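/- **Setting.** Let $\mathcal H$ be a complex Hilbert space, let $C_{ik}^j\in\mathbb C$ $(1\le i,j,k\le n)$, and let $\mathsf C_k=[C_{ik}^j]$ be the matrix with entry $C_{ik}^j$ in row $i$ and column $j$. For an $n\times n$ matrix $A$, $A(e^A-I)^{-1}$ denotes the inverse of $\frac{e^A-I}{A}:=\sum_{m\ge0}\frac{A^m}{(m+1)!}$, where that matrix is invertible. Repeated indices are summed. Matrix inequalities $\ge$ are in the sense of Hermitian nonnegative definiteness. Operators may be unbounded. A density operator is written $\varrho_0=\sum_j|\psi_j\rangle\langle\psi_j|$ with $\sum_j\|\psi_j\|^2=1$, and $\mathrm{Tr}\,(ab^*\varrho)=\sum_j\langle a^*\varphi_j,b^*\varphi_j\rangle$ for $\varrho=\sum_j|\varphi_j\rangle\langle\varphi_j|$. A measurement is a positive operator-valued measure $\Pi$ of total mass $\hat 1$ on a measurable space; the outcome in the state $\varrho$ has distribution $\mathrm{Tr}\,\varrho\,\Pi(\cdot)$. Estimates are measurable functions $\lambda_i$ of the outcome. At each parameter point considered, the second moments of the estimates are assumed to be bounded in a neighbourhood of that point, and the estimates to be unbiased in a neighbourhood of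 it. **1. General generators.** Let $x_1,\dots,x_n$ be linear operators of a dense subspace $\mathcal E\subseteq\mathcal H$ into itself with $x_ix_k-x_kx_i=C_{ik}^j x_j$, and let $\mathcal D$ be a subspace contained in the domains of the adjoints $x_k^*$ and mapped into itself by them. Let $\psi_j\in\mathcal D$, $\sum_j\|\psi_j\|^2=1$, be jointly analytic for $x_1^*,\dots,x_n^*$ in the polydisc of radius $r>0$: $$\sum_{m\ge0}\frac{r^m}{m!}\sum_{k_1,\dots,k_m}\Bigl(\sum_j\|x_{k_1}^*\cdots x_{k_m}^*\psi_j\|^2\Bigr)^{1/2}<\infty .$$ For $\beta\in\mathbb C^n$ with $|\beta^k|<r$ for all $k$, let $$\varrho(\beta,\bar\beta)=\chi^{-1}e^{\beta^kx_k^*}\varrho_0\,e^{\bar\beta^kx_k},\qquad \chi=\mathrm{Tr}\,\varrho_0e^{\bar\beta^kx_k}e^{\beta^kx_k^*},$$ the exponentials acting on the $\psi_j$ by their power series. Put $\mathsf K(\bar\beta)=\bar\beta^k\mathsf C_k\,(e^{\bar\beta^k\mathsf C_k}-I)^{-1}$, which exists for all $\beta$ in a neighbourhood of $0$; in general put $\mathsf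 K^{-1}=(e^{A}-I)/A$ with $A=\bar\beta^k\mathsf C_k$. Let $\mathsf S=[S_{ik}]$, $S_{ik}=\mathrm{Tr}\,(x_i-\mu_i)(x_k-\mu_k)^*\varrho(\beta,\bar\beta)$, $\mu_i=\mathrm{Tr}\,x_i\varrho(\beta,\bar\beta)$. Then $\varrho(\beta,\bar\beta)$ is a density operator in which the $x_k$ have finite second moments, and, with the Wirtinger derivatives $\partial/\partial\beta^k$: * the operators $h_k=x_k(\bar\beta)-\mathrm{Tr}\,x_k(\bar\beta)\varrho$, where $x_k(\bar\beta)=(\mathsf K^{-1})_k^{\,j}x_j$, are right logarithmic derivatives: $h_k^*\varrho=\partial\varrho/\partial\beta^k$ (equivalently $\varrho h_k=\partial\varrho/\partial\bar\beta^k$); * for all densely defined right logarithmic derivatives $h_k$, the right Fisher information $\mathsf H=[\mathrm{Tr}\,h_kh_l^*\varrho]$ equals $\mathsf K^{-1}\mathsf S\,(\mathsf K^{-1})^\dagger$; * if $\mathsf K^{-1}$ and $\mathsf S$ are nonsingular at $\beta$, then for every measurement and all complex estimates $\lambda_1,\dots,\lambda_m$ that are unbiased for functions $\vartheta_i(\beta,\bar\beta)$,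 real-differentiable at the point, $$\mathsf R\ge\mathsf D\,\mathsf K^\dagger\mathsf S^{-1}\mathsf K\,\mathsf D^\dagger,\qquad \mathsf R=\bigl[\mathsf M[(\lambda_i-\vartheta_i)\overline{(\lambda_j-\vartheta_j)}]\bigr],\quad \mathsf D=[\partial\vartheta_i/\partial\beta^k].$$ **2. Hermitian generators.** Let $\hbar>0$, let $s_i$ be operators of a dense subspace $\mathcal E$ into itself with $s_is_k-s_ks_i=C_{ik}^js_j$, and put $\mathsf K_\theta=\frac{i}{\hbar}\theta_k\mathsf C_k\,(e^{\frac{i}{\hbar}\theta_k\mathsf C_k}-I)^{-1}$ for $\theta\in\mathbb R^n$. Let $\mathsf R_\theta=[\mathsf M_\theta[(\lambda_i-\theta_i)(\lambda_k-\theta_k)]]$ for real estimates $\lambda_1,\dots,\lambda_n$ in the state $\varrho_\theta=e^{i\theta_ks_k/\hbar}\varrho_0e^{-i\theta_ks_k/\hbar}$. (a) Let the $s_k$ be symmetric on $\mathcal E$ and $\psi_j\in\mathcal E$ jointly analytic for them in the polydisc of radius $r$; let $|\theta_k|/\hbar<r$. If the estimates are unbiased for $\theta_i=\hbar\,\mathrm{Im}\,\beta^i$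 on the family $\varrho(\beta,\bar\beta)$ of part 1 (with $x_k=s_k$) for $\beta$ near $i\theta/\hbar$, then $$\mathsf R_\theta\ge\frac{\hbar^2}{4}\,\mathsf K_\theta^{\top}\mathsf S_0^{-1}\mathsf K_\theta,\qquad \mathsf S_0=[\mathrm{Tr}\,\tilde s_i\tilde s_k\varrho_0],\quad \tilde s_i=s_i-\mathrm{Tr}\,s_i\varrho_0,$$ whenever $\mathsf K_\theta$ exists and $\mathsf S_0$ is nonsingular. (b) Let the $s_k$ be the generators of a unitary representation of a Lie group in canonical coordinates: $U(\theta)=e^{i\theta_ks_k/\hbar}$ are unitary, each $t\mapsto U(t\theta)$ is a strongly continuous one-parameter group with generator $\theta_ks_k/\hbar$ on $\mathcal E$, each $U(\theta)$ maps $\mathcal E$ into itself, and $t\mapsto s_kU(t\theta)v$ is continuous for $v\in\mathcal E$. Let $\varrho_0$ be any density operator with finite second moments of the (closed) generators. If the estimates are unbiased for $\theta$ only on the unitary family $\varrho_\theta=U(\theta)\varrho_0U(\theta)^*$, then the same inequality holds with the symmetric covariances $\mathsf S_0=[\mathrm{Tr}\,\tfrac12(\tilde s_i\tilde s_k+\tilde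 s_k\tilde s_i)\varrho_0]$, whenever $\mathsf K_\theta$ exists and this $\mathsf S_0$ is nonsingular. -/

import Mathlib

open scoped ENNReal NNReal Topology ComplexConjugate Matrix ComplexOrder

noncomputable section

namespace LieBound

/-! ### Generalised measurements -/

/-- A quantum probability measure (positive operator-valued measure) on a measurable space `X`:
a weakly countably additive map from measurable sets to positive operators, of total mass `1`. -/
structure QPM (X : Type*) [MeasurableSpace X] (H : Type*) [NormedAddCommGroup H]
    [InnerProductSpace ℂ H] [CompleteSpace H] where
  toFun : Set X → H →L[ℂ] H
  isPositive : ∀ s, MeasurableSet s → (toFun s).IsPositive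
  univ : toFun Set.univ = 1
  hasSum_iUnion : ∀ f : ℕ → Set X, (∀ i, MeasurableSet (f i)) →
    Pairwise (Function.onFun Disjoint f) → ∀ v w : H,
    HasSum (fun i => inner ℂ v (toFun (f i) w)) (inner ℂ v (toFun (⋃ i, f i) w))

theorem QPM.empty {X : Type*} [MeasurableSpace X] {H : Type*} [NormedAddCommGroup H]
    [InnerProductSpace ℂ H] [CompleteSpace H] (P : QPM X H) (v w : H) :
    inner ℂ v (P.toFun ∅ w) = 0 := by
  have h := (P.hasSum_iUnion (fun _ => ∅) (fun _ => MeasurableSet.empty)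
    (fun _ _ _ => by simp [Function.onFun]) v w).summable
  exact (summable_const_iff _).1 h

/-- The finite measure `A ↦ ⟨v, Π(A) v⟩`. -/
def QPM.vecMeasure {X : Type*} [MeasurableSpace X] {H : Type*} [NormedAddCommGroup H]
    [InnerProductSpace ℂ H] [CompleteSpace H] (P : QPM X H) (v : H) :
    MeasureTheory.Measure X :=
  MeasureTheory.Measure.ofMeasurable
    (fun s _ => ENNReal.ofReal (inner ℂ v (P.toFun s v)).re)
    (by simp [P.empty])
    (by
      intro f hf hd
      have h := Complex.hasSum_re (P.hasSum_iUnion f hf hd v v)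
      have hn : ∀ i, 0 ≤ (inner ℂ v (P.toFun (f i) v)).re := fun i =>
        (P.isPositive (f i) (hf i)).re_inner_nonneg_right v
      rw [← h.tsum_eq, ENNReal.ofReal_tsum_of_nonneg hn h.summable])

/-- The distribution `A ↦ Tr (ρ Π(A)) = ∑ⱼ ⟨φⱼ, Π(A) φⱼ⟩` of the outcome in the state
`ρ = ∑ⱼ |φⱼ⟩⟨φⱼ|`. -/
def QPM.law {X : Type*} [MeasurableSpace X] {H : Type*} [NormedAddCommGroup H]
    [InnerProductSpace ℂ H] [CompleteSpace H] {ι : Type*} (P : QPM X H) (φ : ι → H) :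
    MeasureTheory.Measure X :=
  MeasureTheory.Measure.sum fun j => P.vecMeasure (φ j)

/-! ### States and (possibly unbounded) operators

A density operator is written as `ρ = ∑ⱼ |φⱼ⟩⟨φⱼ|` with `∑ⱼ ‖φⱼ‖² = 1`; every density operator
has this form. -/

section Operators

variable {H : Type*} [NormedAddCommGroup H] [InnerProductSpace ℂ H] [CompleteSpace H]

/-- The operator `∑ⱼ |φⱼ⟩⟨φⱼ|`. -/
def mixture {ι : Type*} (φ : ι → H) : H →L[ℂ] H :=
  ∑' j, InnerProductSpace.rankOne ℂ (φ j) (φ j)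

/-- An operator defined on the subspace `E` and mapping it to itself, as an operator in `H`. -/
def opOn {E : Submodule ℂ H} (a : Module.End ℂ E) : H →ₗ.[ℂ] H :=
  ⟨E, E.subtype ∘ₗ a⟩

open Classical in
/-- `a* v`, extended by `0` outside the domain of the Hilbert space adjoint `a*`. -/
def adjApply (a : H →ₗ.[ℂ] H) (v : H) : H :=
  if hv : v ∈ a.adjoint.domain then a.adjoint ⟨v, hv⟩ else 0

/-- `Tr (a ρ)` for `ρ = ∑ⱼ |φⱼ⟩⟨φⱼ|`. -/
def expect {ι : Type*} (φ : ι → H) (a : H →ₗ.[ℂ] H) : ℂ :=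
  ∑' j, inner ℂ (adjApply a (φ j)) (φ j)

/-- `Tr (a b* ρ)` for `ρ = ∑ⱼ |φⱼ⟩⟨φⱼ|`. -/
def moment {ι : Type*} (φ : ι → H) (a b : H →ₗ.[ℂ] H) : ℂ :=
  ∑' j, inner ℂ (adjApply a (φ j)) (adjApply b (φ j))

/-- `a - Tr (a ρ)`. -/
def centered {ι : Type*} (φ : ι → H) {E : Submodule ℂ H} (a : Module.End ℂ E) :
    Module.End ℂ E :=
  a - expect φ (opOn a) • (1 : Module.End ℂ E)

/-- The covariance matrix `S_{ik} = Tr ((x_i - μ_i) (x_k - μ_k)* ρ)`, `μ_i = Tr (x_i ρ)`. -/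
def covMatrix {ι : Type*} {n : ℕ} (φ : ι → H) {E : Submodule ℂ H}
    (x : Fin n → Module.End ℂ E) : Matrix (Fin n) (Fin n) ℂ :=
  Matrix.of fun i k => moment φ (opOn (centered φ (x i))) (opOn (centered φ (x k)))

/-! ### Canonical families -/

/-- `exp (∑ₖ zₖ yₖ) v`, by its power series. -/
def expVec {n : ℕ} {D : Submodule ℂ H} (y : Fin n → Module.End ℂ D) (z : Fin n → ℂ) (v : D) : H :=
  ∑' m : ℕ, ((Nat.factorial m : ℂ))⁻¹ • ((((∑ k, z k • y k) ^ m) v : D) : H)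

/-- The family `ψ` is jointly analytic for `y₁, …, yₙ` in the polydisc of radius `r`:
`∑_w (r ^ |w| / |w|!) (∑ⱼ ‖y_w ψⱼ‖²)^{1/2} < ∞`, the sum being over all words
`y_w = y_{w₁} ⋯ y_{w_m}`. -/
def JointlyAnalytic {ι : Type*} {n : ℕ} {D : Submodule ℂ H} (y : Fin n → Module.End ℂ D)
    (ψ : ι → D) (r : ℝ) : Prop :=
  (∀ w : List (Fin n), Summable fun j => ‖(((w.map y).prod (ψ j) : D) : H)‖ ^ 2) ∧
  Summable fun w : List (Fin n) =>
    r ^ w.length / (Nat.factorial w.length : ℝ) * √(∑' j, ‖(((w.map y).prod (ψ j) : D) : H)‖ ^ 2)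

/-- The generating function `χ(β) = ∑ⱼ ‖exp (βᵏ x_k*) ψⱼ‖²`, with `y_k` standing for `x_k*`. -/
def genFun {ι : Type*} {n : ℕ} {D : Submodule ℂ H} (y : Fin n → Module.End ℂ D)
    (ψ : ι → D) (β : Fin n → ℂ) : ℝ :=
  ∑' j, ‖expVec y β (ψ j)‖ ^ 2

/-- The vectors `φⱼ(β) = χ(β)^{-1/2} exp (βᵏ x_k*) ψⱼ`, so that
`∑ⱼ |φⱼ(β)⟩⟨φⱼ(β)| = χ(β)⁻¹ exp (βᵏ x_k*) ρ₀ exp (β̄ᵏ x_k)` for `ρ₀ = ∑ⱼ |ψⱼ⟩⟨ψⱼ|`. -/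
def canonVec {ι : Type*} {n : ℕ} {D : Submodule ℂ H} (y : Fin n → Module.End ℂ D)
    (ψ : ι → D) (β : Fin n → ℂ) (j : ι) : H :=
  (((√(genFun y ψ β))⁻¹ : ℝ) : ℂ) • expVec y β (ψ j)

/-- The canonical density operator `χ(β)⁻¹ exp (βᵏ x_k*) ρ₀ exp (β̄ᵏ x_k)`. -/
def canonState {ι : Type*} {n : ℕ} {D : Submodule ℂ H} (y : Fin n → Module.End ℂ D)
    (ψ : ι → D) (β : Fin n → ℂ) : H →L[ℂ] H :=
  mixture (canonVec y ψ β)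

/-! ### Right logarithmic derivatives -/

/-- The Wirtinger derivative `∂f/∂βᵏ = ½ (∂f/∂(Re βᵏ) - i ∂f/∂(Im βᵏ))`. -/
def wirtinger {n : ℕ} {F : Type*} [NormedAddCommGroup F] [NormedSpace ℂ F]
    (f : (Fin n → ℂ) → F) (β : Fin n → ℂ) (k : Fin n) : F :=
  (2⁻¹ : ℂ) • (fderiv ℝ f β (Pi.single k 1) - Complex.I • fderiv ℝ f β (Pi.single k Complex.I))

/-- `h₁, …, hₙ` are right logarithmic derivatives of `ρ` at `β`: `h_k* ρ = ∂ρ/∂βᵏ` (equivalently,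
taking adjoints, `ρ h_k = ∂ρ/∂β̄ᵏ` on the domain of `h_k`). -/
def IsRightLogDeriv {n : ℕ} (ρ : (Fin n → ℂ) → H →L[ℂ] H) (β : Fin n → ℂ)
    (h : Fin n → H →ₗ.[ℂ] H) : Prop :=
  DifferentiableAt ℝ ρ β ∧ ∀ k, Dense ((h k).domain : Set H) ∧
    ∀ v, ∃ hv : ρ β v ∈ (h k).adjoint.domain,
      (h k).adjoint ⟨ρ β v, hv⟩ = wirtinger ρ β k v

/-- The right Fisher information `H_{kl} = Tr (h_k h_l* ρ)`, `ρ = ∑ⱼ |φⱼ⟩⟨φⱼ|`. -/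
def rightFisher {ι : Type*} {n : ℕ} (φ : ι → H) (h : Fin n → H →ₗ.[ℂ] H) :
    Matrix (Fin n) (Fin n) ℂ :=
  Matrix.of fun k l => moment φ (h k) (h l)

end Operators

/-! ### The matrix `K` -/

/-- `∑ₖ zᵏ C_k`, where `C_k` is the matrix with entry `C_{ik}^j` in row `i` and column `j`. -/
def adMatrix {n : ℕ} (C : Fin n → Fin n → Fin n → ℂ) (z : Fin n → ℂ) :
    Matrix (Fin n) (Fin n) ℂ :=
  ∑ k, z k • Matrix.of fun i j => C i k j

/-- `(e^A - I) A⁻¹`, that is `∑ₘ A^m / (m+1)!`. -/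
def expQuot {n : ℕ} (A : Matrix (Fin n) (Fin n) ℂ) : Matrix (Fin n) (Fin n) ℂ :=
  ∑' m : ℕ, ((Nat.factorial (m + 1) : ℂ))⁻¹ • A ^ m

/-- `A (e^A - I)⁻¹`, the inverse of `∑ₘ A^m / (m+1)!` where that matrix is invertible. -/
def kMatrix {n : ℕ} (A : Matrix (Fin n) (Fin n) ℂ) : Matrix (Fin n) (Fin n) ℂ :=
  (expQuot A)⁻¹

/-! ### Covariances of estimates, unitary representations -/

/-- `R_{ij} = ∫ (λ_i - ϑ_i) conj (λ_j - ϑ_j) dP`. -/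
def errMatrix {X : Type*} [MeasurableSpace X] {m : ℕ} (P : MeasureTheory.Measure X)
    (est : X → Fin m → ℂ) (ϑ : Fin m → ℂ) : Matrix (Fin m) (Fin m) ℂ :=
  Matrix.of fun i j => ∫ ω, (est ω i - ϑ i) * conj (est ω j - ϑ j) ∂P

/-- `U(θ) = exp (i θᵏ s_k / ħ)` are the operators of a unitary representation with generators
`s_k`, in canonical coordinates `θ`. Here `E` is an invariant domain of smooth vectors: each
`t ↦ U(tθ)` is a strongly continuous one-parameter group, its generator is `θᵏ s_k / ħ` on `E`,
and `E` is mapped to itself, with `t ↦ s_k U(tθ) v` continuous for `v` in `E`. -/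
structure IsUnitaryRep {H : Type*} [NormedAddCommGroup H] [InnerProductSpace ℂ H] {n : ℕ}
    {E : Submodule ℂ H} (hbar : ℝ) (s : Fin n → Module.End ℂ E)
    (U : (Fin n → ℝ) → (H ≃ₗᵢ[ℂ] H)) : Prop where
  map_add : ∀ (θ : Fin n → ℝ) (a b : ℝ) (v : H), U ((a + b) • θ) v = U (a • θ) (U (b • θ) v)
  continuous : ∀ (θ : Fin n → ℝ) (v : H), Continuous fun t : ℝ => U (t • θ) v
  hasDerivAt : ∀ (θ : Fin n → ℝ) (v : E), HasDerivAt (fun t : ℝ => U (t • θ) (v : H))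
    ((Complex.I / (hbar : ℂ)) • ∑ k, (θ k : ℂ) • ((s k v : E) : H)) 0
  mapsTo : ∀ (θ : Fin n → ℝ) (v : E), U θ (v : H) ∈ E
  continuous_gen : ∀ (θ : Fin n → ℝ) (v : E) (k : Fin n),
    Continuous fun t : ℝ => ((s k ⟨U (t • θ) (v : H), mapsTo (t • θ) v⟩ : E) : H)

end LieBound

end

/-! A mixed state ∑ⱼ |φⱼ⟩⟨φⱼ| is treated as one vector Φ = (φⱼ) of the Hilbert sum ℓ²(ι, H), with
the measurement acting on each component. The outcome law becomes ⟨Φ, T(A) Φ⟩, so every state is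
pure, and covariance matrices become Gram matrices of the parts of the vectors x_k* Φ orthogonal to
Φ.

The statistical input is `exists_moment_vectors`. Formally an estimate f is the operator F = ∫ f dT,
and a = F* u, b = F u satisfy ‖a‖², ‖b‖² ≤ ∫ |f|² dμ_u. Along a differentiable curve Φ through u
with locally bounded second moments the mean of f has derivative ⟨Φ', b⟩ + ⟨a, Φ'⟩. No dilation is
needed: for simple f the bound is Cauchy–Schwarz for the positive operators T(A), and the product
rule survives because F Φ(t) stays bounded and is weakly continuous at the base point.

For a normalised holomorphic family Φ(β) the derivative in the k-th direction is a vector w_k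
orthogonal to Φ, up to an imaginary multiple of Φ which no state sees. Hence ∂ρ/∂βᵏ = |w_k⟩⟨Φ| and
∂ϑ/∂βᵏ = ⟨a, w_k⟩, and Cauchy–Schwarz for a and ∑ x_k w_k with the best x gives R ≥ D G⁻¹ D†, where
G is the Gram matrix of w. To find w, put a = ∑ βᵏ y_k. Left and right multiplication by a commute,
and their difference ad a acts linearly on the span of the y_k. Expanding powers in ad a gives ∂_k
eᵃψ = ∑ⱼ conj(Q_kj) yⱼ eᵃψ with Q = (e^A - 1)/A, so G = Q S Q†. A right logarithmic derivative must
satisfy h_k* φⱼ = (w_k)ⱼ, hence its Fisher information is again G. The normalisation is possible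
because the exponential is injective on analytic vectors.

For Hermitian generators at β = iθ/ħ the exponential is isometric, so S = e^A S₀ (e^A)†; since the
matrix Q there is that of -A, the identity Q(-A) e^A = Q(A) yields the stated K. A nonsingular S₀
makes the generators independent, whence the structure constants are imaginary and K is real. The
derivative matrix of ħ Im β is -(iħ/2) I, which gives ħ²/4.

On a unitary orbit alone nothing is analytic. Duhamel's formula along t ↦ U(tθ') U((1-t)θ) ψ is
proved weakly against the smooth domain and then read as an integral of a continuous function; it
yields the same w up to the factor i/ħ. Without a holomorphic derivative both terms ⟨w, b⟩ + ⟨a, w⟩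
remain, and (‖a‖ + ‖b‖)² ≤ 4 ∫ |f|² again produces the factor ħ²/4, now with the real part of the
covariance matrix. -/

noncomputable section

namespace LieBound

open MeasureTheory Filter

/-! ### Operator integrals of estimates and differentiability of their means -/

section Measurement

variable {X : Type*} [MeasurableSpace X] {V : Type*} [NormedAddCommGroup V] [InnerProductSpace ℂ V]

/-- A finitely additive positive operator-valued set function `T` of total mass `1`, together with
the measures `μ u : A ↦ ⟨u, T(A) u⟩`. -/
structure IsOutcomeFamily (T : Set X → V →L[ℂ] V) (μ : V → Measure X) : Prop where
  isPositive : ∀ s, MeasurableSet s → (T s).IsPositive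
  union : ∀ s t, MeasurableSet s → MeasurableSet t → Disjoint s t → T (s ∪ t) = T s + T t
  univ : T Set.univ = 1
  apply : ∀ u s, MeasurableSet s → μ u s = ENNReal.ofReal (inner ℂ u (T s u)).re

/-- Cauchy–Schwarz for the form ⟨v, S u⟩, which may be degenerate; hence the
`PreInnerProductSpace.Core`. -/
theorem norm_inner_le_sqrt_mul_sqrt_of_isPositive {S : V →L[ℂ] V}
    (hS : S.IsPositive) (v u : V) :
    ‖inner ℂ v (S u)‖ ≤ √(inner ℂ v (S v)).re * √(inner ℂ u (S u)).re := by
  let c : PreInnerProductSpace.Core ℂ V :=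
    { inner := fun v u => inner ℂ v (S u)
      conj_inner_symm := fun v u => by
        rw [inner_conj_symm]; exact hS.isSymmetric v u
      re_inner_nonneg := fun v => hS.re_inner_nonneg_right v
      add_left := fun _ _ _ => inner_add_left _ _ _
      smul_left := fun _ _ _ => inner_smul_left _ _ _ }
  have h := @InnerProductSpace.Core.inner_mul_inner_self_le ℂ V _ _ _ c v u
  have h1 : ‖inner ℂ u (S v)‖ = ‖inner ℂ v (S u)‖ := by
    rw [← inner_conj_symm, RCLike.norm_conj]
    congr 1; exact hS.isSymmetric v u
  have h2 : ‖inner ℂ v (S u)‖ * ‖inner ℂ u (S v)‖ ≤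
    (inner ℂ v (S v)).re * (inner ℂ u (S u)).re := h
  rw [h1] at h2
  have a1 : 0 ≤ (inner ℂ v (S v)).re := hS.re_inner_nonneg_right v
  rw [← Real.sqrt_mul a1]
  exact Real.le_sqrt_of_sq_le (by rw [sq]; exact h2)

namespace IsOutcomeFamily

variable {T : Set X → V →L[ℂ] V} {μ : V → Measure X}

theorem isFiniteMeasure (hT : IsOutcomeFamily T μ) (u : V) : IsFiniteMeasure (μ u) :=
  ⟨by rw [hT.apply u _ MeasurableSet.univ]; exact ENNReal.ofReal_lt_top⟩

theorem real_apply (hT : IsOutcomeFamily T μ) (u : V) {s : Set X} (hs : MeasurableSet s) :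
    (μ u).real s = (inner ℂ u (T s u)).re := by
  rw [Measure.real, hT.apply u s hs, ENNReal.toReal_ofReal]
  exact (hT.isPositive s hs).re_inner_nonneg_right u

theorem real_univ (hT : IsOutcomeFamily T μ) (u : V) : (μ u).real Set.univ = ‖u‖ ^ 2 := by
  rw [hT.real_apply u MeasurableSet.univ, hT.univ]
  simpa using inner_self_eq_norm_sq (𝕜 := ℂ) u

theorem inner_eq_real (hT : IsOutcomeFamily T μ) (u : V) {s : Set X} (hs : MeasurableSet s) :
    inner ℂ u (T s u) = ((μ u).real s : ℂ) := by
  rw [hT.real_apply u hs]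
  have := (hT.isPositive s hs).inner_nonneg_right u
  exact (Complex.ext (by simp) (by simpa using (Complex.le_def.1 this).2.symm))

end IsOutcomeFamily

/-- `∫ f dT` for a simple function `f`. -/
def opInt (T : Set X → V →L[ℂ] V) (f : SimpleFunc X ℂ) : V →L[ℂ] V :=
  f.setToSimpleFunc fun s => (ContinuousLinearMap.toSpanSingleton ℂ (T s)).restrictScalars ℝ

variable {T : Set X → V →L[ℂ] V} {μ : V → Measure X}

/-- With the zero measure the finiteness conditions are vacuous, so additivity is asked on all
measurable sets. -/
theorem IsOutcomeFamily.finMeasAdditive (hT : IsOutcomeFamily T μ) :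
    FinMeasAdditive (0 : Measure X)
      fun s => (ContinuousLinearMap.toSpanSingleton ℂ (T s)).restrictScalars ℝ := by
  intro s t hs ht _ _ hd
  ext c : 1
  simp [hT.union s t hs ht hd]

theorem opInt_map (hT : IsOutcomeFamily T μ) {G : Type*} [NormedAddCommGroup G]
    (g : SimpleFunc X G) {φ : G → ℂ} (hφ : φ 0 = 0) :
    opInt T (g.map φ) = ∑ c ∈ g.range, φ c • T (g ⁻¹' {c}) := by
  rw [opInt, SimpleFunc.map_setToSimpleFunc _ hT.finMeasAdditive (by simp) hφ]
  rfl

theorem opInt_sub (hT : IsOutcomeFamily T μ) (f g : SimpleFunc X ℂ) :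
    opInt T (f - g) = opInt T f - opInt T g :=
  SimpleFunc.setToSimpleFunc_sub _ hT.finMeasAdditive (by simp) (by simp)

theorem integral_map_eq_sum {ν : Measure X} [IsFiniteMeasure ν] {G E : Type*}
    [NormedAddCommGroup G] [NormedAddCommGroup E] [NormedSpace ℝ E] [CompleteSpace E]
    (g : SimpleFunc X G) {φ : G → E} (hφ : φ 0 = 0) :
    ∫ x, φ (g x) ∂ν = ∑ c ∈ g.range, ν.real (g ⁻¹' {c}) • φ c := by
  rw [← SimpleFunc.map_integral g φ (SimpleFunc.integrable_of_isFiniteMeasure g) hφ,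
    SimpleFunc.integral_eq_integral _ (SimpleFunc.integrable_of_isFiniteMeasure _)]
  rfl

theorem inner_opInt_self (hT : IsOutcomeFamily T μ) (f : SimpleFunc X ℂ) (u : V) :
    inner ℂ u (opInt T f u) = ∫ x, f x ∂(μ u) := by
  have := hT.isFiniteMeasure u
  have h1 := opInt_map hT f (φ := fun c => c) rfl
  have h2 := integral_map_eq_sum (ν := μ u) f (φ := fun c : ℂ => c) rfl
  rw [show f.map (fun c => c) = f from rfl] at h1
  rw [h1, h2, _root_.sum_apply, inner_sum]
  refine Finset.sum_congr rfl fun c _ => ?_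
  rw [_root_.smul_apply, inner_smul_right,
    hT.inner_eq_real u (f.measurableSet_fiber c), mul_comm]
  simp

theorem inner_opInt_left (hT : IsOutcomeFamily T μ) (f : SimpleFunc X ℂ) (v u : V) :
    inner ℂ (opInt T (f.map conj) v) u = inner ℂ v (opInt T f u) := by
  have h1 := opInt_map hT f (φ := fun c => c) rfl
  rw [show f.map (fun c => c) = f from rfl] at h1
  rw [h1, opInt_map hT f (map_zero _), _root_.sum_apply,
    _root_.sum_apply, inner_sum, sum_inner]
  refine Finset.sum_congr rfl fun c _ => ?_
  rw [_root_.smul_apply, _root_.smul_apply, inner_smul_right,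
    inner_smul_left, Complex.conj_conj]
  congr 1
  exact (hT.isPositive _ (f.measurableSet_fiber c)).isSymmetric v u

/-- Cauchy–Schwarz in every cell of the common partition of f and h, then once more for the sum over
cells. The freedom to assign one factor to u and the other to v is what later makes the
approximation error small for arbitrary v. -/
theorem norm_inner_opInt_mul_le (hT : IsOutcomeFamily T μ) (f h : SimpleFunc X ℂ) (v u : V) :
    ‖inner ℂ v (opInt T (f * h) u)‖ ≤
      √(∫ x, ‖f x‖ ^ 2 ∂(μ u)) * √(∫ x, ‖h x‖ ^ 2 ∂(μ v)) := by
  have := hT.isFiniteMeasure u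
  have := hT.isFiniteMeasure v
  have h1 : opInt T (f * h) = ∑ c ∈ (f.pair h).range, (c.1 * c.2) • T ((f.pair h) ⁻¹' {c}) :=
    opInt_map hT (f.pair h) (φ := fun c => c.1 * c.2) (by simp)
  have h2 := integral_map_eq_sum (ν := μ u) (f.pair h) (φ := fun c => ‖c.1‖ ^ 2) (by simp)
  have h3 := integral_map_eq_sum (ν := μ v) (f.pair h) (φ := fun c => ‖c.2‖ ^ 2) (by simp)
  simp only [SimpleFunc.pair_apply] at h2 h3
  rw [h1, h2, h3, _root_.sum_apply, inner_sum]
  refine (norm_sum_le _ _).trans (le_trans (Finset.sum_le_sum fun c _ => ?_)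
    (Real.sum_sqrt_mul_sqrt_le _ (fun c => by simp only [smul_eq_mul]; positivity)
      (fun c => by simp only [smul_eq_mul]; positivity)))
  have hm := (f.pair h).measurableSet_fiber c
  have := norm_inner_le_sqrt_mul_sqrt_of_isPositive (hT.isPositive _ hm) v u
  rw [← hT.real_apply u hm, ← hT.real_apply v hm] at this
  rw [_root_.smul_apply, inner_smul_right, norm_mul, norm_mul, smul_eq_mul,
    smul_eq_mul, Real.sqrt_mul measureReal_nonneg, Real.sqrt_mul measureReal_nonneg,
    Real.sqrt_sq (norm_nonneg _), Real.sqrt_sq (norm_nonneg _)]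
  calc ‖c.1‖ * ‖c.2‖ * ‖inner ℂ v (T ((f.pair h) ⁻¹' {c}) u)‖ ≤ ‖c.1‖ * ‖c.2‖ *
      (√((μ v).real ((f.pair h) ⁻¹' {c})) * √((μ u).real ((f.pair h) ⁻¹' {c}))) := by gcongr
    _ = _ := by ring

/-- The case h = 1, v = `opInt T f u`, divided by ‖v‖. It takes the place of a dilation to a
projection-valued measure. -/
theorem norm_opInt_le (hT : IsOutcomeFamily T μ) (f : SimpleFunc X ℂ) (u : V) :
    ‖opInt T f u‖ ≤ √(∫ x, ‖f x‖ ^ 2 ∂(μ u)) := by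
  have h := norm_inner_opInt_mul_le hT f 1 (opInt T f u) u
  rw [mul_one] at h
  simp only [SimpleFunc.coe_one, Pi.one_apply, norm_one, one_pow, integral_const, smul_eq_mul,
    mul_one, hT.real_univ, Real.sqrt_sq (norm_nonneg _)] at h
  rw [inner_self_eq_norm_sq_to_K, norm_pow, RCLike.norm_ofReal, abs_norm] at h
  rcases eq_or_lt_of_le (norm_nonneg (opInt T f u)) with h0 | h0
  · rw [← h0]; positivity
  · exact le_of_mul_le_mul_right (by rwa [← sq]) h0

variable {f : X → ℂ} {s : ℕ → SimpleFunc X ℂ}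

theorem tendsto_integral_norm_sq_sub {ν : Measure X}
    (hb : ∀ n x, ‖s n x‖ ≤ 2 * ‖f x‖) (hs : ∀ x, Tendsto (fun n => s n x) atTop (𝓝 (f x)))
    (hf2 : Integrable (fun x => ‖f x‖ ^ 2) ν) :
    Tendsto (fun p : ℕ × ℕ => ∫ x, ‖(s p.1 - s p.2) x‖ ^ 2 ∂ν) atTop (𝓝 0) := by
  have h := tendsto_integral_filter_of_dominated_convergence (μ := ν) (l := atTop)
    (F := fun (p : ℕ × ℕ) x => ‖(s p.1 - s p.2) x‖ ^ 2) (f := fun _ => (0 : ℝ))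
    -- 16 = (2 + 2)², since both approximants are bounded by 2‖f‖.
    (fun x => 16 * ‖f x‖ ^ 2)
    (Eventually.of_forall fun p => ((s p.1 - s p.2).measurable.norm.pow_const 2).aestronglyMeasurable)
    (Eventually.of_forall fun p => Eventually.of_forall fun x => by
      rw [Real.norm_of_nonneg (by positivity), SimpleFunc.coe_sub, Pi.sub_apply]
      calc ‖s p.1 x - s p.2 x‖ ^ 2 ≤ (2 * ‖f x‖ + 2 * ‖f x‖) ^ 2 := by
            gcongr; exact (norm_sub_le _ _).trans (add_le_add (hb _ _) (hb _ _))
        _ = _ := by ring)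
    (hf2.const_mul 16)
    (Eventually.of_forall fun x => by
      have h1 : Tendsto (fun p : ℕ × ℕ => s p.1 x - s p.2 x) atTop (𝓝 (f x - f x)) := by
        rw [← prod_atTop_atTop_eq]
        exact ((hs x).comp tendsto_fst).sub ((hs x).comp tendsto_snd)
      simpa using (h1.norm.pow 2))
  simpa using h

/-- The vector τ plays the role of (∫ f dT) u: `norm_opInt_le` turns convergence in L²(μ u) into
convergence in norm. -/
theorem exists_tendsto_opInt [CompleteSpace V] (hT : IsOutcomeFamily T μ) (hf : Measurable f)
    (hb : ∀ n x, ‖s n x‖ ≤ 2 * ‖f x‖) (hs : ∀ x, Tendsto (fun n => s n x) atTop (𝓝 (f x)))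
    {u : V} (hf2 : Integrable (fun x => ‖f x‖ ^ 2) (μ u)) :
    ∃ τ : V, Tendsto (fun n => opInt T (s n) u) atTop (𝓝 τ) ∧
      ‖τ‖ ^ 2 ≤ ∫ x, ‖f x‖ ^ 2 ∂(μ u) ∧ inner ℂ u τ = ∫ x, f x ∂(μ u) := by
  have hfin := hT.isFiniteMeasure u
  have hc : CauchySeq fun n => opInt T (s n) u := by
    rw [cauchySeq_iff_tendsto_dist_atTop_0]
    refine squeeze_zero (fun _ => dist_nonneg) (fun p => ?_)
      (by simpa using (tendsto_integral_norm_sq_sub hb hs hf2).sqrt)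
    rw [dist_eq_norm, ← _root_.sub_apply, ← opInt_sub hT]
    exact norm_opInt_le hT _ u
  obtain ⟨τ, hτ⟩ := cauchySeq_tendsto_of_complete hc
  refine ⟨τ, hτ, ?_, ?_⟩
  · refine le_of_tendsto_of_tendsto (hτ.norm.pow 2)
      (g := fun n => ∫ x, ‖s n x‖ ^ 2 ∂(μ u)) ?_ (Eventually.of_forall fun n => ?_)
    · refine tendsto_integral_of_dominated_convergence (fun x => 4 * ‖f x‖ ^ 2)
        (fun n => ((s n).measurable.norm.pow_const 2).aestronglyMeasurable)
        (hf2.const_mul 4) (fun n => Eventually.of_forall fun x => ?_)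
        (Eventually.of_forall fun x => (hs x).norm.pow 2)
      rw [Real.norm_of_nonneg (by positivity)]
      calc ‖s n x‖ ^ 2 ≤ (2 * ‖f x‖) ^ 2 := by gcongr; exact hb n x
        _ = _ := by ring
    · have := norm_opInt_le hT (s n) u
      calc ‖opInt T (s n) u‖ ^ 2 ≤ √(∫ x, ‖s n x‖ ^ 2 ∂(μ u)) ^ 2 := by gcongr
        _ = _ := Real.sq_sqrt (integral_nonneg fun x => by positivity)
  · refine tendsto_nhds_unique (tendsto_const_nhds.inner hτ) ?_
    simp_rw [inner_opInt_self hT]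
    have hL : MemLp f 2 (μ u) :=
      (memLp_two_iff_integrable_sq_norm hf.aestronglyMeasurable).2 hf2
    refine tendsto_integral_of_dominated_convergence (fun x => 2 * ‖f x‖)
      (fun n => (s n).measurable.aestronglyMeasurable)
      ((hL.integrable (by norm_num)).norm.const_mul 2)
      (fun n => Eventually.of_forall fun x => hb n x) (Eventually.of_forall hs)

/-- The relative error of the approximation of `f` by `s n`. -/
def relErr (f : X → ℂ) (s : ℕ → SimpleFunc X ℂ) (n : ℕ) (x : X) : ℂ :=
  (f x - s n x) / ((‖f x‖ + ‖s n x‖ : ℝ) : ℂ)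

theorem norm_div_norm_add_norm_le (z w : ℂ) : ‖(z - w) / ((‖z‖ + ‖w‖ : ℝ) : ℂ)‖ ≤ 1 := by
  rw [norm_div, Complex.norm_real, Real.norm_of_nonneg (by positivity)]
  exact div_le_one_of_le₀ (norm_sub_le _ _) (by positivity)

/-- The relative error never exceeds 1, so dominated convergence applies in every finite measure,
even where f has no second moment. Where f vanishes the approximants vanish too and the quotient is
0/0 = 0. -/
theorem tendsto_integral_relErr {ν : Measure X} [IsFiniteMeasure ν] (hf : Measurable f)
    (hb : ∀ n x, ‖s n x‖ ≤ 2 * ‖f x‖) (hs : ∀ x, Tendsto (fun n => s n x) atTop (𝓝 (f x))) :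
    Tendsto (fun n => ∫ x, ‖relErr f s n x‖ ^ 2 ∂ν) atTop (𝓝 0) := by
  have h := tendsto_integral_of_dominated_convergence (μ := ν)
    (F := fun n x => ‖relErr f s n x‖ ^ 2) (f := fun _ => (0 : ℝ)) (fun _ => 1)
    (fun n => by
      unfold relErr
      have := (s n).measurable
      exact Measurable.aestronglyMeasurable (by fun_prop))
    (integrable_const _)
    (fun n => Eventually.of_forall fun x => by
      rw [Real.norm_of_nonneg (by positivity)]
      exact pow_le_one₀ (norm_nonneg _) (norm_div_norm_add_norm_le _ _))
    (Eventually.of_forall fun x => by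
      by_cases hx : f x = 0
      · have : ∀ n, s n x = 0 := fun n => by simpa [hx] using hb n x
        simp [relErr, hx, this]
      · have h1 : Tendsto (fun n => relErr f s n x) atTop
            (𝓝 ((f x - f x) / ((‖f x‖ + ‖f x‖ : ℝ) : ℂ))) := by
          refine (tendsto_const_nhds.sub (hs x)).div
            ((Complex.continuous_ofReal.tendsto _).comp (tendsto_const_nhds.add (hs x).norm)) ?_
          have : 0 < ‖f x‖ := norm_pos_iff.2 hx
          exact_mod_cast (by positivity : ‖f x‖ + ‖f x‖ ≠ 0)
        simpa using h1.norm.pow 2)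
  simpa using h

/-- The difference s m - s n is the product of ‖s m‖ + ‖s n‖, square integrable in the state u, and
a relative error, bounded in the state v. The resulting bound is uniform over all u with a common
bound on the second moment, for any v. -/
theorem norm_inner_sub_opInt_le [CompleteSpace V] (hT : IsOutcomeFamily T μ)
    (hb : ∀ n x, ‖s n x‖ ≤ 2 * ‖f x‖) (hs : ∀ x, Tendsto (fun n => s n x) atTop (𝓝 (f x)))
    {u : V} (hf2 : Integrable (fun x => ‖f x‖ ^ 2) (μ u)) {τ : V}
    (hτ : Tendsto (fun n => opInt T (s n) u) atTop (𝓝 τ)) (v : V) (n : ℕ) :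
    ‖inner ℂ v (τ - opInt T (s n) u)‖ ≤
      √(16 * ∫ x, ‖f x‖ ^ 2 ∂(μ u)) * √(∫ x, ‖relErr f s n x‖ ^ 2 ∂(μ v)) := by
  have hfin := hT.isFiniteMeasure v
  have hfin := hT.isFiniteMeasure u
  let p : ℕ → SimpleFunc X ℂ := fun m =>
    ((s m).pair (s n)).map fun z => ((‖z.1‖ + ‖z.2‖ : ℝ) : ℂ)
  let q : ℕ → SimpleFunc X ℂ := fun m =>
    ((s m).pair (s n)).map fun z => (z.1 - z.2) / ((‖z.1‖ + ‖z.2‖ : ℝ) : ℂ)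
  have hpq : ∀ m, s m - s n = p m * q m := by
    intro m
    ext x
    simp only [p, q, SimpleFunc.coe_sub, SimpleFunc.coe_mul, Pi.sub_apply, Pi.mul_apply,
      SimpleFunc.coe_map, Function.comp, SimpleFunc.pair_apply]
    by_cases h : ‖s m x‖ + ‖s n x‖ = 0
    · have h1 : ‖s m x‖ = 0 := by linarith [norm_nonneg (s m x), norm_nonneg (s n x)]
      have h2 : ‖s n x‖ = 0 := by linarith [norm_nonneg (s m x), norm_nonneg (s n x)]
      simp [norm_eq_zero.1 h1, norm_eq_zero.1 h2]
    · rw [mul_div_cancel₀]; exact_mod_cast h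
  have hq : Tendsto (fun m => ∫ x, ‖q m x‖ ^ 2 ∂(μ v)) atTop
      (𝓝 (∫ x, ‖relErr f s n x‖ ^ 2 ∂(μ v))) := by
    refine tendsto_integral_of_dominated_convergence (fun _ => 1)
      (fun m => ((q m).measurable.norm.pow_const 2).aestronglyMeasurable) (integrable_const _)
      (fun m => Eventually.of_forall fun x => ?_) (Eventually.of_forall fun x => ?_)
    · rw [Real.norm_of_nonneg (by positivity)]
      exact pow_le_one₀ (norm_nonneg _) (norm_div_norm_add_norm_le _ _)
    · refine Tendsto.pow (Tendsto.norm ?_) 2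
      change Tendsto (fun m => (s m x - s n x) / ((‖s m x‖ + ‖s n x‖ : ℝ) : ℂ)) atTop _
      by_cases hx : f x = 0
      · have : ∀ n, s n x = 0 := fun n => by simpa [hx] using hb n x
        simp [relErr, hx, this]
      · refine ((hs x).sub tendsto_const_nhds).div
            ((Complex.continuous_ofReal.tendsto _).comp ((hs x).norm.add tendsto_const_nhds)) ?_
        have : 0 < ‖f x‖ := norm_pos_iff.2 hx
        exact_mod_cast (by positivity : ‖f x‖ + ‖s n x‖ ≠ 0)
  refine le_of_tendsto_of_tendsto ((tendsto_const_nhds.inner (hτ.sub tendsto_const_nhds)).norm)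
    (hq.sqrt.const_mul _) (Eventually.of_forall fun m => ?_)
  beta_reduce
  rw [← _root_.sub_apply, ← opInt_sub hT, hpq]
  refine (norm_inner_opInt_mul_le hT _ _ _ _).trans ?_
  refine mul_le_mul_of_nonneg_right (Real.sqrt_le_sqrt ?_) (Real.sqrt_nonneg _)
  rw [← integral_const_mul]
  refine integral_mono_of_nonneg (Eventually.of_forall fun x => by simp only [Pi.zero_apply]; positivity)
    (hf2.const_mul 16)
    (Eventually.of_forall fun x => ?_)
  change ‖((‖s m x‖ + ‖s n x‖ : ℝ) : ℂ)‖ ^ 2 ≤ 16 * ‖f x‖ ^ 2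
  rw [Complex.norm_real, Real.norm_of_nonneg (by positivity)]
  calc (‖s m x‖ + ‖s n x‖) ^ 2 ≤ (2 * ‖f x‖ + 2 * ‖f x‖) ^ 2 := by
        gcongr
        · exact hb _ _
        · exact hb _ _
    _ = _ := by ring

theorem integrable_norm_sq_of_lintegral_le {ν : Measure X} (hf : Measurable f) {M : ℝ≥0}
    (h : ∫⁻ x, ‖f x‖ₑ ^ 2 ∂ν ≤ M) :
    Integrable (fun x => ‖f x‖ ^ 2) ν ∧ ∫ x, ‖f x‖ ^ 2 ∂ν ≤ M := by
  have e : ∀ x, ENNReal.ofReal (‖f x‖ ^ 2) = ‖f x‖ₑ ^ 2 := fun x => by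
    rw [ENNReal.ofReal_pow (norm_nonneg _), ofReal_norm]
  have hm : AEStronglyMeasurable (fun x => ‖f x‖ ^ 2) ν :=
    (hf.norm.pow_const 2).aestronglyMeasurable
  have h1 : ∫⁻ x, ENNReal.ofReal (‖f x‖ ^ 2) ∂ν ≤ M := by simpa only [e] using h
  refine ⟨⟨hm, ?_⟩, ?_⟩
  · rw [hasFiniteIntegral_iff_ofReal (Eventually.of_forall fun x => by positivity)]
    exact h1.trans_lt ENNReal.coe_lt_top
  · rw [integral_eq_lintegral_of_nonneg_ae (Eventually.of_forall fun x => by positivity) hm]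
    exact ENNReal.toReal_le_coe_of_le_coe h1

/-- For an estimate `f` with finite second moment in the pure state `u`, the vectors `a`, `b` stand
for `(∫ f dT)* u`, `(∫ f dT) u`; the mean of `f` is differentiable along every curve of states
on which the second moments of `f` are locally bounded. -/
theorem exists_moment_vectors [CompleteSpace V] (hT : IsOutcomeFamily T μ) (hf : Measurable f)
    {u : V} (hf2 : Integrable (fun x => ‖f x‖ ^ 2) (μ u)) :
    ∃ a b : V, ‖a‖ ^ 2 ≤ ∫ x, ‖f x‖ ^ 2 ∂(μ u) ∧ ‖b‖ ^ 2 ≤ ∫ x, ‖f x‖ ^ 2 ∂(μ u) ∧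
      inner ℂ a u = ∫ x, f x ∂(μ u) ∧ inner ℂ u b = ∫ x, f x ∂(μ u) ∧
      ∀ (Φ : ℝ → V) (Φ' : V), Φ 0 = u → HasDerivAt Φ Φ' 0 →
        (∃ M : ℝ≥0, ∀ᶠ t in 𝓝 0, ∫⁻ x, ‖f x‖ₑ ^ 2 ∂(μ (Φ t)) ≤ M) →
        HasDerivAt (fun t => ∫ x, f x ∂(μ (Φ t))) (inner ℂ Φ' b + inner ℂ a Φ') 0 := by
  let s : ℕ → SimpleFunc X ℂ := SimpleFunc.approxOn f hf Set.univ 0 (Set.mem_univ 0)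
  have hb : ∀ n x, ‖s n x‖ ≤ 2 * ‖f x‖ := fun n x => by
    rw [two_mul]; exact SimpleFunc.norm_approxOn_zero_le hf (Set.mem_univ 0) x n
  have hs : ∀ x, Tendsto (fun n => s n x) atTop (𝓝 (f x)) := fun x =>
    SimpleFunc.tendsto_approxOn hf (Set.mem_univ 0) (by simp)
  obtain ⟨b, hb1, hb2, hb3⟩ := exists_tendsto_opInt hT hf hb hs hf2
  -- The adjoint of ∫ f dT is the integral of the conjugate, approximated by the conjugated simple
  -- functions.
  obtain ⟨a, ha1, ha2, ha3⟩ := exists_tendsto_opInt (s := fun n => (s n).map conj)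
    (f := fun x => conj (f x)) hT (Complex.continuous_conj.measurable.comp hf)
    (fun n x => by simpa using hb n x)
    (fun x => (Complex.continuous_conj.tendsto _).comp (hs x)) (u := u) (by simpa using hf2)
  simp only [RCLike.norm_conj] at ha2
  rw [integral_conj] at ha3
  refine ⟨a, b, ha2, hb2, ?_, hb3, ?_⟩
  · rw [← inner_conj_symm, ha3, Complex.conj_conj]
  rintro Φ Φ' rfl hΦ ⟨M, hM⟩
  have hM' : ∀ᶠ t in 𝓝 (0 : ℝ), Integrable (fun x => ‖f x‖ ^ 2) (μ (Φ t)) ∧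
      ∫ x, ‖f x‖ ^ 2 ∂(μ (Φ t)) ≤ M :=
    hM.mono fun t ht => integrable_norm_sq_of_lintegral_le hf ht
  -- τ t stands for (∫ f dT) Φ(t); the value 0 where the second moment is infinite does not occur
  -- near t = 0.
  have hex : ∀ t, ∃ τ : V, (Integrable (fun x => ‖f x‖ ^ 2) (μ (Φ t))) →
      (Tendsto (fun n => opInt T (s n) (Φ t)) atTop (𝓝 τ) ∧
        ‖τ‖ ^ 2 ≤ ∫ x, ‖f x‖ ^ 2 ∂(μ (Φ t)) ∧ inner ℂ (Φ t) τ = ∫ x, f x ∂(μ (Φ t))) := by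
    intro t
    by_cases h : Integrable (fun x => ‖f x‖ ^ 2) (μ (Φ t))
    · obtain ⟨τ, h⟩ := exists_tendsto_opInt hT hf hb hs h
      exact ⟨τ, fun _ => h⟩
    · exact ⟨0, fun h' => absurd h' h⟩
  choose τ hτ using hex
  have hτ0 : τ 0 = b := tendsto_nhds_unique (hτ 0 hf2).1 hb1
  have hτM : ∀ᶠ t in 𝓝 (0 : ℝ), ‖τ t‖ ≤ √M := by
    filter_upwards [hM'] with t ht
    exact Real.le_sqrt_of_sq_le ((hτ t ht.1).2.1.trans ht.2)
  -- weak continuity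
  have hweak : ∀ v : V, Tendsto (fun t => inner ℂ v (τ t)) (𝓝 0) (𝓝 (inner ℂ v b)) := by
    intro v
    have := hT.isFiniteMeasure v
    rw [Metric.tendsto_nhds]
    intro ε hε
    have h0 : Tendsto (fun n => √(16 * (M : ℝ)) * √(∫ x, ‖relErr f s n x‖ ^ 2 ∂(μ v))) atTop
        (𝓝 0) := by
      simpa using (tendsto_integral_relErr (ν := μ v) hf hb hs).sqrt.const_mul (√(16 * (M : ℝ)))
    obtain ⟨n, hn⟩ := (h0.eventually (gt_mem_nhds (by positivity : (0 : ℝ) < ε / 3))).exists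
    -- One simple function s n serves all t near 0 at once, because the error depends on Φ(t) only
    -- through M. For this fixed n the integral is a bounded operator, hence continuous along Φ.
    have htail : ∀ t, Integrable (fun x => ‖f x‖ ^ 2) (μ (Φ t)) ∧
        ∫ x, ‖f x‖ ^ 2 ∂(μ (Φ t)) ≤ M → ‖inner ℂ v (τ t - opInt T (s n) (Φ t))‖ < ε / 3 := by
      intro t ht
      refine (norm_inner_sub_opInt_le hT hb hs ht.1 (hτ t ht.1).1 v n).trans_lt (lt_of_le_of_lt ?_ hn)
      gcongr
      exact ht.2
    have hcont : ContinuousAt (fun t => inner ℂ v (opInt T (s n) (Φ t))) 0 :=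
      ContinuousAt.inner continuousAt_const
        ((opInt T (s n)).continuous.continuousAt.comp hΦ.continuousAt)
    have hc := (Metric.tendsto_nhds.1 hcont) (ε / 3) (by positivity)
    have t0 := htail 0 hM'.self_of_nhds
    filter_upwards [hM', hc] with t ht hct
    have t1 := htail t ht
    rw [hτ0] at t0
    rw [dist_eq_norm] at hct ⊢
    have : (inner ℂ v (τ t) - inner ℂ v b : ℂ) = inner ℂ v (τ t - opInt T (s n) (Φ t))
        + (inner ℂ v (opInt T (s n) (Φ t)) - inner ℂ v (opInt T (s n) (Φ 0)))
        - inner ℂ v (b - opInt T (s n) (Φ 0)) := by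
      simp only [inner_sub_right]; ring
    rw [this]
    calc _ ≤ _ := norm_sub_le _ _
      _ ≤ _ := add_le_add_left (norm_add_le _ _) _
      _ < ε := by linarith
  -- Moving the integral to Φ 0 leaves only the differentiable curve on the other side: ⟨Φ 0, τ t -
  -- τ 0⟩ = ⟨a, Φ t - Φ 0⟩.
  have hadj : ∀ t, Integrable (fun x => ‖f x‖ ^ 2) (μ (Φ t)) →
      inner ℂ (Φ 0) (τ t) = inner ℂ a (Φ t) := by
    intro t ht
    refine tendsto_nhds_unique (tendsto_const_nhds.inner (hτ t ht).1) ?_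
    simp_rw [← inner_opInt_left hT]
    exact ha1.inner tendsto_const_nhds
  rw [hasDerivAt_iff_tendsto_slope] at hΦ ⊢
  have hmain : Tendsto (fun t => inner ℂ (slope Φ 0 t) (τ t) + inner ℂ a (slope Φ 0 t))
      (𝓝[≠] (0 : ℝ)) (𝓝 (inner ℂ Φ' b + inner ℂ a Φ')) := by
    refine Tendsto.add ?_ (tendsto_const_nhds.inner hΦ)
    -- The slope converges in norm and τ is bounded, so weak convergence of τ, tested on Φ' alone,
    -- suffices.
    have h1 : Tendsto (fun t => inner ℂ (slope Φ 0 t - Φ') (τ t)) (𝓝[≠] (0 : ℝ)) (𝓝 (0 : ℂ)) := by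
      refine squeeze_zero_norm' (a := fun t => ‖slope Φ 0 t - Φ'‖ * √M) ?_ ?_
      · filter_upwards [hτM.filter_mono nhdsWithin_le_nhds] with t ht
        exact (norm_inner_le_norm _ _).trans (by gcongr)
      · have := (hΦ.sub_const Φ').norm.mul_const √M
        simpa using this
    have h2 := h1.add ((hweak Φ').mono_left nhdsWithin_le_nhds)
    simpa [inner_sub_left] using h2
  refine hmain.congr' ?_
  filter_upwards [hM'.filter_mono nhdsWithin_le_nhds] with t ht
  rw [slope_def_module, slope_def_module, ← (hτ t ht.1).2.2, ← (hτ 0 hf2).2.2, hτ0,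
    inner_smul_right_eq_smul, inner_sub_right,
    ← hadj t ht.1, ← hadj 0 hf2, hτ0]
  simp only [sub_zero]
  rw [show inner ℂ (t⁻¹ • (Φ t - Φ 0)) (τ t) = t⁻¹ • inner ℂ (Φ t - Φ 0) (τ t) from ?_,
    inner_sub_left, ← smul_add]
  · congr 1; ring
  · rw [← Complex.coe_smul, inner_smul_left, Complex.conj_ofReal, ← Complex.coe_smul, smul_eq_mul]

end Measurement

/-! ### The Hilbert sum of square summable families -/

section L2

variable {H : Type*} [NormedAddCommGroup H] {ι : Type*}

/-- The Hilbert space of square summable families of vectors. -/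
abbrev L2 (ι H : Type*) [NormedAddCommGroup H] := lp (fun _ : ι => H) 2

/-- A square summable family as an element of the Hilbert sum. -/
def toL2 (φ : ι → H) (h : Summable fun j => ‖φ j‖ ^ 2) : L2 ι H :=
  ⟨φ, memℓp_gen (by simpa using h)⟩

@[simp] theorem toL2_apply (φ : ι → H) (h : Summable fun j => ‖φ j‖ ^ 2) (j : ι) :
    (toL2 φ h : ι → H) j = φ j := rfl

theorem L2.hasSum_norm_sq (u : L2 ι H) : HasSum (fun j => ‖u j‖ ^ 2) (‖u‖ ^ 2) := by
  have := lp.hasSum_norm (p := 2) (by norm_num) u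
  simpa using this

theorem L2.memℓp_of_summable {φ : ι → H} (h : Summable fun j => ‖φ j‖ ^ 2) : Memℓp φ 2 :=
  memℓp_gen (by simpa using h)

theorem L2.summable_norm_mul_norm (u v : L2 ι H) : Summable fun j => ‖u j‖ * ‖v j‖ :=
  lp.summable_mul (p := 2) (q := 2) (by
    have := Real.HolderConjugate.two_two
    simpa using this) u v

theorem L2.tsum_norm_mul_norm_le (u v : L2 ι H) : ∑' j, ‖u j‖ * ‖v j‖ ≤ ‖u‖ * ‖v‖ :=
  lp.tsum_mul_le_mul_norm' (p := 2) (q := 2) (by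
    have := Real.HolderConjugate.two_two
    simpa using this) u v

end L2

/-! ### Measurements acting on families of vectors -/

section Amplification

variable {H : Type*} [NormedAddCommGroup H] [InnerProductSpace ℂ H]
  {X : Type*} [MeasurableSpace X] {ι : Type*}

/-- A bounded operator acting on every member of a family. -/
def amplify (S : H →L[ℂ] H) : L2 ι H →L[ℂ] L2 ι H :=
  lp.mapCLM 2 (fun _ => S) (norm_nonneg S) (fun _ => le_rfl)

@[simp] theorem amplify_apply (S : H →L[ℂ] H) (u : L2 ι H) (j : ι) : amplify S u j = S (u j) := rfl

theorem hasSum_inner_amplify (S : H →L[ℂ] H) (v u : L2 ι H) :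
    HasSum (fun j => inner ℂ (v j) (S (u j))) (inner ℂ v (amplify S u)) :=
  lp.hasSum_inner v (amplify S u)

theorem isPositive_amplify {S : H →L[ℂ] H} (hS : S.IsPositive) :
    (amplify S : L2 ι H →L[ℂ] L2 ι H).IsPositive := by
  refine ⟨fun u v => ?_, fun u => ?_⟩
  · change inner ℂ (amplify S u) v = inner ℂ u (amplify S v)
    refine (lp.hasSum_inner (𝕜 := ℂ) (amplify S u) v).unique ?_
    convert lp.hasSum_inner (𝕜 := ℂ) u (amplify S v) using 2 with j
    exact hS.isSymmetric (u j) (v j)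
  · have h := lp.hasSum_inner (𝕜 := ℂ) (amplify S u) u
    exact (Complex.hasSum_re h).nonneg fun j => hS.re_inner_nonneg_left (u j)

variable [CompleteSpace H]

/-- Countable additivity for the sequence s, t, ∅, ∅, …. -/
theorem QPM.union (P : QPM X H) {s t : Set X} (hs : MeasurableSet s) (ht : MeasurableSet t)
    (hd : Disjoint s t) : P.toFun (s ∪ t) = P.toFun s + P.toFun t := by
  let f : ℕ → Set X := fun i => if i = 0 then s else if i = 1 then t else ∅
  have hf0 : f 0 = s := rfl
  have hf1 : f 1 = t := rfl
  have hf2 : ∀ i, f (i + 2) = ∅ := fun i => rfl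
  have hU : ⋃ i, f i = s ∪ t := by
    ext x
    simp only [Set.mem_iUnion, Set.mem_union]
    constructor
    · rintro ⟨i, hi⟩
      match i, hi with
      | 0, hi => exact Or.inl hi
      | 1, hi => exact Or.inr hi
      | i + 2, hi => exact absurd hi (by rw [hf2]; exact Set.notMem_empty x)
    · rintro (h | h)
      · exact ⟨0, h⟩
      · exact ⟨1, h⟩
  have hm : ∀ i, MeasurableSet (f i) := by
    intro i
    match i with
    | 0 => exact hs
    | 1 => exact ht
    | i + 2 => rw [hf2]; exact MeasurableSet.empty
  have hdis : Pairwise (Function.onFun Disjoint f) := by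
    intro i j hij
    match i, j, hij with
    | 0, 1, _ => exact hd
    | 1, 0, _ => exact hd.symm
    | 0, 0, h => exact absurd rfl h
    | 1, 1, h => exact absurd rfl h
    | i + 2, j, _ => simp [Function.onFun, hf2]
    | i, j + 2, _ => simp [Function.onFun, hf2]
  refine ContinuousLinearMap.ext fun w => ext_inner_left ℂ fun v => ?_
  have h := P.hasSum_iUnion f hm hdis v w
  rw [hU] at h
  have h2 : HasSum (fun i => inner ℂ v (P.toFun (f i) w))
      (∑ i ∈ ({0, 1} : Finset ℕ), inner ℂ v (P.toFun (f i) w)) :=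
    hasSum_sum_of_ne_finset_zero (fun i hi => by
      match i, hi with
      | 0, hi => simp at hi
      | 1, hi => simp at hi
      | i + 2, _ => simp only [hf2]; exact P.empty v w)
  rw [h.unique h2, Finset.sum_pair (by norm_num), hf0, hf1, _root_.add_apply, inner_add_right]

/-- The purification step: the mixture of the u j gives the outcome law of a single vector in the
Hilbert sum. -/
theorem QPM.law_apply (P : QPM X H) (u : L2 ι H) {s : Set X} (hs : MeasurableSet s) :
    P.law u s = ENNReal.ofReal (inner ℂ u (amplify (P.toFun s) u)).re := by
  have h := Complex.hasSum_re (hasSum_inner_amplify (P.toFun s) u u)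
  have h2 := ENNReal.ofReal_tsum_of_nonneg
    (fun j => (P.isPositive s hs).re_inner_nonneg_right (u j)) h.summable
  rw [QPM.law, Measure.sum_apply _ hs, ← h.tsum_eq]
  exact (tsum_congr fun j => Measure.ofMeasurable_apply s hs).trans h2.symm

/-- The outcome distributions of a measurement, all families of vectors being considered at once. -/
theorem QPM.isOutcomeFamily (P : QPM X H) (ι : Type*) :
    IsOutcomeFamily (fun s => (amplify (P.toFun s) : L2 ι H →L[ℂ] L2 ι H))
      (fun u => P.law (u : ι → H)) where
  isPositive s hs := isPositive_amplify (P.isPositive s hs)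
  union s t hs ht hd := by
    ext u j
    simp only [P.union hs ht hd]
    rfl
  univ := by
    ext u j
    simp only [P.univ]
    rfl
  apply u s hs := P.law_apply u hs

end Amplification

/-! ### Trace-class operators as a bilinear function of two families -/

section Mixture

variable {H : Type*} [NormedAddCommGroup H] [InnerProductSpace ℂ H] {ι : Type*}

/-- The operator `∑ⱼ |uⱼ⟩⟨vⱼ|`. -/
def crossOp (u v : L2 ι H) : H →L[ℂ] H :=
  ∑' j, InnerProductSpace.rankOne ℂ (u j) (v j)

theorem summable_norm_rankOne (u v : L2 ι H) :
    Summable fun j => ‖InnerProductSpace.rankOne ℂ (u j) (v j)‖ := by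
  simpa using L2.summable_norm_mul_norm u v

theorem mixture_eq_crossOp (u : L2 ι H) : mixture u = crossOp u u := rfl

variable [CompleteSpace H]

theorem hasSum_crossOp (u v : L2 ι H) :
    HasSum (fun j => InnerProductSpace.rankOne ℂ (u j) (v j)) (crossOp u v) :=
  (summable_norm_rankOne u v).of_norm.hasSum

theorem hasSum_crossOp_apply (u v : L2 ι H) (w : H) :
    HasSum (fun j => inner ℂ (v j) w • u j) (crossOp u v w) := by
  simpa using (ContinuousLinearMap.apply ℂ H w).hasSum (hasSum_crossOp u v)

/-- Bilinear over ℝ only, as v enters conjugate-linearly. The bound in operator norm makes the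
density operator differentiable wherever its family of vectors is. -/
theorem isBoundedBilinearMap_crossOp :
    IsBoundedBilinearMap ℝ fun p : L2 ι H × L2 ι H => crossOp p.1 p.2 where
  add_left u u' v := (hasSum_crossOp (u + u') v).unique (by
    simpa using (hasSum_crossOp u v).add (hasSum_crossOp u' v))
  smul_left c u v := (hasSum_crossOp (c • u) v).unique (by
    have := (hasSum_crossOp u v).const_smul (c : ℂ)
    simpa [← Complex.coe_smul] using this)
  add_right u v v' := (hasSum_crossOp u (v + v')).unique (by
    simpa using (hasSum_crossOp u v).add (hasSum_crossOp u v'))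
  smul_right c u v := (hasSum_crossOp u (c • v)).unique (by
    have := (hasSum_crossOp u v).const_smul (c : ℂ)
    simpa [← Complex.coe_smul] using this)
  bound := ⟨1, one_pos, fun u v => by
    rw [one_mul]
    refine (norm_tsum_le_tsum_norm (summable_norm_rankOne u v)).trans ?_
    simpa using L2.tsum_norm_mul_norm_le u v⟩

theorem crossOp_smul_left (c : ℂ) (u v : L2 ι H) : crossOp (c • u) v = c • crossOp u v :=
  (hasSum_crossOp (c • u) v).unique (by simpa using (hasSum_crossOp u v).const_smul c)

theorem crossOp_smul_right (c : ℂ) (u v : L2 ι H) : crossOp u (c • v) = conj c • crossOp u v :=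
  (hasSum_crossOp u (c • v)).unique (by simpa using (hasSum_crossOp u v).const_smul (conj c))

end Mixture

/-! ### Adjoints of densely defined operators on single vectors -/

section Adjoint

variable {H : Type*} [NormedAddCommGroup H] [InnerProductSpace ℂ H] [CompleteSpace H]

/-- Testing against a dense domain decides both membership of v in the domain of a* and the value
there; adjoint values of concrete generators are found in this way. -/
theorem exists_mem_adjoint_domain {a : H →ₗ.[ℂ] H} (ha : Dense (a.domain : Set H)) {v w : H}
    (h : ∀ u : a.domain, inner ℂ (a u) v = inner ℂ (u : H) w) :
    ∃ hv : v ∈ a.adjoint.domain, a.adjoint ⟨v, hv⟩ = w := by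
  have h' : ∀ u : a.domain, inner ℂ w (u : H) = inner ℂ v (a u) := fun u => by
    rw [← inner_conj_symm, ← h, inner_conj_symm]
  refine ⟨LinearPMap.mem_adjoint_domain_of_exists v ⟨w, h'⟩, ?_⟩
  exact LinearPMap.adjoint_apply_eq ha _ h'

theorem adjApply_eq {a : H →ₗ.[ℂ] H} (ha : Dense (a.domain : Set H)) {v w : H}
    (h : ∀ u : a.domain, inner ℂ (a u) v = inner ℂ (u : H) w) : adjApply a v = w := by
  obtain ⟨hv, e⟩ := exists_mem_adjoint_domain ha h
  rw [adjApply, dif_pos hv, e]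

theorem adjApply_spec {a : H →ₗ.[ℂ] H} (ha : Dense (a.domain : Set H)) {v : H}
    (hv : v ∈ a.adjoint.domain) (u : a.domain) :
    inner ℂ (a u) v = inner ℂ (u : H) (adjApply a v) := by
  rw [adjApply, dif_pos hv, ← inner_conj_symm, ← LinearPMap.adjoint_isFormalAdjoint ha ⟨v, hv⟩ u,
    inner_conj_symm]

variable {E : Submodule ℂ H}

theorem adjApply_opOn_eq (hE : Dense (E : Set H)) (a : Module.End ℂ E) {v w : H}
    (h : ∀ u : E, inner ℂ ((a u : E) : H) v = inner ℂ (u : H) w) : adjApply (opOn a) v = w :=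
  adjApply_eq (a := opOn a) hE h

theorem exists_mem_opOn_adjoint_domain (hE : Dense (E : Set H)) (a : Module.End ℂ E) {v w : H}
    (h : ∀ u : E, inner ℂ ((a u : E) : H) v = inner ℂ (u : H) w) :
    ∃ hv : v ∈ (opOn a).adjoint.domain, (opOn a).adjoint ⟨v, hv⟩ = w :=
  exists_mem_adjoint_domain (a := opOn a) hE h

theorem adjApply_opOn_spec (hE : Dense (E : Set H)) (a : Module.End ℂ E) {v : H}
    (hv : v ∈ (opOn a).adjoint.domain) (u : E) :
    inner ℂ ((a u : E) : H) v = inner ℂ (u : H) (adjApply (opOn a) v) :=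
  adjApply_spec (a := opOn a) hE hv u

end Adjoint

/-! ### Cauchy products and shifted power series -/

section Series

open Finset in
theorem summable_prod_of_summable_antidiagonal {f : ℕ × ℕ → ℝ} (hf : ∀ p, 0 ≤ f p)
    (h : Summable fun m => ∑ p ∈ antidiagonal m, f p) : Summable f := by
  rw [← HasAntidiagonal.sigmaAntidiagonalEquivProd.summable_iff]
  refine (summable_sigma_of_nonneg fun _ => hf _).2 ?_
  refine ⟨fun n => (hasSum_fintype _).summable, h.congr fun m => ?_⟩
  rw [tsum_fintype, ← sum_finset_coe]
  rfl

open Finset in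
theorem hasSum_sum_antidiagonal {G : Type*} [AddCommGroup G] [UniformSpace G] [IsUniformAddGroup G]
    [CompleteSpace G] [T2Space G] {f : ℕ × ℕ → G} {a : G}
    (h : HasSum f a) : HasSum (fun m => ∑ p ∈ antidiagonal m, f p) a := by
  rw [← HasAntidiagonal.sigmaAntidiagonalEquivProd.hasSum_iff] at h
  have h2 := h.sigma (g := fun m => ∑ p ∈ antidiagonal m, f p) (fun m => by
    rw [← sum_finset_coe]
    exact hasSum_fintype _)
  exact h2

open Finset in
/-- The Cauchy product of two absolutely convergent series under a bounded bilinear map. -/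
theorem hasSum_antidiagonal_bilinear {E F G : Type*} [NormedAddCommGroup E] [NormedSpace ℝ E]
    [CompleteSpace E] [NormedAddCommGroup F] [NormedSpace ℝ F] [CompleteSpace F]
    [NormedAddCommGroup G] [NormedSpace ℝ G] [CompleteSpace G]
    {B : E × F → G} (hB : IsBoundedBilinearMap ℝ B) {f : ℕ → E} {g : ℕ → F}
    (hf : Summable fun m => ‖f m‖) (hg : Summable fun m => ‖g m‖) :
    HasSum (fun m => ∑ p ∈ antidiagonal m, B (f p.1, g p.2)) (B (∑' m, f m, ∑' m, g m)) := by
  obtain ⟨c, _, hc⟩ := hB.bound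
  have hs : Summable fun p : ℕ × ℕ => B (f p.1, g p.2) := by
    refine Summable.of_norm_bounded ((hf.mul_of_nonneg hg (fun _ => norm_nonneg _)
      fun _ => norm_nonneg _).mul_left c) fun p => ?_
    rw [← mul_assoc]; exact hc _ _
  have h := hs.hasSum
  rw [hs.tsum_prod] at h
  convert hasSum_sum_antidiagonal h using 1
  let B' := hB.toContinuousLinearMap
  have e : ∀ x y, B (x, y) = B' x y := fun _ _ => rfl
  simp_rw [e]
  rw [B'.map_tsum hf.of_norm]
  refine ((ContinuousLinearMap.apply ℝ G (∑' m, g m)).map_tsum (B'.summable hf.of_norm)).trans ?_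
  exact tsum_congr fun p => (B' (f p)).map_tsum hg.of_norm

/-- As for the derivative of a power series: (m + 1)(ρ/r)^m / r is bounded, so a smaller radius pays
for the extra factor in the index shift. -/
theorem summable_shift {a : ℕ → ℝ} (ha : ∀ m, 0 ≤ a m) {ρ r : ℝ} (h0 : 0 ≤ ρ) (hr : ρ < r)
    (h : Summable fun m => r ^ m / (m.factorial : ℝ) * a m) :
    Summable fun m => ρ ^ m / (m.factorial : ℝ) * a (m + 1) := by
  have hr0 : 0 < r := h0.trans_lt hr
  have hq : ρ / r < 1 := (div_lt_one hr0).2 hr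
  have hq0 : 0 ≤ ρ / r := div_nonneg h0 hr0.le
  have ht : Tendsto (fun m : ℕ => ((m : ℝ) + 1) * (ρ / r) ^ m / r) atTop (𝓝 0) := by
    have := (tendsto_self_mul_const_pow_of_lt_one hq0 hq).add
      (tendsto_pow_atTop_nhds_zero_of_lt_one hq0 hq)
    simpa [add_mul] using this.div_const r
  obtain ⟨c, hc⟩ := ht.bddAbove_range
  refine Summable.of_nonneg_of_le (fun m => by have := ha (m + 1); positivity) (fun m => ?_)
    (((summable_nat_add_iff 1).2 h).mul_left c)
  have hcm : ((m : ℝ) + 1) * (ρ / r) ^ m / r ≤ c := hc ⟨m, rfl⟩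
  have : ρ ^ m / (m.factorial : ℝ) = ((m : ℝ) + 1) * (ρ / r) ^ m / r *
      (r ^ (m + 1) / ((m + 1).factorial : ℝ)) := by
    rw [Nat.factorial_succ, div_pow]
    push_cast
    field_simp
    ring
  rw [this, mul_assoc]
  have h1 := ha (m + 1)
  exact mul_le_mul_of_nonneg_right hcm (by positivity)

end Series

/-! ### The matrix functions e^A and (e^A - 1)/A, entry by entry -/

section MatrixSeries

variable {n : ℕ}

/-- The sum of the absolute values of all entries is a submultiplicative size, so no norm on
matrices has to be chosen. -/
theorem norm_pow_entry_le (A : Matrix (Fin n) (Fin n) ℂ) (l : ℕ) (k j : Fin n) :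
    ‖(A ^ l) k j‖ ≤ (∑ i, ∑ i', ‖A i i'‖) ^ l := by
  induction l generalizing j with
  | zero =>
    rw [pow_zero, pow_zero, Matrix.one_apply]
    split_ifs <;> simp
  | succ l ih =>
    rw [pow_succ, Matrix.mul_apply, pow_succ]
    refine (norm_sum_le _ _).trans ?_
    simp_rw [norm_mul]
    refine (Finset.sum_le_sum fun i _ => mul_le_mul_of_nonneg_right (ih i) (norm_nonneg _)).trans ?_
    rw [← Finset.mul_sum]
    refine mul_le_mul_of_nonneg_left (Finset.sum_le_sum fun i _ => ?_) (by positivity)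
    exact Finset.single_le_sum (f := fun j => ‖A i j‖) (fun _ _ => norm_nonneg _) (Finset.mem_univ j)

theorem summable_norm_exp_entry (A : Matrix (Fin n) (Fin n) ℂ) (k j : Fin n) :
    Summable fun l : ℕ => ‖((l.factorial : ℂ))⁻¹ * (A ^ l) k j‖ := by
  refine Summable.of_nonneg_of_le (fun _ => norm_nonneg _) (fun l => ?_)
    (Real.summable_pow_div_factorial (∑ i, ∑ i', ‖A i i'‖))
  rw [norm_mul, norm_inv, Complex.norm_natCast, div_eq_inv_mul]
  exact mul_le_mul_of_nonneg_left (norm_pow_entry_le A l k j) (by positivity)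

theorem norm_expQuot_entry_le (A : Matrix (Fin n) (Fin n) ℂ) (l : ℕ) (k j : Fin n) :
    ‖(((l + 1).factorial : ℂ))⁻¹ * (A ^ l) k j‖ ≤
      (∑ i, ∑ i', ‖A i i'‖) ^ l / (l.factorial : ℝ) := by
  rw [norm_mul, norm_inv, Complex.norm_natCast, div_eq_inv_mul]
  refine mul_le_mul ?_ (norm_pow_entry_le A l k j) (norm_nonneg _) (by positivity)
  gcongr
  exact Nat.le_succ l

theorem summable_norm_expQuot_entry (A : Matrix (Fin n) (Fin n) ℂ) (k j : Fin n) :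
    Summable fun l : ℕ => ‖(((l + 1).factorial : ℂ))⁻¹ * (A ^ l) k j‖ :=
  Summable.of_nonneg_of_le (fun _ => norm_nonneg _) (fun l => norm_expQuot_entry_le A l k j)
    (Real.summable_pow_div_factorial (∑ i, ∑ i', ‖A i i'‖))

theorem hasSum_expQuot (A : Matrix (Fin n) (Fin n) ℂ) :
    HasSum (fun l : ℕ => (((l + 1).factorial : ℂ))⁻¹ • A ^ l) (expQuot A) := by
  refine Summable.hasSum ?_
  refine Pi.summable.2 fun k => Pi.summable.2 fun j => ?_
  exact (summable_norm_expQuot_entry A k j).of_norm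

theorem expQuot_apply (A : Matrix (Fin n) (Fin n) ℂ) (k j : Fin n) :
    expQuot A k j = ∑' l : ℕ, (((l + 1).factorial : ℂ))⁻¹ * (A ^ l) k j :=
  (Pi.hasSum.1 (Pi.hasSum.1 (hasSum_expQuot A) k) j).tsum_eq.symm

theorem hasSum_exp (A : Matrix (Fin n) (Fin n) ℂ) :
    HasSum (fun l : ℕ => ((l.factorial : ℂ))⁻¹ • A ^ l) (NormedSpace.exp A) := by
  rw [NormedSpace.exp_eq_tsum ℂ]
  refine Summable.hasSum ?_
  refine Pi.summable.2 fun k => Pi.summable.2 fun j => ?_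
  exact (summable_norm_exp_entry A k j).of_norm

theorem exp_apply (A : Matrix (Fin n) (Fin n) ℂ) (k j : Fin n) :
    NormedSpace.exp A k j = ∑' l : ℕ, ((l.factorial : ℂ))⁻¹ * (A ^ l) k j :=
  (Pi.hasSum.1 (Pi.hasSum.1 (hasSum_exp A) k) j).tsum_eq.symm

theorem map_conj_pow (A : Matrix (Fin n) (Fin n) ℂ) (l : ℕ) :
    A.map conj ^ l = (A ^ l).map conj :=
  (map_pow (starRingEnd ℂ).mapMatrix A l).symm

theorem expQuot_map_conj (A : Matrix (Fin n) (Fin n) ℂ) :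
    expQuot (A.map conj) = (expQuot A).map conj := by
  ext k j
  rw [Matrix.map_apply, expQuot_apply, expQuot_apply, Complex.conj_tsum]
  refine tsum_congr fun l => ?_
  rw [map_conj_pow, Matrix.map_apply, map_mul, map_inv₀, Complex.conj_natCast]

theorem exp_map_conj (A : Matrix (Fin n) (Fin n) ℂ) :
    NormedSpace.exp (A.map conj) = (NormedSpace.exp A).map conj := by
  ext k j
  rw [Matrix.map_apply, exp_apply, exp_apply, Complex.conj_tsum]
  refine tsum_congr fun l => ?_
  rw [map_conj_pow, Matrix.map_apply, map_mul, map_inv₀, Complex.conj_natCast]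

/-- `(e^A - I) A⁻¹` is invertible for small `A`. -/
theorem eventually_isUnit_det_expQuot {W : Type*} [TopologicalSpace W]
    {A : W → Matrix (Fin n) (Fin n) ℂ} {w : W} (hA : ContinuousAt A w) (h0 : A w = 0) :
    ∀ᶠ b in 𝓝 w, IsUnit (expQuot (A b)).det := by
  have hent : ∀ i j, ContinuousAt (fun b => A b i j) w := fun i j =>
    (continuous_id.matrix_elem i j).continuousAt.comp hA
  have hK : Tendsto (fun b => ∑ i, ∑ i', ‖A b i i'‖) (𝓝 w) (𝓝 0) := by
    have : ContinuousAt (fun b => ∑ i, ∑ i', ‖A b i i'‖) w :=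
      tendsto_finsetSum _ fun i _ => tendsto_finsetSum _ fun j _ => (hent i j).norm
    simpa [ContinuousAt, h0] using this
  have hQ : Tendsto (fun b => expQuot (A b)) (𝓝 w) (𝓝 (expQuot (A w))) := by
    refine tendsto_pi_nhds.2 fun k => tendsto_pi_nhds.2 fun j => ?_
    simp_rw [expQuot_apply]
    refine tendsto_tsum_of_dominated_convergence (bound := fun l => 1 ^ l / (l.factorial : ℝ))
      (Real.summable_pow_div_factorial 1) (fun l => ?_) ?_
    · refine Tendsto.const_mul _ ?_
      have : ContinuousAt (fun b => A b ^ l) w := hA.pow l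
      exact (continuous_id.matrix_elem k j).continuousAt.comp this
    · filter_upwards [hK.eventually (gt_mem_nhds one_pos)] with b hb l
      refine (norm_expQuot_entry_le (A b) l k j).trans ?_
      gcongr
  have h1 : expQuot (A w) = 1 := by
    rw [h0]
    refine (hasSum_expQuot 0).unique ?_
    have := hasSum_single (f := fun l : ℕ => (((l + 1).factorial : ℂ))⁻¹ •
      (0 : Matrix (Fin n) (Fin n) ℂ) ^ l) 0 (fun l hl => by rw [zero_pow hl, smul_zero])
    simpa using this
  have hdet : Tendsto (fun b => (expQuot (A b)).det) (𝓝 w) (𝓝 1) := by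
    have := (Continuous.matrix_det continuous_id).continuousAt.tendsto.comp hQ
    simpa [h1, Function.comp_def] using this
  filter_upwards [hdet.eventually_ne one_ne_zero] with b hb
  exact isUnit_iff_ne_zero.2 hb

end MatrixSeries

/-! ### Words in the generators and analytic vectors -/

section Words

variable {n : ℕ} {V M : Type*} [NormedAddCommGroup V] [NormedSpace ℂ V] [AddCommGroup M]
  [Module ℂ M] (J : M →ₗ[ℂ] V) (y : Fin n → Module.End ℂ M)

/-- `∑ₖ bᵏ y_k`. -/
abbrev genComb (b : Fin n → ℂ) : Module.End ℂ M := ∑ k, b k • y k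

theorem genComb_apply (b : Fin n → ℂ) (v : M) : genComb y b v = ∑ k, b k • y k v := by
  simp [genComb]

theorem genComb_single (k : Fin n) : genComb y (Pi.single k 1) = y k := by
  rw [genComb, Finset.sum_eq_single k] <;> simp +contextual

theorem genComb_smul (c : ℂ) (b : Fin n → ℂ) : genComb y (c • b) = c • genComb y b := by
  simp [genComb, Finset.smul_sum, mul_smul]

/-- `∑ ‖y_w v‖` over the words `w` of length `m`. -/
def wordNorm (m : ℕ) (v : M) : ℝ := ∑ w : Fin m → Fin n, ‖J (((List.ofFn w).map y).prod v)‖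

theorem wordNorm_nonneg (m : ℕ) (v : M) : 0 ≤ wordNorm J y m v :=
  Finset.sum_nonneg fun _ _ => norm_nonneg _

theorem wordNorm_zero (v : M) : wordNorm J y 0 v = ‖J v‖ := by simp [wordNorm]

/-- The last letter of a word acts first on v, so it is the letter split off. -/
theorem wordNorm_succ (m : ℕ) (v : M) :
    wordNorm J y (m + 1) v = ∑ k, wordNorm J y m (y k v) := by
  rw [wordNorm, ← (Fin.snocEquiv fun _ => Fin n).sum_comp, Fintype.sum_prod_type]
  refine Finset.sum_congr rfl fun k _ => Finset.sum_congr rfl fun w _ => ?_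
  congr 2
  rw [List.ofFn_succ']
  simp [Fin.snocEquiv, List.concat_eq_append]

theorem wordNorm_gen_le (m : ℕ) (k : Fin n) (v : M) :
    wordNorm J y m (y k v) ≤ wordNorm J y (m + 1) v := by
  rw [wordNorm_succ]
  exact Finset.single_le_sum (f := fun k => wordNorm J y m (y k v))
    (fun _ _ => wordNorm_nonneg J y m _) (Finset.mem_univ k)

/-- A product of linear combinations of generators expands into words. Allowing different
coefficients in each factor covers powers and their directional derivatives together. -/
theorem norm_prod_genComb_le (bs : List (Fin n → ℂ)) (v : M) :
    ‖J ((bs.map (genComb y)).prod v)‖ ≤ (bs.map norm).prod * wordNorm J y bs.length v := by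
  induction bs using List.reverseRecOn generalizing v with
  | nil => simp [wordNorm_zero]
  | append_singleton bs b ih =>
    have h0 : 0 ≤ (bs.map norm).prod := List.prod_nonneg (by simp)
    rw [List.map_append, List.prod_append, List.map_append, List.prod_append]
    simp only [List.map_cons, List.map_nil, List.prod_singleton, List.length_append,
      List.length_singleton, Module.End.mul_apply]
    rw [genComb_apply, map_sum, map_sum, wordNorm_succ, Finset.mul_sum]
    refine (norm_sum_le _ _).trans (Finset.sum_le_sum fun k _ => ?_)
    rw [map_smul, map_smul, norm_smul, mul_right_comm, mul_comm]
    have := wordNorm_nonneg J y bs.length (y k v)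
    exact mul_le_mul (ih _) (norm_le_pi_norm b k) (norm_nonneg _) (by positivity)

theorem norm_pow_genComb_le (z : Fin n → ℂ) (m : ℕ) (v : M) :
    ‖J ((genComb y z ^ m) v)‖ ≤ ‖z‖ ^ m * wordNorm J y m v := by
  simpa using norm_prod_genComb_le J y (List.replicate m z) v

theorem norm_pow_mul_pow_genComb_le (z b : Fin n → ℂ) (p q : ℕ) (v : M) :
    ‖J ((genComb y z ^ p * genComb y b * genComb y z ^ q) v)‖ ≤
      ‖z‖ ^ (p + q) * ‖b‖ * wordNorm J y (p + q + 1) v := by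
  have h := norm_prod_genComb_le J y (List.replicate p z ++ b :: List.replicate q z) v
  have e1 : ((List.replicate p z ++ b :: List.replicate q z).map (genComb y)).prod =
      genComb y z ^ p * genComb y b * genComb y z ^ q := by simp [mul_assoc]
  have e2 : ((List.replicate p z ++ b :: List.replicate q z).map norm).prod =
      ‖z‖ ^ (p + q) * ‖b‖ := by simp; ring
  have e3 : (List.replicate p z ++ b :: List.replicate q z).length = p + q + 1 := by simp; ring
  rwa [e1, e2, e3] at h

theorem norm_gen_mul_pow_genComb_le (z : Fin n → ℂ) (k : Fin n) (m : ℕ) (v : M) :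
    ‖J ((y k * genComb y z ^ m) v)‖ ≤ ‖z‖ ^ m * wordNorm J y (m + 1) v := by
  have h := norm_pow_mul_pow_genComb_le J y z (Pi.single k 1) 0 m v
  rw [genComb_single] at h
  have : ‖(Pi.single k 1 : Fin n → ℂ)‖ = 1 := by rw [Pi.norm_single]; simp
  simpa [this] using h

/-- `v` is analytic for `y₁, …, yₙ` in the polydisc of radius `r`. -/
def IsAnalyticVec (v : M) (r : ℝ) : Prop :=
  Summable fun m : ℕ => r ^ m / (m.factorial : ℝ) * wordNorm J y m v

/-- `exp (∑ₖ zᵏ y_k) v`. -/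
def expMap (z : Fin n → ℂ) (v : M) : V :=
  ∑' m : ℕ, ((m.factorial : ℂ))⁻¹ • J ((genComb y z ^ m) v)

/-- `y_k exp (∑ₖ zᵏ y_k) v`. -/
def genExpMap (k : Fin n) (z : Fin n → ℂ) (v : M) : V :=
  ∑' m : ℕ, ((m.factorial : ℂ))⁻¹ • J ((y k * genComb y z ^ m) v)

/-- The derivative of `(∑ₖ zᵏ y_k) ^ m v` in the direction `b`. -/
def powDeriv (m : ℕ) (z b : Fin n → ℂ) : Module.End ℂ M :=
  ∑ p ∈ Finset.range m, genComb y z ^ p * genComb y b * genComb y z ^ (m - 1 - p)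

theorem powDeriv_succ (m : ℕ) (z b : Fin n → ℂ) :
    powDeriv y (m + 1) z b = powDeriv y m z b * genComb y z + genComb y z ^ m * genComb y b := by
  rw [powDeriv, Finset.sum_range_succ, powDeriv, Finset.sum_mul]
  congr 1
  · refine Finset.sum_congr rfl fun p hp => ?_
    rw [mul_assoc _ _ (genComb y z), ← pow_succ]
    congr 2
    have := Finset.mem_range.1 hp
    omega
  · simp

/-- The rightmost factor is split off, which replaces v by y_k v and leaves a finite sum of scalar
functions times lower powers; the operators themselves are never differentiated. -/
theorem exists_hasFDerivAt_pow (m : ℕ) (z : Fin n → ℂ) (v : M) :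
    ∃ L : (Fin n → ℂ) →L[ℂ] V, HasFDerivAt (fun z => J ((genComb y z ^ m) v)) L z ∧
      ∀ b, L b = J (powDeriv y m z b v) := by
  induction m generalizing v with
  | zero => exact ⟨0, by simpa using hasFDerivAt_const _ _, by simp [powDeriv]⟩
  | succ m ih =>
    choose L hL hL' using fun k => ih (y k v)
    have e : (fun z => J ((genComb y z ^ (m + 1)) v)) =
        fun z => ∑ k, z k • J ((genComb y z ^ m) (y k v)) := by
      funext z
      rw [pow_succ, Module.End.mul_apply, genComb_apply, map_sum, map_sum]
      simp
    rw [e]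
    refine ⟨_, HasFDerivAt.fun_sum fun k _ => (hasFDerivAt_apply k z).smul (hL k), fun b => ?_⟩
    rw [powDeriv_succ]
    simp only [FunLike.coe_sum, Finset.sum_apply, _root_.add_apply,
      _root_.smul_apply, ContinuousLinearMap.smulRight_apply, ContinuousLinearMap.proj_apply, hL',
      LinearMap.add_apply, Module.End.mul_apply, map_add, genComb_apply, map_sum, map_smul,
      Finset.sum_add_distrib]

variable {J y}

theorem IsAnalyticVec.mono {v : M} {r ρ : ℝ} (h : IsAnalyticVec J y v r) (h0 : 0 ≤ ρ)
    (hr : ρ ≤ r) : IsAnalyticVec J y v ρ := by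
  refine Summable.of_nonneg_of_le (fun m => ?_) (fun m => ?_) h
  · have := wordNorm_nonneg J y m v
    positivity
  · have := wordNorm_nonneg J y m v
    gcongr

theorem IsAnalyticVec.summable_shift {v : M} {r ρ : ℝ} (h : IsAnalyticVec J y v r) (h0 : 0 ≤ ρ)
    (hr : ρ < r) : Summable fun m : ℕ => ρ ^ m / (m.factorial : ℝ) * wordNorm J y (m + 1) v :=
  LieBound.summable_shift (wordNorm_nonneg J y · v) h0 hr h

theorem IsAnalyticVec.gen {v : M} {r ρ : ℝ} (h : IsAnalyticVec J y v r) (h0 : 0 ≤ ρ)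
    (hr : ρ < r) (k : Fin n) : IsAnalyticVec J y (y k v) ρ := by
  refine Summable.of_nonneg_of_le (fun m => ?_) (fun m => ?_) (h.summable_shift h0 hr)
  · have := wordNorm_nonneg J y m (y k v)
    positivity
  · have := wordNorm_gen_le J y m k v
    gcongr

theorem IsAnalyticVec.summable_norm {v : M} {r : ℝ} (h : IsAnalyticVec J y v r) {z : Fin n → ℂ}
    (hz : ‖z‖ ≤ r) : Summable fun m : ℕ => ‖((m.factorial : ℂ))⁻¹ • J ((genComb y z ^ m) v)‖ := by
  refine Summable.of_nonneg_of_le (fun _ => norm_nonneg _) (fun m => ?_)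
    (h.mono (norm_nonneg z) hz)
  rw [norm_smul, norm_inv, Complex.norm_natCast, div_eq_inv_mul, mul_assoc]
  exact mul_le_mul_of_nonneg_left (norm_pow_genComb_le J y z m v) (by positivity)

theorem IsAnalyticVec.summable_norm_gen {v : M} {r : ℝ} (h : IsAnalyticVec J y v r)
    {z : Fin n → ℂ} (hz : ‖z‖ < r) (k : Fin n) :
    Summable fun m : ℕ => ‖((m.factorial : ℂ))⁻¹ • J ((y k * genComb y z ^ m) v)‖ := by
  refine Summable.of_nonneg_of_le (fun _ => norm_nonneg _) (fun m => ?_)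
    (h.summable_shift (norm_nonneg z) hz)
  rw [norm_smul, norm_inv, Complex.norm_natCast, div_eq_inv_mul, mul_assoc]
  exact mul_le_mul_of_nonneg_left (norm_gen_mul_pow_genComb_le J y z k m v) (by positivity)

end Words

/-! ### Algebraic identities for ad a on the span of the generators -/

section Commutation

variable {n : ℕ} {R : Type*} [Ring R] [Algebra ℂ R]

/-- The linear combination `∑ⱼ N_{kj} y_j`. -/
abbrev rowComb (N : Matrix (Fin n) (Fin n) ℂ) (y : Fin n → R) (k : Fin n) : R := ∑ j, N k j • y j

/-- The span of the y_k is stable under ad a, which acts on the tuple y as the matrix N. -/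
theorem ad_pow_apply {a : R} {y : Fin n → R} {N : Matrix (Fin n) (Fin n) ℂ}
    (h : ∀ k, a * y k - y k * a = rowComb N y k) (l : ℕ) (k : Fin n) :
    ((LinearMap.mulLeft ℂ a - LinearMap.mulRight ℂ a) ^ l) (y k) = rowComb (N ^ l) y k := by
  induction l with
  | zero => simp [rowComb, Matrix.one_apply]
  | succ l ih =>
    rw [pow_succ', Module.End.mul_apply, ih, rowComb, map_sum]
    simp only [map_smul, LinearMap.sub_apply, LinearMap.mulLeft_apply, LinearMap.mulRight_apply, h,
      rowComb, Finset.smul_sum, smul_smul]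
    rw [Finset.sum_comm]
    refine Finset.sum_congr rfl fun j _ => ?_
    rw [pow_succ, Matrix.mul_apply, Finset.sum_smul]

/-- The sum `∑ L^p R^{m-1-p}` in terms of `D = L - R`. -/
theorem sum_pow_mul_pow_eq {S : Type*} [Ring S] {D r : S} (h : Commute D r) (m : ℕ) :
    ∑ p ∈ Finset.range m, (D + r) ^ p * r ^ (m - 1 - p) =
      ∑ l ∈ Finset.range m, (m.choose (l + 1)) • (D ^ l * r ^ (m - 1 - l)) := by
  -- Both sides are formally ((D + r)^m - r^m)/D; the induction avoids the division.
  induction m with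
  | zero => simp
  | succ m ih =>
    have e1 : ∑ p ∈ Finset.range m, (D + r) ^ p * r ^ (m + 1 - 1 - p) =
        (∑ p ∈ Finset.range m, (D + r) ^ p * r ^ (m - 1 - p)) * r := by
      rw [Finset.sum_mul]
      refine Finset.sum_congr rfl fun p hp => ?_
      rw [mul_assoc, ← pow_succ]
      congr 2
      have := Finset.mem_range.1 hp
      omega
    have e2 : ∑ l ∈ Finset.range m, (m.choose (l + 1)) • (D ^ l * r ^ (m + 1 - 1 - l)) =
        (∑ l ∈ Finset.range m, (m.choose (l + 1)) • (D ^ l * r ^ (m - 1 - l))) * r := by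
      rw [Finset.sum_mul]
      refine Finset.sum_congr rfl fun p hp => ?_
      rw [smul_mul_assoc, mul_assoc, ← pow_succ]
      congr 3
      have := Finset.mem_range.1 hp
      omega
    simp_rw [Nat.choose_succ_succ, add_smul, Finset.sum_add_distrib]
    rw [Finset.sum_range_succ, e1, ih, ← e2, add_comm, h.add_pow,
      Finset.sum_range_succ (fun l => (m.choose (l + 1)) • (D ^ l * r ^ (m + 1 - 1 - l)))]
    simp [nsmul_eq_mul, Nat.cast_comm]

/-- The previous identity for r = right multiplication by a and D = ad a, evaluated at y_k. The
shifted binomial coefficient is what produces (e^N - 1)/N rather than e^N. -/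
theorem sum_pow_mul_mul_pow {a : R} {y : Fin n → R} {N : Matrix (Fin n) (Fin n) ℂ}
    (h : ∀ k, a * y k - y k * a = rowComb N y k) (m : ℕ) (k : Fin n) :
    ∑ p ∈ Finset.range m, a ^ p * y k * a ^ (m - 1 - p) =
      ∑ l ∈ Finset.range m, (m.choose (l + 1)) • (rowComb (N ^ l) y k * a ^ (m - 1 - l)) := by
  have hc : Commute (LinearMap.mulLeft ℂ a - LinearMap.mulRight ℂ a) (LinearMap.mulRight ℂ a) :=
    (LinearMap.commute_mulLeft_right a a).sub_left (Commute.refl _)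
  have h0 := sum_pow_mul_pow_eq hc m
  simp_rw [hc.pow_pow _ _ |>.eq] at h0
  have := congrArg (fun f : Module.End ℂ R => f (y k)) h0
  simp only [sub_add_cancel, LinearMap.sum_apply, LinearMap.pow_mulLeft, LinearMap.pow_mulRight,
    Module.End.mul_apply, LinearMap.mulLeft_apply, LinearMap.mulRight_apply,
    LinearMap.smul_apply, ad_pow_apply h] at this
  simpa only [mul_assoc] using this

/-- Right multiplication by a is ad(-a) plus left multiplication by a, and the two summands commute,
so the binomial theorem applies. -/
theorem mul_pow_eq_sum {a : R} {y : Fin n → R} {N : Matrix (Fin n) (Fin n) ℂ}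
    (h : ∀ k, a * y k - y k * a = rowComb N y k) (m : ℕ) (k : Fin n) :
    y k * a ^ m = ∑ p ∈ Finset.HasAntidiagonal.antidiagonal m,
      (m.choose p.1) • (a ^ p.2 * rowComb ((-N) ^ p.1) y k) := by
  have hN : ∀ k, (-a) * y k - y k * (-a) = rowComb (-N) y k := fun k => by
    have := congrArg Neg.neg (h k)
    simpa [rowComb, sub_eq_add_neg, add_comm] using this
  have hc : Commute (LinearMap.mulLeft ℂ (-a) - LinearMap.mulRight ℂ (-a)) (LinearMap.mulLeft ℂ a) := by
    refine Commute.sub_left ?_ ?_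
    · rw [commute_iff_eq]; ext x; simp
    · exact (LinearMap.commute_mulLeft_right _ _).symm
  have e : LinearMap.mulRight ℂ a =
      (LinearMap.mulLeft ℂ (-a) - LinearMap.mulRight ℂ (-a)) + LinearMap.mulLeft ℂ a := by
    ext x; simp
  have h0 := hc.add_pow' m
  rw [← e] at h0
  simp_rw [hc.pow_pow _ _ |>.eq] at h0
  have := congrArg (fun f : Module.End ℂ R => f (y k)) h0
  simpa only [LinearMap.sum_apply, LinearMap.pow_mulLeft, LinearMap.pow_mulRight,
    Module.End.mul_apply, LinearMap.mulLeft_apply, LinearMap.mulRight_apply,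
    LinearMap.smul_apply, ad_pow_apply hN] using this

end Commutation

/-! ### Derivative of the exponential and conjugation of generators -/

section ExpDeriv

variable {n : ℕ} {V M : Type*} [NormedAddCommGroup V] [NormedSpace ℂ V] [CompleteSpace V]
  [AddCommGroup M] [Module ℂ M] {J : M →ₗ[ℂ] V} {y : Fin n → Module.End ℂ M}

theorem IsAnalyticVec.hasSum_expMap {v : M} {r : ℝ} (h : IsAnalyticVec J y v r) {z : Fin n → ℂ}
    (hz : ‖z‖ ≤ r) :
    HasSum (fun m : ℕ => ((m.factorial : ℂ))⁻¹ • J ((genComb y z ^ m) v)) (expMap J y z v) :=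
  (h.summable_norm hz).of_norm.hasSum

theorem IsAnalyticVec.hasSum_genExpMap {v : M} {r : ℝ} (h : IsAnalyticVec J y v r)
    {z : Fin n → ℂ} (hz : ‖z‖ < r) (k : Fin n) :
    HasSum (fun m : ℕ => ((m.factorial : ℂ))⁻¹ • J ((y k * genComb y z ^ m) v))
      (genExpMap J y k z v) :=
  (h.summable_norm_gen hz k).of_norm.hasSum

theorem isBoundedBilinearMap_smul_complex (V : Type*) [NormedAddCommGroup V] [NormedSpace ℂ V] :
    IsBoundedBilinearMap ℝ fun p : ℂ × V => p.1 • p.2 where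
  add_left _ _ _ := add_smul _ _ _
  smul_left _ _ _ := smul_assoc _ _ _
  add_right _ _ _ := smul_add _ _ _
  smul_right c a v := smul_comm a c v
  bound := ⟨1, one_pos, fun a v => by rw [norm_smul, one_mul]⟩

theorem factorial_inv_mul_choose_succ {m : ℕ} (p : ℕ × ℕ) (hp : p.1 + p.2 = m) :
    (((m + 1).factorial : ℂ))⁻¹ * ((m + 1).choose (p.1 + 1) : ℂ) =
      (((p.1 + 1).factorial : ℂ))⁻¹ * ((p.2.factorial : ℂ))⁻¹ := by
  subst hp
  have h := Nat.add_choose_mul_factorial_mul_factorial (p.1 + 1) p.2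
  rw [show p.1 + p.2 + 1 = p.1 + 1 + p.2 by ring, ← h, ← Nat.choose_symm_add]
  have h1 : ((p.1 + 1 + p.2).choose (p.1 + 1) : ℂ) ≠ 0 := by
    exact_mod_cast (Nat.choose_pos (by omega)).ne'
  have h2 : ((p.1 + 1).factorial : ℂ) ≠ 0 := by exact_mod_cast Nat.factorial_ne_zero _
  have h3 : (p.2.factorial : ℂ) ≠ 0 := by exact_mod_cast Nat.factorial_ne_zero _
  push_cast
  field_simp

theorem factorial_inv_mul_choose {m : ℕ} (p : ℕ × ℕ) (hp : p.1 + p.2 = m) :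
    ((m.factorial : ℂ))⁻¹ * (m.choose p.1 : ℂ) =
      ((p.1.factorial : ℂ))⁻¹ * ((p.2.factorial : ℂ))⁻¹ := by
  subst hp
  rw [← Nat.add_choose_mul_factorial_mul_factorial p.1 p.2, ← Nat.choose_symm_add]
  have h1 : ((p.1 + p.2).choose p.1 : ℂ) ≠ 0 := by
    exact_mod_cast (Nat.choose_pos (by omega)).ne'
  have h2 : (p.1.factorial : ℂ) ≠ 0 := by exact_mod_cast Nat.factorial_ne_zero _
  have h3 : (p.2.factorial : ℂ) ≠ 0 := by exact_mod_cast Nat.factorial_ne_zero _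
  push_cast
  field_simp

/-- The derivatives of `z ↦ exp (∑ₖ zᵏ y_k) v`. -/
theorem IsAnalyticVec.exists_hasFDerivAt_expMap {v : M} {r : ℝ} (h : IsAnalyticVec J y v r)
    {z : Fin n → ℂ} (hz : ‖z‖ < r) {N : Matrix (Fin n) (Fin n) ℂ}
    (hN : ∀ k, genComb y z * y k - y k * genComb y z = rowComb N y k) :
    ∃ L : (Fin n → ℂ) →L[ℂ] V, HasFDerivAt (fun z => expMap J y z v) L z ∧
      ∀ k, L (Pi.single k 1) = ∑ j, expQuot N k j • genExpMap J y j z v := by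
  obtain ⟨ρ, hzρ, hρr⟩ := exists_between hz
  have hρ0 : 0 < ρ := (norm_nonneg z).trans_lt hzρ
  choose L hL hL' using fun (m : ℕ) (z : Fin n → ℂ) => exists_hasFDerivAt_pow J y m z v
  -- There are m positions for the differentiated factor, and the m - 1 others have size at most ρ.
  let u : ℕ → ℝ := fun m => ((m.factorial : ℝ))⁻¹ * (m * ρ ^ (m - 1) * wordNorm J y m v)
  have hu : Summable u := by
    rw [← summable_nat_add_iff 1]
    refine (h.summable_shift hρ0.le hρr).congr fun m => ?_
    simp only [u, Nat.factorial_succ, Nat.add_sub_cancel]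
    push_cast
    field_simp
  have hbound : ∀ m x, x ∈ Metric.ball (0 : Fin n → ℂ) ρ →
      ‖((m.factorial : ℂ))⁻¹ • L m x‖ ≤ u m := by
    intro m x hx
    have hxρ : ‖x‖ ≤ ρ := (mem_ball_zero_iff.1 hx).le
    rw [norm_smul, norm_inv, Complex.norm_natCast]
    refine mul_le_mul_of_nonneg_left ?_ (by positivity)
    have h0 := wordNorm_nonneg J y m v
    refine ContinuousLinearMap.opNorm_le_bound _ (by positivity) fun b => ?_
    rw [hL', powDeriv, LinearMap.sum_apply, map_sum]
    refine (norm_sum_le _ _).trans ?_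
    have : ∀ p ∈ Finset.range m, ‖J ((genComb y x ^ p * genComb y b * genComb y x ^ (m - 1 - p)) v)‖
        ≤ ρ ^ (m - 1) * wordNorm J y m v * ‖b‖ := by
      intro p hp
      have hp := Finset.mem_range.1 hp
      have := norm_pow_mul_pow_genComb_le J y x b p (m - 1 - p) v
      rw [show p + (m - 1 - p) = m - 1 by omega, show m - 1 + 1 = m by omega] at this
      refine this.trans ?_
      rw [mul_right_comm]
      gcongr
    refine (Finset.sum_le_sum this).trans (le_of_eq ?_)
    simp
    ring
  have hder := hasFDerivAt_tsum_of_isPreconnected hu Metric.isOpen_ball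
    (convex_ball (0 : Fin n → ℂ) ρ).isPreconnected
    (f := fun m z => ((m.factorial : ℂ))⁻¹ • J ((genComb y z ^ m) v))
    (f' := fun m z => ((m.factorial : ℂ))⁻¹ • L m z)
    (fun m x _ => (hL m x).const_smul _) hbound (Metric.mem_ball_self hρ0)
    (h.summable_norm (by simpa using hρ0.le.trans hρr.le)).of_norm (mem_ball_zero_iff.2 hzρ)
  refine ⟨_, hder, fun k => ?_⟩
  have hs : Summable fun m : ℕ => ((m.factorial : ℂ))⁻¹ • L m z :=
    Summable.of_norm_bounded hu fun m => hbound m z (mem_ball_zero_iff.2 hzρ)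
  have hs1 := (ContinuousLinearMap.apply ℂ V (Pi.single k 1 : Fin n → ℂ)).hasSum hs.hasSum
  -- The constant term m = 0 has zero derivative and is dropped, which yields the factorials (m +
  -- 1)! of `expQuot`.
  have hs2 : HasSum (fun m : ℕ => (((m + 1).factorial : ℂ))⁻¹ •
      J (powDeriv y (m + 1) z (Pi.single k 1) v))
      ((∑' m : ℕ, ((m.factorial : ℂ))⁻¹ • L m z) (Pi.single k 1)) := by
    have := (hasSum_nat_add_iff' 1).2 hs1
    simpa [hL', powDeriv] using this
  -- The claimed value is a Cauchy product of two absolutely convergent series, so the terms of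
  -- equal degree can be compared algebraically.
  have hs3 : ∀ j, HasSum (fun m => ∑ p ∈ Finset.HasAntidiagonal.antidiagonal m,
      ((((p.1 + 1).factorial : ℂ))⁻¹ * (N ^ p.1) k j) •
        (((p.2.factorial : ℂ))⁻¹ • J ((y j * genComb y z ^ p.2) v)))
      (expQuot N k j • genExpMap J y j z v) := fun j => by
    have := hasSum_antidiagonal_bilinear (isBoundedBilinearMap_smul_complex V)
      (summable_norm_expQuot_entry N k j) (h.summable_norm_gen hz j)
    rwa [← expQuot_apply] at this
  refine hs2.unique ((hasSum_sum fun j _ => hs3 j).congr_fun fun m => ?_)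
  rw [powDeriv]
  simp_rw [genComb_single]
  have hS := (sum_pow_mul_mul_pow hN (m + 1) k).trans
    (Finset.Nat.sum_antidiagonal_eq_sum_range_succ_mk (fun p : ℕ × ℕ =>
      ((m + 1).choose (p.1 + 1)) • (rowComb (N ^ p.1) y k * genComb y z ^ p.2)) m).symm
  rw [hS, Finset.sum_comm, LinearMap.sum_apply, map_sum, Finset.smul_sum]
  refine Finset.sum_congr rfl fun p hp => ?_
  rw [rowComb, Finset.sum_mul, LinearMap.smul_apply, LinearMap.sum_apply, map_nsmul, map_sum,
    ← Nat.cast_smul_eq_nsmul ℂ, smul_smul,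
    factorial_inv_mul_choose_succ p (Finset.HasAntidiagonal.mem_antidiagonal.1 hp), Finset.smul_sum]
  refine Finset.sum_congr rfl fun j _ => ?_
  rw [smul_mul_assoc, LinearMap.smul_apply, map_smul, smul_smul, smul_smul]
  congr 1
  ring

/-- Commuting a generator past the exponential. -/
theorem IsAnalyticVec.genExpMap_eq {v : M} {r : ℝ} (h : IsAnalyticVec J y v r)
    {z : Fin n → ℂ} (hz : ‖z‖ < r) {N : Matrix (Fin n) (Fin n) ℂ}
    (hN : ∀ k, genComb y z * y k - y k * genComb y z = rowComb N y k) (k : Fin n) :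
    genExpMap J y k z v = ∑ j, NormedSpace.exp (-N) k j • expMap J y z (y j v) := by
  obtain ⟨ρ, hzρ, hρr⟩ := exists_between hz
  have hs3 : ∀ j, HasSum (fun m => ∑ p ∈ Finset.HasAntidiagonal.antidiagonal m,
      (((p.1.factorial : ℂ))⁻¹ * ((-N) ^ p.1) k j) •
        (((p.2.factorial : ℂ))⁻¹ • J ((genComb y z ^ p.2) (y j v))))
      (NormedSpace.exp (-N) k j • expMap J y z (y j v)) := fun j => by
    have := hasSum_antidiagonal_bilinear (isBoundedBilinearMap_smul_complex V)
      (summable_norm_exp_entry (-N) k j)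
      ((h.gen ((norm_nonneg z).trans hzρ.le) hρr j).summable_norm hzρ.le)
    rwa [← exp_apply] at this
  refine (h.hasSum_genExpMap hz k).unique ((hasSum_sum fun j _ => hs3 j).congr_fun fun m => ?_)
  rw [mul_pow_eq_sum hN, Finset.sum_comm, LinearMap.sum_apply, map_sum, Finset.smul_sum]
  refine Finset.sum_congr rfl fun p hp => ?_
  rw [rowComb, Finset.mul_sum, LinearMap.smul_apply, LinearMap.sum_apply, map_nsmul, map_sum,
    ← Nat.cast_smul_eq_nsmul ℂ, smul_smul,
    factorial_inv_mul_choose p (Finset.HasAntidiagonal.mem_antidiagonal.1 hp), Finset.smul_sum]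
  refine Finset.sum_congr rfl fun j _ => ?_
  rw [mul_smul_comm, LinearMap.smul_apply, map_smul, smul_smul, smul_smul, Module.End.mul_apply]
  congr 1
  ring

end ExpDeriv

/-! ### Exponentials of skew-symmetric operators -/

section Isometry

variable {n : ℕ} {V M : Type*} [NormedAddCommGroup V] [InnerProductSpace ℂ V] [CompleteSpace V]
  [AddCommGroup M] [Module ℂ M] {J : M →ₗ[ℂ] V} {y : Fin n → Module.End ℂ M}

/-- The exponential of a skew-symmetric operator is isometric on analytic vectors. -/
theorem inner_expMap_of_skew {u v : M} {z : Fin n → ℂ} (hu : IsAnalyticVec J y u ‖z‖)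
    (hv : IsAnalyticVec J y v ‖z‖)
    (hskew : ∀ u v, inner ℂ (J (genComb y z u)) (J v) = -inner ℂ (J u) (J (genComb y z v))) :
    inner ℂ (expMap J y z u) (expMap J y z v) = inner ℂ (J u) (J v) := by
  have hpow : ∀ p u v, inner ℂ (J ((genComb y z ^ p) u)) (J v) =
      (-1) ^ p * inner ℂ (J u) (J ((genComb y z ^ p) v)) := by
    intro p
    induction p with
    | zero => simp
    | succ p ih =>
      intro u v
      rw [pow_succ', Module.End.mul_apply, hskew, ih, pow_succ' (-1 : ℂ), ← Module.End.mul_apply,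
        ← pow_succ, pow_succ', Module.End.mul_apply]
      ring
  have h := hasSum_antidiagonal_bilinear (isBoundedBilinearMap_inner (𝕜 := ℂ) (E := V))
    (hu.summable_norm le_rfl) (hv.summable_norm le_rfl)
  refine h.unique ?_
  -- Moving all powers to the right, the m-th degree part of the Cauchy product carries (1 - 1)^m /
  -- m!, so only m = 0 survives.
  have h0 := hasSum_single (f := fun m : ℕ => ((m.factorial : ℂ))⁻¹ * (0 : ℂ) ^ m *
    inner ℂ (J u) (J ((genComb y z ^ m) v))) 0 (fun m hm => by simp [hm])
  simp only [Nat.factorial_zero, Nat.cast_one, inv_one, pow_zero, Module.End.one_apply,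
    one_mul] at h0
  refine h0.congr_fun fun m => ?_
  have e : (0 : ℂ) ^ m = ∑ p ∈ Finset.HasAntidiagonal.antidiagonal m, (m.choose p.1 : ℂ) * (-1) ^ p.1 := by
    have := (Commute.all (-1 : ℂ) 1).add_pow' m
    simpa [nsmul_eq_mul] using this
  rw [e, Finset.mul_sum, Finset.sum_mul]
  refine Finset.sum_congr rfl fun p hp => ?_
  have hp := Finset.HasAntidiagonal.mem_antidiagonal.1 hp
  rw [inner_smul_left, inner_smul_right, hpow, ← Module.End.mul_apply, ← pow_add, hp, ← mul_assoc,
    ← mul_assoc, ← mul_assoc, factorial_inv_mul_choose p hp]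
  simp

end Isometry

/-! ### Injectivity of the exponential on analytic vectors -/

section NonVanishing

variable {H : Type*} [NormedAddCommGroup H] [InnerProductSpace ℂ H] [CompleteSpace H]
  {E D : Submodule ℂ H}

/-- The exponential of an operator with densely defined formal adjoint is injective on its
analytic vectors. -/
theorem eq_zero_of_tsum_exp_eq_zero (hE : Dense (E : Set H)) {a : Module.End ℂ E}
    {b : Module.End ℂ D}
    (hab : ∀ (u : E) (v : D), inner ℂ ((a u : E) : H) (v : H) = inner ℂ (u : H) ((b v : D) : H))
    {v : D} {ρ : ℝ} (hρ : 1 < ρ)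
    (hs : Summable fun m : ℕ => ρ ^ m / (m.factorial : ℝ) * ‖(((b ^ m) v : D) : H)‖)
    (h0 : ∑' m : ℕ, ((m.factorial : ℂ))⁻¹ • (((b ^ m) v : D) : H) = 0) : (v : H) = 0 := by
  have hpow : ∀ (p : ℕ) (u : E) (v : D), inner ℂ (((a ^ p) u : E) : H) (v : H) =
      inner ℂ (u : H) (((b ^ p) v : D) : H) := by
    intro p
    induction p with
    | zero => simp
    | succ p ih =>
      intro u v
      rw [pow_succ, Module.End.mul_apply, ih, hab, pow_succ', Module.End.mul_apply]
  -- g t u is ⟨u, e^{tb} v⟩. The goal is g 0 = 0, starting from g 1 = 0.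
  let g : ℝ → E → ℂ := fun t u => ∑' m : ℕ, ((t : ℂ) ^ m / (m.factorial : ℂ)) *
    inner ℂ (u : H) (((b ^ m) v : D) : H)
  -- Expanding e^{sb} and moving its powers to u gives ⟨u, e^{(s+t)b} v⟩ = ∑ s^p/p! g t (a^p u), all
  -- of whose terms vanish. The restriction on s and t is absolute convergence of the double series.
  have hstep : ∀ s t : ℝ, |s| + |t| ≤ ρ → (∀ u, g t u = 0) → ∀ u, g (s + t) u = 0 := by
    intro s t hst ht u
    let F : ℕ × ℕ → ℂ := fun p => ((s : ℂ) ^ p.1 / (p.1.factorial : ℂ)) *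
      (((t : ℂ) ^ p.2 / (p.2.factorial : ℂ)) *
        inner ℂ (((a ^ p.1) u : E) : H) (((b ^ p.2) v : D) : H))
    have hbin : ∀ (K : Type) [Field K] [CharZero K] (s t : K) (m : ℕ),
        ∑ p ∈ Finset.HasAntidiagonal.antidiagonal m, s ^ p.1 / (p.1.factorial : K) *
        (t ^ p.2 / (p.2.factorial : K)) = (s + t) ^ m / (m.factorial : K) := by
      intro K _ _ s t m
      rw [(Commute.all s t).add_pow', Finset.sum_div]
      refine Finset.sum_congr rfl fun p hp => ?_
      obtain rfl := Finset.HasAntidiagonal.mem_antidiagonal.1 hp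
      rw [← Nat.add_choose_mul_factorial_mul_factorial p.1 p.2, ← Nat.choose_symm_add, nsmul_eq_mul]
      have h1 : ((p.1 + p.2).choose p.1 : K) ≠ 0 := by
        exact_mod_cast (Nat.choose_pos (by omega)).ne'
      have h2 : (p.1.factorial : K) ≠ 0 := by exact_mod_cast Nat.factorial_ne_zero _
      have h3 : (p.2.factorial : K) ≠ 0 := by exact_mod_cast Nat.factorial_ne_zero _
      push_cast
      field_simp
    have hanti : ∀ m : ℕ, ∀ p ∈ Finset.HasAntidiagonal.antidiagonal m,
        inner ℂ (((a ^ p.1) u : E) : H) (((b ^ p.2) v : D) : H) =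
          inner ℂ (u : H) (((b ^ m) v : D) : H) := by
      intro m p hp
      rw [hpow, ← Module.End.mul_apply, ← pow_add, Finset.HasAntidiagonal.mem_antidiagonal.1 hp]
    have hF : Summable F := by
      refine Summable.of_norm (summable_prod_of_summable_antidiagonal (fun _ => norm_nonneg _) ?_)
      refine Summable.of_nonneg_of_le (fun m => Finset.sum_nonneg fun _ _ => norm_nonneg _)
        (fun m => ?_) (hs.mul_left ‖(u : H)‖)
      calc ∑ p ∈ Finset.HasAntidiagonal.antidiagonal m, ‖F p‖
          = ∑ p ∈ Finset.HasAntidiagonal.antidiagonal m, (|s| ^ p.1 / (p.1.factorial : ℝ) *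
            (|t| ^ p.2 / (p.2.factorial : ℝ))) * ‖inner ℂ (u : H) (((b ^ m) v : D) : H)‖ := by
            refine Finset.sum_congr rfl fun p hp => ?_
            simp only [F, norm_mul, norm_div, norm_pow, Complex.norm_natCast, Complex.norm_real,
              Real.norm_eq_abs, hanti m p hp]
            ring
        _ ≤ ρ ^ m / (m.factorial : ℝ) * (‖(u : H)‖ * ‖(((b ^ m) v : D) : H)‖) := by
            rw [← Finset.sum_mul, hbin]
            gcongr
            exact norm_inner_le_norm _ _
        _ = _ := by ring
    have h1 := hasSum_sum_antidiagonal hF.hasSum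
    have h2 : ∑' p, F p = 0 := by
      rw [hF.tsum_prod]
      have : ∀ p : ℕ, ∑' q : ℕ, F (p, q) = 0 := fun p => by
        simp only [F]
        rw [tsum_mul_left]
        have := ht ((a ^ p) u)
        simp only [g] at this
        rw [this, mul_zero]
      simp [this]
    rw [h2] at h1
    refine Eq.trans (tsum_congr fun m => ?_) h1.tsum_eq
    simp only [F]
    rw [Complex.ofReal_add, ← hbin ℂ s t m, Finset.sum_mul]
    refine Finset.sum_congr rfl fun p hp => ?_
    rw [hanti m p hp, mul_assoc]
  have hsum1 : Summable fun m : ℕ => ((m.factorial : ℂ))⁻¹ • (((b ^ m) v : D) : H) := by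
    refine Summable.of_norm (Summable.of_nonneg_of_le (fun _ => norm_nonneg _) (fun m => ?_) hs)
    rw [norm_smul, norm_inv, Complex.norm_natCast, div_eq_mul_inv]
    gcongr
    exact le_mul_of_one_le_left (by positivity) (one_le_pow₀ hρ.le)
  have hg1 : ∀ u, g 1 u = 0 := by
    intro u
    have := (innerSL ℂ (u : H)).hasSum hsum1.hasSum
    rw [h0, map_zero] at this
    refine Eq.trans (tsum_congr fun m => ?_) this.tsum_eq
    simp
  -- Steps of length 1/K back from t = 1 satisfy |s| + |t| ≤ 1 + 1/K ≤ ρ, so K of them reach 0.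
  obtain ⟨K, hK⟩ := exists_nat_gt (1 / (ρ - 1))
  have hK0 : (0 : ℝ) < K := lt_trans (one_div_pos.2 (by linarith)) hK
  have hK1 : 1 + 1 / (K : ℝ) ≤ ρ := by
    have : 1 / (K : ℝ) < ρ - 1 := by
      rw [div_lt_iff₀ hK0]
      rw [div_lt_iff₀ (by linarith)] at hK
      linarith
    linarith
  have hind : ∀ k : ℕ, k ≤ K → ∀ u, g (1 - k / K) u = 0 := by
    intro k
    induction k with
    | zero => intro _ u; simpa using hg1 u
    | succ k ih =>
      intro hk u
      have hk' : (k : ℝ) ≤ K := by exact_mod_cast (Nat.le_of_succ_le hk)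
      have h2 : (k : ℝ) / K ≤ 1 := (div_le_one hK0).2 hk'
      have h3 : 0 ≤ (k : ℝ) / K := by positivity
      have := hstep (-(1 / K)) (1 - k / K) (by
        rw [abs_neg, abs_of_pos (by positivity), abs_of_nonneg (by linarith)]
        linarith) (ih (Nat.le_of_succ_le hk)) u
      rw [← this]
      congr 1
      push_cast
      ring
  have hg0 : ∀ u : E, inner ℂ (u : H) (v : H) = 0 := by
    intro u
    have h1 := hind K le_rfl u
    rw [div_self hK0.ne', sub_self] at h1
    simp only [g] at h1
    rw [tsum_eq_single 0 (fun m hm => by simp [hm])] at h1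
    simpa using h1
  exact hE.eq_zero_of_inner_right ℂ fun u hu => hg0 ⟨u, hu⟩

end NonVanishing

/-! ### Analytic families of vectors in the Hilbert sum -/

section Families

variable {H : Type*} [NormedAddCommGroup H] [InnerProductSpace ℂ H] {ι : Type*} {n : ℕ}
  {D : Submodule ℂ H} (y : Fin n → Module.End ℂ D)

/-- The families `v` in `D` for which all families `y_w v` are square summable. -/
def smoothFamilies (ι : Type*) : Submodule ℂ (ι → D) where
  carrier := {v | ∀ w : List (Fin n), Memℓp (fun j => (((w.map y).prod (v j) : D) : H)) 2}
  add_mem' hu hv w := by simpa using! (hu w).add (hv w)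
  zero_mem' w := by
    simp only [Pi.zero_apply, map_zero, ZeroMemClass.coe_zero]
    exact zero_memℓp
  smul_mem' c v hv w := by simpa using! (hv w).const_smul c

/-- A smooth family as an element of the Hilbert sum. -/
def familyL2 : smoothFamilies y ι →ₗ[ℂ] L2 ι H where
  toFun v := ⟨fun j => (v.1 j : H), v.2 []⟩
  map_add' _ _ := rfl
  map_smul' _ _ := rfl

/-- A generator acting on every member of a smooth family. -/
def familyGen (k : Fin n) : Module.End ℂ (smoothFamilies y ι) where
  toFun v := ⟨fun j => y k (v.1 j), fun w => by simpa using v.2 (w ++ [k])⟩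
  map_add' u v := Subtype.ext (funext fun j => map_add (y k) (u.1 j) (v.1 j))
  map_smul' c v := Subtype.ext (funext fun j => map_smul (y k) c (v.1 j))

@[simp] theorem familyL2_apply (v : smoothFamilies y ι) (j : ι) :
    familyL2 y v j = (v.1 j : H) := rfl

@[simp] theorem familyGen_apply (k : Fin n) (v : smoothFamilies y ι) (j : ι) :
    (familyGen y k v).1 j = y k (v.1 j) := rfl

theorem list_prod_familyGen_apply (w : List (Fin n)) (v : smoothFamilies y ι) (j : ι) :
    ((w.map (familyGen y)).prod v).1 j = (w.map y).prod (v.1 j) := by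
  induction w with
  | nil => rfl
  | cons k w ih => simp [ih]

theorem genComb_familyGen_apply (z : Fin n → ℂ) (v : smoothFamilies y ι) (j : ι) :
    (genComb (familyGen y) z v).1 j = genComb y z (v.1 j) := by
  rw [genComb_apply, genComb_apply]
  simp [Finset.sum_apply]

theorem genComb_familyGen_pow_apply (z : Fin n → ℂ) (m : ℕ) (v : smoothFamilies y ι) (j : ι) :
    ((genComb (familyGen y) z ^ m) v).1 j = (genComb y z ^ m) (v.1 j) := by
  induction m with
  | zero => rfl
  | succ m ih =>
    rw [pow_succ', Module.End.mul_apply, genComb_familyGen_apply, ih, pow_succ',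
      Module.End.mul_apply]

theorem familyGen_comm {c : Fin n → Fin n → Fin n → ℂ}
    (h : ∀ i k, y i * y k - y k * y i = ∑ j, c i k j • y j) (i k : Fin n) :
    (familyGen y i : Module.End ℂ (smoothFamilies y ι)) * familyGen y k
      - familyGen y k * familyGen y i = ∑ j, c i k j • familyGen y j := by
  refine LinearMap.ext fun v => Subtype.ext (funext fun a => ?_)
  have := congrArg (fun f : Module.End ℂ D => f (v.1 a)) (h i k)
  simp only [LinearMap.sub_apply, Module.End.mul_apply, LinearMap.sum_apply,
    LinearMap.smul_apply] at this
  simpa [Finset.sum_apply] using this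

variable {y}

theorem JointlyAnalytic.mem_smoothFamilies {ψ : ι → D} {r : ℝ} (h : JointlyAnalytic y ψ r) :
    ψ ∈ smoothFamilies y ι := fun w => L2.memℓp_of_summable (h.1 w)

/-- The square roots in joint analyticity are norms in the Hilbert sum; the words are grouped by
length. -/
theorem JointlyAnalytic.isAnalyticVec {ψ : ι → D} {r : ℝ} (h : JointlyAnalytic y ψ r) :
    IsAnalyticVec (familyL2 y) (familyGen y) ⟨ψ, h.mem_smoothFamilies⟩ r := by
  have h2 := ((List.equivSigmaTuple (α := Fin n)).symm.summable_iff.2 h.2).sigma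
  refine h2.congr fun m => ?_
  rw [tsum_fintype, wordNorm, Finset.mul_sum]
  refine Finset.sum_congr rfl fun w _ => ?_
  simp only [Function.comp, List.equivSigmaTuple, Equiv.coe_fn_symm_mk, List.length_ofFn]
  congr 1
  have := (L2.hasSum_norm_sq (familyL2 y (((List.ofFn w).map (familyGen y)).prod
    ⟨ψ, h.mem_smoothFamilies⟩))).tsum_eq
  rw [← Real.sqrt_sq (norm_nonneg (familyL2 y _)), ← this]
  simp only [familyL2_apply, list_prod_familyGen_apply]

theorem JointlyAnalytic.isAnalyticVec_apply {ψ : ι → D} {r : ℝ} (h : JointlyAnalytic y ψ r)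
    (hr : 0 ≤ r) (j : ι) : IsAnalyticVec D.subtype y (ψ j) r := by
  refine Summable.of_nonneg_of_le (fun m => ?_) (fun m => ?_) h.isAnalyticVec
  · have := wordNorm_nonneg D.subtype y m (ψ j)
    positivity
  · refine mul_le_mul_of_nonneg_left ?_ (by positivity)
    refine Finset.sum_le_sum fun w _ => ?_
    have := lp.norm_apply_le_norm (p := 2) (by norm_num) (familyL2 y
      (((List.ofFn w).map (familyGen y)).prod ⟨ψ, h.mem_smoothFamilies⟩)) j
    rw [familyL2_apply, list_prod_familyGen_apply] at this
    exact this

theorem L2.hasSum_apply {f : ℕ → L2 ι H} {a : L2 ι H} (h : HasSum f a) (j : ι) :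
    HasSum (fun m => f m j) (a j) := by
  simpa using! h.mapL (lp.evalCLM ℂ (fun _ : ι => H) 2 j)

/-- The generators of `D` satisfy the adjoint commutation relations. -/
theorem adjoint_comm {E : Submodule ℂ H} (hE : Dense (E : Set H)) {x : Fin n → Module.End ℂ E}
    {C : Fin n → Fin n → Fin n → ℂ}
    (hC : ∀ i k, x i * x k - x k * x i = ∑ j, C i k j • x j)
    (hxy : ∀ (k : Fin n) (u : E) (v : D),
      inner ℂ ((x k u : E) : H) (v : H) = inner ℂ (u : H) ((y k v : D) : H)) (i k : Fin n) :
    y i * y k - y k * y i = ∑ j, conj (C k i j) • y j := by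
  refine LinearMap.ext fun v => Subtype.ext ?_
  refine hE.eq_of_inner_right ℂ fun u hu => ?_
  have h1 := congrArg (fun f : Module.End ℂ E => inner ℂ ((f ⟨u, hu⟩ : E) : H) (v : H)) (hC k i)
  simp only [LinearMap.sub_apply, Module.End.mul_apply, LinearMap.sum_apply, LinearMap.smul_apply,
    Submodule.coe_sub, Submodule.coe_sum, Submodule.coe_smul, inner_sub_left, sum_inner,
    inner_smul_left, hxy] at h1
  simp only [LinearMap.sub_apply, Module.End.mul_apply, LinearMap.sum_apply, LinearMap.smul_apply,
    Submodule.coe_sub, Submodule.coe_sum, Submodule.coe_smul, inner_sub_right, inner_sum,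
    inner_smul_right, h1]

/-- Adjunction conjugates the structure constants and reverses the commutator, so ad of ∑ zᵏ y_k is
the entrywise conjugate of the matrix built from C at z̄. -/
theorem genComb_comm {R : Type*} [AddCommGroup R] [Module ℂ R] {y : Fin n → Module.End ℂ R}
    {C : Fin n → Fin n → Fin n → ℂ}
    (h : ∀ i k, y i * y k - y k * y i = ∑ j, conj (C k i j) • y j) (z : Fin n → ℂ) (k : Fin n) :
    genComb y z * y k - y k * genComb y z = rowComb ((adMatrix C (star z)).map conj) y k := by
  rw [genComb, Finset.sum_mul, Finset.mul_sum, ← Finset.sum_sub_distrib]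
  simp_rw [smul_mul_assoc, mul_smul_comm, ← smul_sub, h, Finset.smul_sum, smul_smul]
  rw [Finset.sum_comm]
  refine Finset.sum_congr rfl fun j _ => ?_
  rw [← Finset.sum_smul]
  congr 1
  simp [adMatrix, Matrix.sum_apply]

variable [CompleteSpace H]

/-- The family `exp (zᵏ y_k) ψ` in the Hilbert sum. -/
def expFamily {ψ : ι → D} {r : ℝ} (h : JointlyAnalytic y ψ r) (z : Fin n → ℂ) : L2 ι H :=
  expMap (familyL2 y) (familyGen y) z ⟨ψ, h.mem_smoothFamilies⟩

/-- The family `y_k exp (zᵏ y_k) ψ` in the Hilbert sum. -/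
def genExpFamily {ψ : ι → D} {r : ℝ} (h : JointlyAnalytic y ψ r) (k : Fin n) (z : Fin n → ℂ) :
    L2 ι H :=
  genExpMap (familyL2 y) (familyGen y) k z ⟨ψ, h.mem_smoothFamilies⟩

theorem expFamily_apply {ψ : ι → D} {r : ℝ} (h : JointlyAnalytic y ψ r) {z : Fin n → ℂ}
    (hz : ‖z‖ < r) (j : ι) : expFamily h z j = expVec y z (ψ j) := by
  have := L2.hasSum_apply (h.isAnalyticVec.hasSum_expMap hz.le) j
  refine this.tsum_eq.symm.trans (tsum_congr fun m => ?_)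
  simp [genComb_familyGen_pow_apply]

theorem hasSum_genExpFamily_apply {ψ : ι → D} {r : ℝ} (h : JointlyAnalytic y ψ r) {z : Fin n → ℂ}
    (hz : ‖z‖ < r) (k : Fin n) (j : ι) :
    HasSum (fun m : ℕ => ((m.factorial : ℂ))⁻¹ • ((y k ((genComb y z ^ m) (ψ j)) : D) : H))
      (genExpFamily h k z j) := by
  have := L2.hasSum_apply (h.isAnalyticVec.hasSum_genExpMap hz k) j
  refine this.congr_fun fun m => ?_
  simp [genComb_familyGen_pow_apply]

/-- This identifies `genExpFamily` as x_k* applied to the exponential, which itself need not lie in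
D. -/
theorem inner_expFamily {E : Submodule ℂ H} {x : Fin n → Module.End ℂ E}
    (hxy : ∀ (k : Fin n) (u : E) (v : D),
      inner ℂ ((x k u : E) : H) (v : H) = inner ℂ (u : H) ((y k v : D) : H))
    {ψ : ι → D} {r : ℝ} (h : JointlyAnalytic y ψ r) {z : Fin n → ℂ}
    (hz : ‖z‖ < r) (k : Fin n) (u : E) (j : ι) :
    inner ℂ ((x k u : E) : H) (expFamily h z j) = inner ℂ (u : H) (genExpFamily h k z j) := by
  have h1 := (L2.hasSum_apply (h.isAnalyticVec.hasSum_expMap hz.le) j).mapL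
    (innerSL ℂ ((x k u : E) : H))
  have h2 := (hasSum_genExpFamily_apply h hz k j).mapL (innerSL ℂ (u : H))
  refine h1.unique (h2.congr_fun fun m => ?_)
  simp only [innerSL_apply_apply, inner_smul_right, ← hxy]
  simp [genComb_familyGen_pow_apply, inner_smul_right]

theorem expFamily_ne_zero {E : Submodule ℂ H} (hE : Dense (E : Set H)) {x : Fin n → Module.End ℂ E}
    (hxy : ∀ (k : Fin n) (u : E) (v : D),
      inner ℂ ((x k u : E) : H) (v : H) = inner ℂ (u : H) ((y k v : D) : H))
    {ψ : ι → D} (hψ : HasSum (fun j => ‖(ψ j : H)‖ ^ 2) 1) {r : ℝ} (h : JointlyAnalytic y ψ r)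
    {z : Fin n → ℂ} (hz : ‖z‖ < r) : expFamily h z ≠ 0 := by
  intro h0
  have hr : 0 < r := (norm_nonneg z).trans_lt hz
  have key : ∀ j, (ψ j : H) = 0 := by
    intro j
    have hj : expVec y z (ψ j) = 0 := by
      rw [← expFamily_apply h hz j, h0]; rfl
    -- Room beyond parameter 1 on the ray through z is needed for injectivity; the open polydisc
    -- provides it.
    obtain ⟨t, ht1, ht2⟩ : ∃ t : ℝ, 1 < t ∧ t * ‖z‖ ≤ r := by
      rcases eq_or_lt_of_le (norm_nonneg z) with hz0 | hz0
      · exact ⟨2, by norm_num, by rw [← hz0]; simpa using hr.le⟩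
      · exact ⟨r / ‖z‖, (one_lt_div hz0).2 hz, by rw [div_mul_cancel₀ _ hz0.ne']⟩
    refine eq_zero_of_tsum_exp_eq_zero hE (a := genComb x (star z)) (b := genComb y z) ?_ ht1 ?_ hj
    · intro u v
      rw [genComb_apply, genComb_apply]
      simp only [Submodule.coe_sum, Submodule.coe_smul, sum_inner, inner_sum, inner_smul_left,
        inner_smul_right, hxy, Pi.star_apply, RCLike.star_def, Complex.conj_conj]
    · have h1 := (h.isAnalyticVec_apply hr.le j).summable_norm (z := (t : ℂ) • z) (by
        rw [norm_smul, Complex.norm_real, Real.norm_of_nonneg (by linarith)]; exact ht2)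
      refine h1.congr fun m => ?_
      rw [genComb_smul, smul_pow, LinearMap.smul_apply, map_smul, smul_smul, norm_smul, norm_mul,
        norm_inv, Complex.norm_natCast, norm_pow, Complex.norm_real,
        Real.norm_of_nonneg (by linarith : (0 : ℝ) ≤ t)]
      simp only [Submodule.subtype_apply]
      ring
  have : (1 : ℝ) = 0 := hψ.unique (by simp [key])
  exact one_ne_zero this

/-- The derivative of the family `exp (zᵏ y_k) ψ`. -/
theorem exists_hasFDerivAt_expFamily {C : Fin n → Fin n → Fin n → ℂ}
    (hy : ∀ i k, y i * y k - y k * y i = ∑ j, conj (C k i j) • y j)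
    {ψ : ι → D} {r : ℝ} (h : JointlyAnalytic y ψ r) {z : Fin n → ℂ} (hz : ‖z‖ < r) :
    ∃ L : (Fin n → ℂ) →L[ℂ] L2 ι H, HasFDerivAt (expFamily h) L z ∧
      ∀ k, L (Pi.single k 1) =
        ∑ j, conj (expQuot (adMatrix C (star z)) k j) • genExpFamily h j z := by
  obtain ⟨L, h1, h2⟩ := h.isAnalyticVec.exists_hasFDerivAt_expMap hz
    (genComb_comm (familyGen_comm y hy) z)
  refine ⟨L, h1, fun k => ?_⟩
  rw [h2, expQuot_map_conj]
  rfl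

end Families

/-! ### Matrix Cauchy–Schwarz inequality -/

section MatrixInequality

/-- The matrix form of the Cauchy–Schwarz inequality. -/
theorem posSemidef_sub_mul_inv_mul {𝕜 ι κ : Type*} [RCLike 𝕜] [Fintype ι] [Fintype κ]
    [DecidableEq κ] {R : Matrix ι ι 𝕜} {G : Matrix κ κ 𝕜} {B : Matrix ι κ 𝕜}
    (hR : R.PosSemidef) (hG : G.PosSemidef) (hGu : IsUnit G.det)
    (h : ∀ z x, ‖star z ⬝ᵥ (B *ᵥ x)‖ ^ 2 ≤
      RCLike.re (star z ⬝ᵥ (R *ᵥ z)) * RCLike.re (star x ⬝ᵥ (G *ᵥ x))) :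
    (R - B * G⁻¹ * Bᴴ).PosSemidef := by
  have hGi : G⁻¹.PosSemidef := hG.inv
  have hP : (B * G⁻¹ * Bᴴ).PosSemidef := hGi.mul_mul_conjTranspose_same B
  refine Matrix.posSemidef_iff_dotProduct_mulVec.2 ⟨hR.1.sub hP.1, fun z => ?_⟩
  rw [Matrix.sub_mulVec, dotProduct_sub]
  have hRz := Matrix.posSemidef_iff_dotProduct_mulVec.1 hR |>.2 z
  have hPz := Matrix.posSemidef_iff_dotProduct_mulVec.1 hP |>.2 z
  rw [RCLike.nonneg_iff] at hRz hPz ⊢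
  refine ⟨?_, by rw [map_sub, hRz.2, hPz.2, sub_zero]⟩
  rw [map_sub]
  -- This is the optimal x. With p = z† B G⁻¹ B† z the hypothesis becomes p² ≤ (z† R z) p, and p can
  -- be cancelled unless it is 0.
  have hz := h z (G⁻¹ *ᵥ (Bᴴ *ᵥ z))
  have e1 : B *ᵥ (G⁻¹ *ᵥ (Bᴴ *ᵥ z)) = (B * G⁻¹ * Bᴴ) *ᵥ z := by
    simp [Matrix.mulVec_mulVec, Matrix.mul_assoc]
  have e2 : star (G⁻¹ *ᵥ (Bᴴ *ᵥ z)) ⬝ᵥ (G *ᵥ (G⁻¹ *ᵥ (Bᴴ *ᵥ z))) =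
      star z ⬝ᵥ ((B * G⁻¹ * Bᴴ) *ᵥ z) := by
    rw [Matrix.mulVec_mulVec _ G, Matrix.mul_nonsing_inv _ hGu, Matrix.one_mulVec,
      Matrix.star_mulVec, Matrix.star_mulVec, Matrix.conjTranspose_conjTranspose, hGi.1.eq,
      Matrix.dotProduct_mulVec, Matrix.vecMul_vecMul, Matrix.vecMul_vecMul, ← Matrix.mul_assoc,
      ← Matrix.dotProduct_mulVec]
  rw [e1, e2] at hz
  have h3 : (RCLike.re (star z ⬝ᵥ ((B * G⁻¹ * Bᴴ) *ᵥ z))) ^ 2 ≤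
      ‖star z ⬝ᵥ ((B * G⁻¹ * Bᴴ) *ᵥ z)‖ ^ 2 := by
    rw [← sq_abs]
    gcongr
    exact RCLike.abs_re_le_norm _
  rcases eq_or_lt_of_le hPz.1 with h0 | h0
  · rw [← h0, sub_zero]; exact hRz.1
  · have := h3.trans hz
    rw [sq] at this
    linarith [le_of_mul_le_mul_right this h0]

end MatrixInequality

/-! ### Error matrices and the abstract Cramér–Rao inequality -/

section ErrorMatrix

variable {X : Type*} [MeasurableSpace X] {m : ℕ} {P : Measure X} {est : X → Fin m → ℂ}
  {ϑ : Fin m → ℂ}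

/-- The error of the linear combination of the estimates with coefficients `z̄`. -/
def combErr (est : X → Fin m → ℂ) (ϑ : Fin m → ℂ) (z : Fin m → ℂ) (ω : X) : ℂ :=
  ∑ i, conj (z i) * (est ω i - ϑ i)

theorem measurable_combErr (he : Measurable est) (ϑ z : Fin m → ℂ) :
    Measurable (combErr est ϑ z) :=
  Finset.measurable_fun_sum _ fun i _ =>
    (((measurable_pi_apply i).comp he).sub_const _).const_mul _

theorem dotProduct_errMatrix_mulVec [IsFiniteMeasure P] (he : ∀ i, MemLp (fun ω => est ω i) 2 P)
    (z : Fin m → ℂ) :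
    star z ⬝ᵥ (errMatrix P est ϑ *ᵥ z) = ((∫ ω, ‖combErr est ϑ z ω‖ ^ 2 ∂P : ℝ) : ℂ) := by
  have hL : ∀ i, MemLp (fun ω => est ω i - ϑ i) 2 P := fun i => (he i).sub (memLp_const _)
  have hi : ∀ i j, Integrable (fun ω => (est ω i - ϑ i) * conj (est ω j - ϑ j)) P := fun i j =>
    (hL i).integrable_mul (hL j).star
  have e : ∀ ω, ((‖combErr est ϑ z ω‖ ^ 2 : ℝ) : ℂ) =
      ∑ i, ∑ j, conj (z i) * z j * ((est ω i - ϑ i) * conj (est ω j - ϑ j)) := by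
    intro ω
    rw [Complex.ofReal_pow, ← Complex.mul_conj', combErr, map_sum, Finset.sum_mul_sum]
    refine Finset.sum_congr rfl fun i _ => Finset.sum_congr rfl fun j _ => ?_
    rw [map_mul, Complex.conj_conj]
    ring
  rw [← integral_complex_ofReal]
  simp_rw [e]
  rw [integral_finsetSum _ fun i _ => integrable_finsetSum _ fun j _ => (hi i j).const_mul _]
  simp_rw [integral_finsetSum Finset.univ (fun j _ => (hi _ j).const_mul _), integral_const_mul]
  simp only [dotProduct, Matrix.mulVec, Finset.mul_sum, errMatrix, Matrix.of_apply, Pi.star_apply,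
    RCLike.star_def]
  refine Finset.sum_congr rfl fun i _ => Finset.sum_congr rfl fun j _ => ?_
  ring

theorem isHermitian_errMatrix : (errMatrix P est ϑ).IsHermitian := by
  ext i j
  simp only [errMatrix, Matrix.conjTranspose_apply, Matrix.of_apply, RCLike.star_def]
  rw [← integral_conj]
  congr 1
  funext ω
  rw [map_mul, Complex.conj_conj, mul_comm]

theorem posSemidef_errMatrix [IsFiniteMeasure P] (he : ∀ i, MemLp (fun ω => est ω i) 2 P) :
    (errMatrix P est ϑ).PosSemidef := by
  refine Matrix.posSemidef_iff_dotProduct_mulVec.2 ⟨isHermitian_errMatrix, fun z => ?_⟩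
  rw [dotProduct_errMatrix_mulVec he]
  exact_mod_cast integral_nonneg fun ω => by positivity

/-- The Cramér–Rao inequality for the vectors `w`, given the representation of the derivatives. -/
theorem posSemidef_errMatrix_sub [IsFiniteMeasure P] {V : Type*} [NormedAddCommGroup V]
    [InnerProductSpace ℂ V] {n : ℕ} (he : ∀ i, MemLp (fun ω => est ω i) 2 P) {w : Fin n → V}
    {B : Matrix (Fin m) (Fin n) ℂ}
    (h : ∀ z : Fin m → ℂ, ∃ a : V, ‖a‖ ^ 2 ≤ ∫ ω, ‖combErr est ϑ z ω‖ ^ 2 ∂P ∧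
      ∀ k, ∑ i, conj (z i) * B i k = inner ℂ a (w k))
    (hw : IsUnit (Matrix.gram ℂ w).det) :
    (errMatrix P est ϑ - B * (Matrix.gram ℂ w)⁻¹ * Bᴴ).PosSemidef := by
  refine posSemidef_sub_mul_inv_mul (posSemidef_errMatrix he) (Matrix.posSemidef_gram ℂ w) hw
    fun z x => ?_
  obtain ⟨a, ha, hk⟩ := h z
  have e1 : star z ⬝ᵥ (B *ᵥ x) = inner ℂ a (∑ k, x k • w k) := by
    rw [inner_sum]
    simp only [inner_smul_right, ← hk, dotProduct, Matrix.mulVec, Finset.mul_sum, Pi.star_apply,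
      RCLike.star_def]
    rw [Finset.sum_comm]
    refine Finset.sum_congr rfl fun i _ => Finset.sum_congr rfl fun j _ => ?_
    ring
  have e2 : star x ⬝ᵥ (Matrix.gram ℂ w *ᵥ x) = inner ℂ (∑ k, x k • w k) (∑ k, x k • w k) := by
    rw [sum_inner]
    simp only [inner_sum, inner_smul_left, inner_smul_right, dotProduct, Matrix.mulVec,
      Finset.mul_sum, Pi.star_apply, RCLike.star_def, Matrix.gram_apply]
    refine Finset.sum_congr rfl fun i _ => Finset.sum_congr rfl fun j _ => ?_
    ring
  rw [e1, e2, dotProduct_errMatrix_mulVec he, inner_self_eq_norm_sq]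
  calc ‖inner ℂ a (∑ k, x k • w k)‖ ^ 2 ≤ (‖a‖ * ‖∑ k, x k • w k‖) ^ 2 := by
        gcongr; exact norm_inner_le_norm _ _
    _ = ‖a‖ ^ 2 * ‖∑ k, x k • w k‖ ^ 2 := by ring
    _ ≤ _ := mul_le_mul_of_nonneg_right (le_of_le_of_eq ha (Complex.ofReal_re _).symm)
        (sq_nonneg _)

end ErrorMatrix

theorem hasDerivAt_comp_line {W V : Type*} [NormedAddCommGroup W] [NormedSpace ℝ W]
    [NormedAddCommGroup V] [NormedSpace ℝ V] {Φ : W → V} {β : W}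
    {Φ' : W →L[ℝ] V} (hΦ : HasFDerivAt Φ Φ' β) (v : W) :
    HasDerivAt (fun t : ℝ => Φ (β + t • v)) (Φ' v) 0 := by
  have h1 : HasDerivAt (fun t : ℝ => β + t • v) v 0 := by
    simpa using ((hasDerivAt_id (0 : ℝ)).smul_const v).const_add β
  have h2 : HasFDerivAt Φ Φ' (β + (0 : ℝ) • v) := by simpa using hΦ
  exact h2.comp_hasDerivAt (0 : ℝ) h1

/-! ### Covariances as Gram matrices; holomorphic curves of unit vectors -/

section States

variable {H : Type*} [NormedAddCommGroup H] [InnerProductSpace ℂ H]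
  {ι : Type*} {n : ℕ}

theorem tsum_eq_inner {u v : L2 ι H} {f : ι → ℂ} (h : ∀ j, f j = inner ℂ (u j) (v j)) :
    ∑' j, f j = inner ℂ u v := by
  rw [← (lp.hasSum_inner (𝕜 := ℂ) u v).tsum_eq]
  exact tsum_congr h

/-- The component of `l` orthogonal to `φ`. -/
def orthPart (φ l : L2 ι H) : L2 ι H := l - inner ℂ φ l • φ

theorem orthPart_sum (φ : L2 ι H) (l : Fin n → L2 ι H) (c : Fin n → ℂ) :
    orthPart φ (∑ k, c k • l k) = ∑ k, c k • orthPart φ (l k) := by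
  simp only [orthPart, inner_sum, inner_smul_right, smul_sub, Finset.sum_sub_distrib,
    Finset.sum_smul, smul_smul]

theorem orthPart_smul (φ l : L2 ι H) (c : ℂ) : orthPart φ (c • l) = c • orthPart φ l := by
  simp only [orthPart, inner_smul_right, smul_sub, smul_smul]

variable [CompleteSpace H]

theorem moment_eq_inner {φ u v : L2 ι H} {a b : H →ₗ.[ℂ] H}
    (ha : ∀ j, adjApply a (φ j) = u j) (hb : ∀ j, adjApply b (φ j) = v j) :
    moment φ a b = inner ℂ u v :=
  tsum_eq_inner fun j => by rw [ha, hb]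

theorem expect_eq_inner {φ u : L2 ι H} {a : H →ₗ.[ℂ] H} (ha : ∀ j, adjApply a (φ j) = u j) :
    expect φ a = inner ℂ u φ :=
  tsum_eq_inner fun j => by rw [ha]

variable {E : Submodule ℂ H}

/-- If l = a* φ, then (a - μ)* φ = l - μ̄ φ with μ̄ = ⟨φ, l⟩: centering the operator removes from l
its component along φ. -/
theorem inner_centered (hE : Dense (E : Set H)) {φ l : L2 ι H} {a : Module.End ℂ E}
    (h : ∀ (u : E) j, inner ℂ ((a u : E) : H) (φ j) = inner ℂ (u : H) (l j)) (u : E) (j : ι) :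
    inner ℂ ((centered φ a u : E) : H) (φ j) = inner ℂ (u : H) (orthPart φ l j) := by
  have hx : expect φ (opOn a) = inner ℂ l φ :=
    expect_eq_inner fun j => adjApply_opOn_eq hE a fun u => h u j
  have e1 : ((centered φ a u : E) : H) = (a u : H) - expect φ (opOn a) • (u : H) := rfl
  have e2 : orthPart φ l j = l j - inner ℂ φ l • φ j := rfl
  rw [e1, e2, hx, inner_sub_left, inner_sub_right, h, inner_smul_left, inner_smul_right,
    inner_conj_symm]

theorem adjApply_centered (hE : Dense (E : Set H)) {φ l : L2 ι H} {a : Module.End ℂ E}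
    (h : ∀ (u : E) j, inner ℂ ((a u : E) : H) (φ j) = inner ℂ (u : H) (l j)) (j : ι) :
    adjApply (opOn (centered φ a)) (φ j) = orthPart φ l j :=
  adjApply_opOn_eq hE _ fun u => inner_centered hE h u j

theorem covMatrix_eq_gram (hE : Dense (E : Set H)) {φ : L2 ι H} {l : Fin n → L2 ι H}
    {x : Fin n → Module.End ℂ E}
    (h : ∀ k (u : E) j, inner ℂ ((x k u : E) : H) (φ j) = inner ℂ (u : H) (l k j)) :
    covMatrix φ x = Matrix.gram ℂ fun k => orthPart φ (l k) := by
  ext i k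
  exact moment_eq_inner (fun j => adjApply_centered hE (h i) j)
    (fun j => adjApply_centered hE (h k) j)

theorem gram_sum_eq {V : Type*} [NormedAddCommGroup V] [InnerProductSpace ℂ V]
    (Q : Matrix (Fin n) (Fin n) ℂ) (t : Fin n → V) :
    (Matrix.gram ℂ fun k => ∑ j, conj (Q k j) • t j) = Q * Matrix.gram ℂ t * Qᴴ := by
  ext k l
  simp only [Matrix.gram_apply, Matrix.mul_apply, sum_inner, inner_sum, inner_smul_left,
    inner_smul_right, Complex.conj_conj, Matrix.conjTranspose_apply, RCLike.star_def, Finset.sum_mul,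
    Finset.mul_sum]
  refine Finset.sum_congr rfl fun i _ => Finset.sum_congr rfl fun j _ => ?_
  ring

/-- A curve of unit vectors whose derivative in the `k`-th complex direction is complex linear up to
a phase. -/
structure HasHolomorphicDeriv (Φ : (Fin n → ℂ) → L2 ι H) (β : Fin n → ℂ)
    (w : Fin n → L2 ι H) : Prop where
  exists_deriv : ∃ Φ' : (Fin n → ℂ) →L[ℝ] L2 ι H, HasFDerivAt Φ Φ' β ∧ ∀ k, ∃ p q : ℝ,
    Φ' (Pi.single k 1) = w k + (Complex.I * p) • Φ β ∧
    Φ' (Pi.single k Complex.I) = Complex.I • w k + (Complex.I * q) • Φ β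

/-- Imaginary multiples of Φ cancel in the derivative of |Φ⟩⟨Φ|. In the Wirtinger combination the
two terms |w⟩⟨Φ| add up, while the terms |Φ⟩⟨w| cancel. -/
theorem HasHolomorphicDeriv.hasFDerivAt_crossOp {Φ : (Fin n → ℂ) → L2 ι H} {β : Fin n → ℂ}
    {w : Fin n → L2 ι H} (h : HasHolomorphicDeriv Φ β w) :
    DifferentiableAt ℝ (fun b => crossOp (Φ b) (Φ b)) β ∧
      ∀ k, wirtinger (fun b => crossOp (Φ b) (Φ b)) β k = crossOp (w k) (Φ β) := by
  obtain ⟨Φ', hΦ, hk⟩ := h.exists_deriv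
  have hB := isBoundedBilinearMap_crossOp (ι := ι) (H := H)
  have hd := (hB.hasFDerivAt (Φ β, Φ β)).comp β (hΦ.prodMk hΦ)
  have hd' : HasFDerivAt (fun b => crossOp (Φ b) (Φ b)) _ β := hd
  refine ⟨hd'.differentiableAt, fun k => ?_⟩
  obtain ⟨p, q, h1, h2⟩ := hk k
  rw [wirtinger, hd'.fderiv]
  have e : ∀ v, ((hB.deriv (Φ β, Φ β)).comp (Φ'.prod Φ')) v =
      crossOp (Φ β) (Φ' v) + crossOp (Φ' v) (Φ β) := fun v => rfl
  rw [e, e, h1, h2]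
  have add_l : ∀ u v w : L2 ι H, crossOp (u + v) w = crossOp u w + crossOp v w :=
    fun u v w => hB.add_left u v w
  have add_r : ∀ u v w : L2 ι H, crossOp u (v + w) = crossOp u v + crossOp u w :=
    fun u v w => hB.add_right u v w
  simp only [add_l, add_r, crossOp_smul_left, crossOp_smul_right, map_mul, Complex.conj_I,
    Complex.conj_ofReal, smul_add, smul_smul]
  have i1 : Complex.I * -Complex.I = 1 := by simp
  have i2 : Complex.I * (-Complex.I * q) = q := by rw [← mul_assoc, i1, one_mul]
  have i3 : Complex.I * (Complex.I * q) = -q := by rw [← mul_assoc, Complex.I_mul_I, neg_one_mul]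
  rw [i1, i2, i3, Complex.I_mul_I]
  module

/-- The holomorphic derivative of the mean of an estimate. -/
theorem HasHolomorphicDeriv.wirtinger_integral {X : Type*} [MeasurableSpace X]
    {T : Set X → L2 ι H →L[ℂ] L2 ι H} {μ : L2 ι H → Measure X} (hT : IsOutcomeFamily T μ)
    {Φ : (Fin n → ℂ) → L2 ι H} {β : Fin n → ℂ}
    {w : Fin n → L2 ι H} (h : HasHolomorphicDeriv Φ β w) {f : X → ℂ} (hf : Measurable f)
    {M : ℝ≥0} (hM : ∀ᶠ b in 𝓝 β, ∫⁻ x, ‖f x‖ₑ ^ 2 ∂(μ (Φ b)) ≤ M)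
    {ϑ : (Fin n → ℂ) → ℂ} (hϑ : DifferentiableAt ℝ ϑ β)
    (hu : ∀ᶠ b in 𝓝 β, ∫ x, f x ∂(μ (Φ b)) = ϑ b) :
    ∃ a : L2 ι H, ‖a‖ ^ 2 ≤ ∫ x, ‖f x‖ ^ 2 ∂(μ (Φ β)) ∧
      ∀ k, wirtinger ϑ β k = inner ℂ a (w k) := by
  obtain ⟨Φ', hΦ, hk⟩ := h.exists_deriv
  obtain ⟨a, b, ha, _, ha1, hb1, hder⟩ := exists_moment_vectors hT hf
    (integrable_norm_sq_of_lintegral_le hf hM.self_of_nhds).1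
  refine ⟨a, ha, fun k => ?_⟩
  have hd : ∀ v, fderiv ℝ ϑ β v = inner ℂ (Φ' v) b + inner ℂ a (Φ' v) := by
    intro v
    have hcont : Tendsto (fun t : ℝ => β + t • v) (𝓝 0) (𝓝 β) := by
      have : Continuous fun t : ℝ => β + t • v := by fun_prop
      simpa using this.tendsto 0
    have h1 := hder (fun t => Φ (β + t • v)) (Φ' v) (by simp)
      (hasDerivAt_comp_line hΦ v) ⟨M, hcont.eventually hM⟩
    have h2 := hasDerivAt_comp_line hϑ.hasFDerivAt v
    exact h2.unique (h1.congr_of_eventuallyEq ((hcont.eventually hu).mono fun t ht => ht.symm))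
  obtain ⟨p, q, h1, h2⟩ := hk k
  rw [wirtinger, hd, hd, h1, h2]
  -- Both are the mean of f, so the phase terms drop out; the Wirtinger combination then removes ⟨w,
  -- b⟩ as well.
  have hab : inner ℂ (Φ β) b = inner ℂ a (Φ β) := by rw [ha1, hb1]
  simp only [inner_add_left, inner_add_right, inner_smul_left, inner_smul_right, map_mul,
    Complex.conj_I, Complex.conj_ofReal, hab, smul_eq_mul]
  linear_combination (inner ℂ (w k) b / 2 - inner ℂ a (w k) / 2) * Complex.I_mul_I

end States

/-! ### Uniform second moments of combinations of estimates -/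

section SecondMoments

variable {X : Type*} [MeasurableSpace X] {m : ℕ} {est : X → Fin m → ℂ}

/-- The constant M' is chosen before the measure, so a local bound for the estimates passes to their
combinations. -/
theorem lintegral_combErr_le (he : Measurable est) (ϑ z : Fin m → ℂ) (M : ℝ≥0) :
    ∃ M' : ℝ≥0, ∀ P : Measure X, P Set.univ ≤ 1 → (∀ i, ∫⁻ ω, ‖est ω i‖ₑ ^ 2 ∂P ≤ M) →
      ∫⁻ ω, ‖combErr est ϑ z ω‖ₑ ^ 2 ∂P ≤ M' := by
  let Z : ℝ := ∑ i, ‖z i‖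
  let B : ℝ := ∑ i, ‖z i‖ * ‖ϑ i‖
  have hpt : ∀ ω, ‖combErr est ϑ z ω‖ ^ 2 ≤ 2 * Z ^ 2 * m * ∑ i, ‖est ω i‖ ^ 2 + 2 * B ^ 2 := by
    intro ω
    have hZ : 0 ≤ Z := Finset.sum_nonneg fun _ _ => norm_nonneg _
    have h1 : ‖combErr est ϑ z ω‖ ≤ Z * (∑ i, ‖est ω i‖) + B := by
      refine (norm_sum_le _ _).trans ?_
      rw [Finset.mul_sum, ← Finset.sum_add_distrib]
      refine Finset.sum_le_sum fun i _ => ?_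
      rw [norm_mul, RCLike.norm_conj]
      have hi : ‖z i‖ ≤ Z := Finset.single_le_sum (f := fun i => ‖z i‖)
        (fun _ _ => norm_nonneg _) (Finset.mem_univ i)
      calc ‖z i‖ * ‖est ω i - ϑ i‖ ≤ ‖z i‖ * (‖est ω i‖ + ‖ϑ i‖) := by
            gcongr; exact norm_sub_le _ _
        _ ≤ _ := by rw [mul_add]; gcongr
    have h2 : (∑ i, ‖est ω i‖) ^ 2 ≤ m * ∑ i, ‖est ω i‖ ^ 2 := by
      simpa using sq_sum_le_card_mul_sum_sq (s := Finset.univ) (f := fun i => ‖est ω i‖)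
    calc ‖combErr est ϑ z ω‖ ^ 2 ≤ (Z * (∑ i, ‖est ω i‖) + B) ^ 2 := by gcongr
      _ ≤ 2 * Z ^ 2 * (∑ i, ‖est ω i‖) ^ 2 + 2 * B ^ 2 := by
          nlinarith [sq_nonneg (Z * (∑ i, ‖est ω i‖) - B)]
      _ ≤ 2 * Z ^ 2 * (m * ∑ i, ‖est ω i‖ ^ 2) + 2 * B ^ 2 := by gcongr
      _ = _ := by ring
  have hen : ∀ w : ℂ, ‖w‖ₑ ^ 2 = ENNReal.ofReal (‖w‖ ^ 2) := fun w => by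
    rw [ENNReal.ofReal_pow (norm_nonneg _), ofReal_norm]
  refine ⟨Real.toNNReal (2 * Z ^ 2 * m) * (m * M) + Real.toNNReal (2 * B ^ 2), fun P hP hM => ?_⟩
  calc ∫⁻ ω, ‖combErr est ϑ z ω‖ₑ ^ 2 ∂P
      ≤ ∫⁻ ω, (ENNReal.ofReal (2 * Z ^ 2 * m) * ∑ i, ‖est ω i‖ₑ ^ 2)
          + ENNReal.ofReal (2 * B ^ 2) ∂P := by
        refine lintegral_mono fun ω => ?_
        simp only [hen]
        rw [← ENNReal.ofReal_sum_of_nonneg fun _ _ => by positivity,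
          ← ENNReal.ofReal_mul (by positivity), ← ENNReal.ofReal_add (by positivity) (by positivity)]
        exact ENNReal.ofReal_le_ofReal (hpt ω)
    _ = ENNReal.ofReal (2 * Z ^ 2 * m) * (∑ i, ∫⁻ ω, ‖est ω i‖ₑ ^ 2 ∂P)
          + ENNReal.ofReal (2 * B ^ 2) * P Set.univ := by
        have hm : ∀ i, Measurable fun ω => ‖est ω i‖ₑ ^ 2 := fun i =>
          ((measurable_pi_apply i).comp he).enorm.pow_const 2
        rw [lintegral_add_right _ measurable_const, lintegral_const,
          lintegral_const_mul _ (Finset.measurable_fun_sum _ fun i _ => hm i),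
          lintegral_finsetSum _ fun i _ => hm i]
    _ ≤ ENNReal.ofReal (2 * Z ^ 2 * m) * (∑ _i : Fin m, (M : ℝ≥0∞))
          + ENNReal.ofReal (2 * B ^ 2) * 1 := by
        gcongr with i
        exact hM i
    _ = _ := by
        rw [Finset.sum_const, Finset.card_univ, Fintype.card_fin, nsmul_eq_mul, mul_one]
        push_cast
        rfl

theorem memLp_of_lintegral_le (he : Measurable est) {P : Measure X} {M : ℝ≥0}
    (hM : ∀ i, ∫⁻ ω, ‖est ω i‖ₑ ^ 2 ∂P ≤ M) (i : Fin m) : MemLp (fun ω => est ω i) 2 P :=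
  (memLp_two_iff_integrable_sq_norm ((measurable_pi_apply i).comp he).aestronglyMeasurable).2
    (integrable_norm_sq_of_lintegral_le ((measurable_pi_apply i).comp he) (hM i)).1

theorem integral_combErr {P : Measure X} [IsProbabilityMeasure P]
    (he : ∀ i, MemLp (fun ω => est ω i) 2 P) (ϑ z : Fin m → ℂ) :
    ∫ ω, combErr est ϑ z ω ∂P = ∑ i, conj (z i) * (∫ ω, est ω i ∂P - ϑ i) := by
  have hi : ∀ i, Integrable (fun ω => est ω i) P := fun i => (he i).integrable (by norm_num)
  have hij : ∀ i, Integrable (fun ω => conj (z i) * (est ω i - ϑ i)) P := fun i =>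
    ((hi i).sub (integrable_const _)).const_mul _
  simp only [combErr]
  rw [integral_finsetSum _ fun i _ => hij i]
  refine Finset.sum_congr rfl fun i _ => ?_
  rw [integral_const_mul, integral_sub (hi i) (integrable_const _), integral_const]
  simp

end SecondMoments

theorem IsOutcomeFamily.isProbabilityMeasure {X : Type*} [MeasurableSpace X] {V : Type*}
    [NormedAddCommGroup V] [InnerProductSpace ℂ V] {T : Set X → V →L[ℂ] V} {μ : V → Measure X}
    (hT : IsOutcomeFamily T μ) {u : V} (hu : ‖u‖ = 1) : IsProbabilityMeasure (μ u) := by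
  constructor
  rw [hT.apply u _ MeasurableSet.univ, hT.univ]
  simp [hu]

/-! ### The right Cramér–Rao inequality -/

section CramerRao

variable {H : Type*} [NormedAddCommGroup H] [InnerProductSpace ℂ H] [CompleteSpace H]
  {ι : Type*} {n m : ℕ} {X : Type*} [MeasurableSpace X]

theorem wirtinger_sum {ϑ : (Fin n → ℂ) → Fin m → ℂ} {β : Fin n → ℂ} (hϑ : DifferentiableAt ℝ ϑ β)
    (z c : Fin m → ℂ) (k : Fin n) :
    wirtinger (fun b => ∑ i, conj (z i) * (ϑ b i - c i)) β k =
      ∑ i, conj (z i) * wirtinger (fun b => ϑ b i) β k := by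
  have hi : ∀ i, DifferentiableAt ℝ (fun b => ϑ b i) β := differentiableAt_pi.1 hϑ
  have h : HasFDerivAt (fun b => ∑ i, conj (z i) * (ϑ b i - c i))
      (∑ i, conj (z i) • fderiv ℝ (fun b => ϑ b i) β) β :=
    HasFDerivAt.fun_sum fun i _ => ((hi i).hasFDerivAt.sub_const (c i)).const_mul (conj (z i))
  rw [wirtinger, h.fderiv]
  simp only [FunLike.coe_sum, Finset.sum_apply, _root_.smul_apply, smul_eq_mul, wirtinger,
    Finset.mul_sum]
  rw [← Finset.sum_sub_distrib, Finset.mul_sum]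
  refine Finset.sum_congr rfl fun i _ => ?_
  ring

/-- The right Cramér–Rao inequality. -/
theorem HasHolomorphicDeriv.posSemidef_errMatrix_sub
    {T : Set X → L2 ι H →L[ℂ] L2 ι H} {μ : L2 ι H → Measure X} (hT : IsOutcomeFamily T μ)
    {Φ : (Fin n → ℂ) → L2 ι H} {β : Fin n → ℂ} {w : Fin n → L2 ι H}
    (h : HasHolomorphicDeriv Φ β w) (h1 : ∀ᶠ b in 𝓝 β, ‖Φ b‖ = 1)
    {est : X → Fin m → ℂ} (he : Measurable est) {ϑ : (Fin n → ℂ) → Fin m → ℂ}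
    (hϑ : DifferentiableAt ℝ ϑ β)
    {M : ℝ≥0} (hM : ∀ᶠ b in 𝓝 β, ∀ i, ∫⁻ ω, ‖est ω i‖ₑ ^ 2 ∂(μ (Φ b)) ≤ M)
    (hu : ∀ᶠ b in 𝓝 β, ∀ i, ∫ ω, est ω i ∂(μ (Φ b)) = ϑ b i)
    (hw : IsUnit (Matrix.gram ℂ w).det) :
    (errMatrix (μ (Φ β)) est (ϑ β)
      - Matrix.of (fun i k => wirtinger (fun b => ϑ b i) β k) * (Matrix.gram ℂ w)⁻¹ *
        (Matrix.of fun i k => wirtinger (fun b => ϑ b i) β k)ᴴ).PosSemidef := by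
  have := hT.isFiniteMeasure (Φ β)
  refine LieBound.posSemidef_errMatrix_sub (memLp_of_lintegral_le he hM.self_of_nhds)
    (fun z => ?_) hw
  obtain ⟨M', hM'⟩ := lintegral_combErr_le he (ϑ β) z M
  have hd : DifferentiableAt ℝ (fun b => ∑ i, conj (z i) * (ϑ b i - ϑ β i)) β :=
    DifferentiableAt.fun_sum fun i _ =>
      ((differentiableAt_pi.1 hϑ i).sub_const _).const_mul _
  obtain ⟨a, ha, hk⟩ := h.wirtinger_integral hT (measurable_combErr he (ϑ β) z) (M := M')
    (by
      filter_upwards [hM, h1] with b hb hb1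
      have := hT.isProbabilityMeasure hb1
      exact hM' _ prob_le_one hb) hd
    (by
      filter_upwards [hM, h1, hu] with b hb hb1 hbu
      have := hT.isProbabilityMeasure hb1
      rw [integral_combErr (memLp_of_lintegral_le he hb)]
      simp_rw [hbu])
  refine ⟨a, ha, fun k => ?_⟩
  rw [← hk k, wirtinger_sum hϑ]
  rfl

end CramerRao

/-! ### Uniqueness of right logarithmic derivatives; normalisation -/

section LogDerivatives

variable {H : Type*} [NormedAddCommGroup H] [InnerProductSpace ℂ H] [CompleteSpace H]
  {ι : Type*} {n : ℕ} {E : Submodule ℂ H}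

theorem inner_crossOp_right (a b : L2 ι H) (u v : H) :
    inner ℂ u (crossOp a b v) = inner ℂ (crossOp b a u) v := by
  have h1 := (hasSum_crossOp_apply a b v).mapL (innerSL ℂ u)
  have h2 := ((hasSum_crossOp_apply b a u).mapL (innerSL ℂ v)).star
  have e : star (innerSL ℂ v (crossOp b a u)) = inner ℂ (crossOp b a u) v := by
    simp
  rw [← e]
  refine h1.unique (h2.congr_fun fun j => ?_)
  simp only [innerSL_apply_apply, inner_smul_right, RCLike.star_def, map_mul, inner_conj_symm]
  ring

theorem inner_crossOp_of_adjoint {φ w : L2 ι H} {u u' : H}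
    (h : ∀ j, inner ℂ u' (φ j) = inner ℂ u (w j)) (b : L2 ι H) (v : H) :
    inner ℂ u' (crossOp φ b v) = inner ℂ u (crossOp w b v) := by
  refine ((hasSum_crossOp_apply φ b v).mapL (innerSL ℂ u')).unique
    (((hasSum_crossOp_apply w b v).mapL (innerSL ℂ u)).congr_fun fun j => ?_)
  simp [h]

/-- A densely defined `h` with `h* ρ` equal to `∑ⱼ |wⱼ⟩⟨φⱼ|` satisfies `h* φⱼ = wⱼ`, provided
this holds for one densely defined operator. -/
theorem adjApply_eq_of_adjoint_crossOp (hE : Dense (E : Set H)) {φ w : L2 ι H}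
    {a : Module.End ℂ E}
    (ha : ∀ (u : E) j, inner ℂ ((a u : E) : H) (φ j) = inner ℂ (u : H) (w j))
    {h : H →ₗ.[ℂ] H} (hd : Dense (h.domain : Set H))
    (hh : ∀ v, ∃ hv : crossOp φ φ v ∈ h.adjoint.domain, h.adjoint ⟨_, hv⟩ = crossOp w φ v)
    (j : ι) : adjApply h (φ j) = w j := by
  refine adjApply_eq hd fun u => ?_
  have hv : ∀ v, inner ℂ (h u) (crossOp φ φ v) = inner ℂ (u : H) (crossOp w φ v) := by
    intro v
    obtain ⟨hv, e⟩ := hh v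
    rw [← e, ← inner_conj_symm, ← LinearPMap.adjoint_isFormalAdjoint hd ⟨_, hv⟩ u,
      inner_conj_symm]
  have h1 : crossOp φ φ (h u) - crossOp φ w u = 0 := by
    refine ext_inner_right ℂ fun v => ?_
    rw [inner_sub_left, ← inner_crossOp_right, ← inner_crossOp_right, hv, sub_self, inner_zero_left]
  -- The known operator a converts φ into w: pairing with e ∈ E reduces this to the previous
  -- identity paired with a e.
  have h2 : crossOp w φ (h u) - crossOp w w u = 0 := by
    refine hE.eq_zero_of_inner_right ℂ fun e he => ?_
    rw [inner_sub_right, ← inner_crossOp_of_adjoint (ha ⟨e, he⟩),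
      ← inner_crossOp_of_adjoint (ha ⟨e, he⟩), ← inner_sub_right, h1, inner_zero_right]
  -- The sum of squares expands into the previous two identities, paired with h u and u
  -- respectively, so each component must vanish.
  have h3 : HasSum (fun j => ‖(inner ℂ (h u) (φ j) - inner ℂ (u : H) (w j) : ℂ)‖ ^ 2) 0 := by
    have s1 := ((hasSum_crossOp_apply φ φ (h u)).sub (hasSum_crossOp_apply φ w (u : H))).mapL
      (innerSL ℂ (h u))
    have s2 := ((hasSum_crossOp_apply w φ (h u)).sub (hasSum_crossOp_apply w w (u : H))).mapL
      (innerSL ℂ (u : H))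
    have s3 := Complex.hasSum_re (s1.sub s2)
    rw [h1, h2, map_zero, map_zero, sub_zero, Complex.zero_re] at s3
    refine s3.congr_fun fun j => ?_
    simp only [innerSL_apply_apply, inner_sub_right, inner_smul_right]
    rw [← inner_conj_symm (φ j), ← inner_conj_symm (w j), ← Complex.ofReal_re (‖_‖ ^ 2),
      Complex.ofReal_pow, ← Complex.mul_conj', map_sub]
    congr 1
    ring
  have h4 := (hasSum_zero_iff_of_nonneg fun j => by positivity).1 h3
  have := congrFun h4 j
  simpa [sub_eq_zero] using this

theorem wirtinger_congr {F : Type*} [NormedAddCommGroup F] [NormedSpace ℂ F]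
    {f g : (Fin n → ℂ) → F} {β : Fin n → ℂ} (h : f =ᶠ[𝓝 β] g) (k : Fin n) :
    wirtinger f β k = wirtinger g β k := by
  rw [wirtinger, wirtinger, h.fderiv_eq]

omit [CompleteSpace H] in
/-- The normalisation of a holomorphic family of vectors. -/
theorem hasHolomorphicDeriv_normalize {F : (Fin n → ℂ) → L2 ι H} {β : Fin n → ℂ}
    {L : (Fin n → ℂ) →L[ℂ] L2 ι H} (hF : HasFDerivAt F L β) (h0 : F β ≠ 0) :
    HasHolomorphicDeriv (fun b => ((‖F b‖⁻¹ : ℝ) : ℂ) • F b) β fun k =>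
      orthPart (((‖F β‖⁻¹ : ℝ) : ℂ) • F β) (((‖F β‖⁻¹ : ℝ) : ℂ) • L (Pi.single k 1)) := by
  have hFr : HasFDerivAt F (L.restrictScalars ℝ) β := hF.restrictScalars ℝ
  have hc : DifferentiableAt ℝ (fun b => ‖F b‖⁻¹) β :=
    (hFr.differentiableAt.norm ℂ h0).inv (norm_ne_zero_iff.2 h0)
  have hΦ := hc.hasFDerivAt.smul hFr
  set Φ : (Fin n → ℂ) → L2 ι H := fun b => ((‖F b‖⁻¹ : ℝ) : ℂ) • F b with hΦdef
  set Φ' := ‖F β‖⁻¹ • L.restrictScalars ℝ + (fderiv ℝ (fun b => ‖F b‖⁻¹) β).smulRight (F β)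
    with hΦ'
  have hΦ2 : HasFDerivAt Φ Φ' β := by
    refine hΦ.congr_of_eventuallyEq (Eventually.of_forall fun b => ?_)
    simp only [Φ, Complex.coe_smul]
    rfl
  have hne : ∀ᶠ b in 𝓝 β, F b ≠ 0 := hF.continuousAt.eventually_ne h0
  have hunit : ∀ b, F b ≠ 0 → inner ℂ (Φ b) (Φ b) = 1 := fun b hb => by
    rw [inner_self_eq_norm_sq_to_K, norm_smul, Complex.norm_real, norm_inv, norm_norm,
      inv_mul_cancel₀ (norm_ne_zero_iff.2 hb)]
    simp
  -- Differentiate ⟨Φ, Φ⟩ = 1.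
  have hre : ∀ v, (inner ℂ (Φ β) (Φ' v)).re = 0 := by
    intro v
    have d1 := (hΦ2.inner ℂ hΦ2)
    have d2 : HasFDerivAt (fun b => inner ℂ (Φ b) (Φ b)) (0 : (Fin n → ℂ) →L[ℝ] ℂ) β :=
      (hasFDerivAt_const (1 : ℂ) β).congr_of_eventuallyEq (hne.mono hunit)
    have e : inner ℂ (Φ β) (Φ' v) + inner ℂ (Φ' v) (Φ β) = 0 := by
      simpa [fderivInnerCLM_apply] using! congrArg (fun f : (Fin n → ℂ) →L[ℝ] ℂ => f v) (d1.unique d2)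
    have e2 := congrArg Complex.re e
    rw [Complex.add_re, ← inner_conj_symm (Φ' v), Complex.conj_re, Complex.zero_re] at e2
    linarith
  -- Differentiating the real factor ‖F‖⁻¹ adds only a real multiple of Φ, and this multiple cancels
  -- the real part of the component along Φ, leaving an imaginary one.
  have hdec : ∀ v, ∃ q : ℝ, Φ' v = orthPart (Φ β) (((‖F β‖⁻¹ : ℝ) : ℂ) • L v)
      + (Complex.I * q) • Φ β := by
    intro v
    obtain ⟨α, hα⟩ : ∃ α : ℝ, Φ' v = ((‖F β‖⁻¹ : ℝ) : ℂ) • L v + (α : ℂ) • Φ β := by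
      refine ⟨fderiv ℝ (fun b => ‖F b‖⁻¹) β v * ‖F β‖, ?_⟩
      simp only [Φ, smul_smul]
      rw [← Complex.ofReal_mul, mul_assoc, mul_inv_cancel₀ (norm_ne_zero_iff.2 h0), mul_one,
        Complex.coe_smul, Complex.coe_smul]
      rfl
    have h1 := hre v
    rw [hα, inner_add_right, inner_smul_right _ _ (α : ℂ), hunit β h0, mul_one, Complex.add_re,
      Complex.ofReal_re] at h1
    set l := ((‖F β‖⁻¹ : ℝ) : ℂ) • L v
    refine ⟨(inner ℂ (Φ β) l).im, ?_⟩
    rw [hα, orthPart]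
    have e : (α : ℂ) + inner ℂ (Φ β) l = Complex.I * ((inner ℂ (Φ β) l).im : ℝ) := by
      apply Complex.ext
      · simp; linarith
      · simp
    rw [← e]
    module
  refine ⟨Φ', hΦ2, fun k => ?_⟩
  obtain ⟨p, hp⟩ := hdec (Pi.single k 1)
  obtain ⟨q, hq⟩ := hdec (Pi.single k Complex.I)
  refine ⟨p, q, hp, ?_⟩
  rw [hq]
  have e : (Pi.single k Complex.I : Fin n → ℂ) = Complex.I • Pi.single k 1 := by
    rw [← Pi.single_smul]; simp
  rw [e, map_smul, smul_comm _ Complex.I, orthPart_smul]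

end LogDerivatives

/-! ### The normalised canonical family -/

section CanonicalFamily

variable {H : Type*} [NormedAddCommGroup H] [InnerProductSpace ℂ H] [CompleteSpace H]
  {ι : Type*} {n : ℕ} {E D : Submodule ℂ H} {y : Fin n → Module.End ℂ D}
  {x : Fin n → Module.End ℂ E} {C : Fin n → Fin n → Fin n → ℂ} {ψ : ι → D} {r : ℝ}

/-- The normalised family `χ^{-1/2} exp (βᵏ y_k) ψ` in the Hilbert sum. -/
def canonL2 (h : JointlyAnalytic y ψ r) (b : Fin n → ℂ) : L2 ι H :=
  ((‖expFamily h b‖⁻¹ : ℝ) : ℂ) • expFamily h b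

/-- The normalised family `χ^{-1/2} y_k exp (βᵏ y_k) ψ` in the Hilbert sum. -/
def genCanonL2 (h : JointlyAnalytic y ψ r) (k : Fin n) (b : Fin n → ℂ) : L2 ι H :=
  ((‖expFamily h b‖⁻¹ : ℝ) : ℂ) • genExpFamily h k b

theorem canonVec_eq (h : JointlyAnalytic y ψ r) {b : Fin n → ℂ} (hb : ‖b‖ < r) :
    canonVec y ψ b = canonL2 h b := by
  have hg : genFun y ψ b = ‖expFamily h b‖ ^ 2 := by
    rw [genFun, ← (L2.hasSum_norm_sq (expFamily h b)).tsum_eq]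
    exact tsum_congr fun j => by rw [expFamily_apply h hb]
  funext j
  rw [canonVec, hg, Real.sqrt_sq (norm_nonneg _), ← expFamily_apply h hb]
  rfl

variable (hE : Dense (E : Set H))
  (hxy : ∀ (k : Fin n) (u : E) (v : D),
      inner ℂ ((x k u : E) : H) (v : H) = inner ℂ (u : H) ((y k v : D) : H))
include hxy

theorem inner_canonL2 (h : JointlyAnalytic y ψ r) {b : Fin n → ℂ} (hb : ‖b‖ < r) (k : Fin n)
    (u : E) (j : ι) :
    inner ℂ ((x k u : E) : H) (canonL2 h b j) = inner ℂ (u : H) (genCanonL2 h k b j) := by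
  have := inner_expFamily hxy h hb k u j
  simp only [canonL2, genCanonL2, lp.coeFn_smul, Pi.smul_apply, inner_smul_right, this]

include hE

theorem norm_canonL2 (hψ : HasSum (fun j => ‖(ψ j : H)‖ ^ 2) 1) (h : JointlyAnalytic y ψ r)
    {b : Fin n → ℂ} (hb : ‖b‖ < r) : ‖canonL2 h b‖ = 1 := by
  rw [canonL2, norm_smul, Complex.norm_real, norm_inv, norm_norm,
    inv_mul_cancel₀ (norm_ne_zero_iff.2 (expFamily_ne_zero hE hxy hψ h hb))]

theorem hasHolomorphicDeriv_canonL2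
    (hC : ∀ i k, x i * x k - x k * x i = ∑ j, C i k j • x j)
    (hψ : HasSum (fun j => ‖(ψ j : H)‖ ^ 2) 1) (h : JointlyAnalytic y ψ r)
    {β : Fin n → ℂ} (hβ : ‖β‖ < r) :
    HasHolomorphicDeriv (canonL2 h) β fun k =>
      ∑ j, conj (expQuot (adMatrix C (star β)) k j) • orthPart (canonL2 h β) (genCanonL2 h j β) := by
  obtain ⟨L, hL, hk⟩ := exists_hasFDerivAt_expFamily (adjoint_comm hE hC hxy) h hβ
  have := hasHolomorphicDeriv_normalize hL (expFamily_ne_zero hE hxy hψ h hβ)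
  have e : (fun k => ∑ j, conj (expQuot (adMatrix C (star β)) k j) •
      orthPart (canonL2 h β) (genCanonL2 h j β)) = fun k =>
      orthPart (((‖expFamily h β‖⁻¹ : ℝ) : ℂ) • expFamily h β)
        (((‖expFamily h β‖⁻¹ : ℝ) : ℂ) • L (Pi.single k 1)) := by
    funext k
    rw [hk, Finset.smul_sum]
    simp_rw [smul_comm _ (conj _)]
    exact (orthPart_sum _ _ _).symm
  rw [e]
  exact this

end CanonicalFamily

/-! ### Fisher information and the bound for general generators -/

section CanonicalBounds

variable {H : Type*} [NormedAddCommGroup H] [InnerProductSpace ℂ H] [CompleteSpace H]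
  {ι : Type*} {n : ℕ} {E D : Submodule ℂ H} (hE : Dense (E : Set H))
  {x : Fin n → Module.End ℂ E} {C : Fin n → Fin n → Fin n → ℂ}
  (hC : ∀ i k, x i * x k - x k * x i = ∑ j, C i k j • x j) {y : Fin n → Module.End ℂ D}
  (hxy : ∀ (k : Fin n) (u : E) (v : D),
      inner ℂ ((x k u : E) : H) (v : H) = inner ℂ (u : H) ((y k v : D) : H))
  {ψ : ι → D} (hψ : HasSum (fun j => ‖(ψ j : H)‖ ^ 2) 1) {r : ℝ} (h : JointlyAnalytic y ψ r)
  {β : Fin n → ℂ} (hβ : ‖β‖ < r)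

theorem eventually_norm_lt (hβ : ‖β‖ < r) : ∀ᶠ b in 𝓝 β, ‖b‖ < r :=
  continuous_norm.continuousAt.eventually_lt continuousAt_const hβ

include hβ h in
theorem canonState_eventuallyEq :
    canonState y ψ =ᶠ[𝓝 β] fun b => crossOp (canonL2 h b) (canonL2 h b) := by
  filter_upwards [eventually_norm_lt hβ] with b hb
  rw [canonState, canonVec_eq h hb, mixture_eq_crossOp]

include hE hxy h hβ in
theorem covMatrix_canonVec : covMatrix (canonVec y ψ β) x =
    Matrix.gram ℂ fun k => orthPart (canonL2 h β) (genCanonL2 h k β) := by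
  rw [canonVec_eq h hβ]
  exact covMatrix_eq_gram hE fun k u j => inner_canonL2 hxy h hβ k u j

include hxy hβ in
theorem inner_sum_canonL2 (Q : Matrix (Fin n) (Fin n) ℂ) (k : Fin n) (u : E) (j : ι) :
    inner ℂ ((((∑ i, Q k i • x i) u : E) : H)) (canonL2 h β j) =
      inner ℂ (u : H) ((∑ i, conj (Q k i) • genCanonL2 h i β : L2 ι H) j) := by
  simp only [LinearMap.sum_apply, LinearMap.smul_apply, Submodule.coe_sum, Submodule.coe_smul,
    sum_inner, inner_smul_left, inner_canonL2 hxy h hβ, lp.coeFn_sum, Finset.sum_apply,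
    lp.coeFn_smul, Pi.smul_apply, inner_sum, inner_smul_right]

include hE hxy h hβ in
theorem inner_centered_canonL2 (Q : Matrix (Fin n) (Fin n) ℂ) (k : Fin n) (u : E) (j : ι) :
    inner ℂ ((centered (canonL2 h β) (∑ i, Q k i • x i) u : E) : H) (canonL2 h β j) =
      inner ℂ (u : H)
        ((∑ i, conj (Q k i) • orthPart (canonL2 h β) (genCanonL2 h i β) : L2 ι H) j) := by
  rw [← orthPart_sum]
  exact inner_centered hE (fun u j => inner_sum_canonL2 hxy h hβ Q k u j) u j

include hE hC hxy hψ h hβ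

theorem isRightLogDeriv_canonState :
    IsRightLogDeriv (canonState y ψ) β fun k => opOn (centered (canonVec y ψ β)
      (∑ j, expQuot (adMatrix C (star β)) k j • x j)) := by
  have hev := canonState_eventuallyEq h hβ
  obtain ⟨hd, hw⟩ := (hasHolomorphicDeriv_canonL2 hE hxy hC hψ h hβ).hasFDerivAt_crossOp
  refine ⟨hd.congr_of_eventuallyEq hev, fun k => ⟨hE, fun v => ?_⟩⟩
  rw [wirtinger_congr hev, hw, hev.eq_of_nhds, canonVec_eq h hβ]
  exact exists_mem_opOn_adjoint_domain hE _ fun u =>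
    inner_crossOp_of_adjoint (fun j => inner_centered_canonL2 hE hxy h hβ _ k u j) _ v

/-- By uniqueness f_k* φⱼ = (w_k)ⱼ for every choice of f, so the Fisher information is the Gram
matrix of w. -/
theorem rightFisher_eq {f : Fin n → H →ₗ.[ℂ] H} (hf : IsRightLogDeriv (canonState y ψ) β f) :
    rightFisher (canonVec y ψ β) f = expQuot (adMatrix C (star β)) *
      covMatrix (canonVec y ψ β) x * (expQuot (adMatrix C (star β)))ᴴ := by
  have hev := canonState_eventuallyEq h hβ
  obtain ⟨hd, hw⟩ := (hasHolomorphicDeriv_canonL2 hE hxy hC hψ h hβ).hasFDerivAt_crossOp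
  rw [covMatrix_canonVec hE hxy h hβ, ← gram_sum_eq, canonVec_eq h hβ]
  have key : ∀ k j, adjApply (f k) (canonL2 h β j) =
      (∑ i, conj (expQuot (adMatrix C (star β)) k i) •
        orthPart (canonL2 h β) (genCanonL2 h i β) : L2 ι H) j := fun k j =>
    adjApply_eq_of_adjoint_crossOp hE
      (fun u j => inner_centered_canonL2 hE hxy h hβ (expQuot (adMatrix C (star β))) k u j)
      (hf.2 k).1
      (fun v => by
        have := (hf.2 k).2 v
        rwa [wirtinger_congr hev, hw, hev.eq_of_nhds] at this) j
  ext k l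
  exact moment_eq_inner (key k) (key l)

/-- The Gram matrix in the Cramér–Rao inequality is Q S Q†, whose inverse is K† S⁻¹ K. -/
theorem posSemidef_errMatrix_sub_canonVec {m : ℕ} {X : Type*} [MeasurableSpace X]
    (P : QPM X H) {est : X → Fin m → ℂ} (he : Measurable est)
    {ϑ : (Fin n → ℂ) → Fin m → ℂ} (hϑ : DifferentiableAt ℝ ϑ β)
    (hM : ∃ M : ℝ≥0, ∀ᶠ b in 𝓝 β, ∀ i, ∫⁻ ω, ‖est ω i‖ₑ ^ 2 ∂(P.law (canonVec y ψ b)) ≤ M)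
    (hu : ∀ᶠ b in 𝓝 β, ∀ i, ∫ ω, est ω i ∂(P.law (canonVec y ψ b)) = ϑ b i)
    (hQ : IsUnit (expQuot (adMatrix C (star β))).det)
    (hS : IsUnit (covMatrix (canonVec y ψ β) x).det) :
    (errMatrix (P.law (canonVec y ψ β)) est (ϑ β)
      - Matrix.of (fun i k => wirtinger (fun b => ϑ b i) β k) *
        (kMatrix (adMatrix C (star β)))ᴴ * (covMatrix (canonVec y ψ β) x)⁻¹ *
        kMatrix (adMatrix C (star β)) *
        (Matrix.of fun i k => wirtinger (fun b => ϑ b i) β k)ᴴ).PosSemidef := by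
  obtain ⟨M, hM⟩ := hM
  have hlt := eventually_norm_lt hβ
  have hg := gram_sum_eq (expQuot (adMatrix C (star β)))
    fun k => orthPart (canonL2 h β) (genCanonL2 h k β)
  rw [← covMatrix_canonVec hE hxy h hβ] at hg
  have := (hasHolomorphicDeriv_canonL2 hE hxy hC hψ h hβ).posSemidef_errMatrix_sub
    (P.isOutcomeFamily ι) (M := M) (hlt.mono fun b hb => norm_canonL2 hE hxy hψ h hb) he hϑ
    (by filter_upwards [hlt, hM] with b hb hMb; rwa [canonVec_eq h hb] at hMb)
    (by filter_upwards [hlt, hu] with b hb hub; rwa [canonVec_eq h hb] at hub)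
    (by
      rw [hg, Matrix.det_mul, Matrix.det_mul, Matrix.det_conjTranspose]
      exact (hQ.mul hS).mul hQ.star)
  rw [hg, Matrix.mul_inv_rev, Matrix.mul_inv_rev, ← Matrix.conjTranspose_nonsing_inv,
    ← canonVec_eq h hβ] at this
  simpa only [kMatrix, Matrix.mul_assoc] using this

end CanonicalBounds

theorem eventually_isUnit_det_expQuot_adMatrix {n : ℕ} (C : Fin n → Fin n → Fin n → ℂ) :
    ∀ᶠ b : Fin n → ℂ in 𝓝 0, IsUnit (expQuot (adMatrix C (star b))).det := by
  refine eventually_isUnit_det_expQuot (Continuous.continuousAt ?_) (by simp [adMatrix])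
  exact continuous_finsetSum _ fun k _ =>
    (((continuous_apply k).comp continuous_star).smul continuous_const)

/-! ### The identity Q(-A) e^A = Q(A) for Q(A) = (e^A - 1)/A -/

section MatrixExponential

variable {n : ℕ}

-- Coefficients of ((1 - e^{-x})/x) eˣ = (eˣ - 1)/x; they come from the vanishing alternating
-- binomial sum with its first term split off.
open Finset in
theorem sum_antidiagonal_alternating (m : ℕ) :
    ∑ p ∈ HasAntidiagonal.antidiagonal m,
      (((p.1 + 1).factorial : ℂ))⁻¹ * (-1) ^ p.1 * ((p.2.factorial : ℂ))⁻¹ =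
      (((m + 1).factorial : ℂ))⁻¹ := by
  have h1 : ∀ p ∈ HasAntidiagonal.antidiagonal m,
      (((p.1 + 1).factorial : ℂ))⁻¹ * (-1) ^ p.1 * ((p.2.factorial : ℂ))⁻¹ =
      (((m + 1).factorial : ℂ))⁻¹ * ((-1) ^ p.1 * ((m + 1).choose (p.1 + 1) : ℂ)) := fun p hp => by
    have := factorial_inv_mul_choose_succ p (HasAntidiagonal.mem_antidiagonal.1 hp)
    linear_combination -(-1) ^ p.1 * this
  rw [Finset.sum_congr rfl h1, ← Finset.mul_sum]
  have h2 := Finset.Nat.sum_antidiagonal_eq_sum_range_succ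
    (fun a _ => (-1 : ℂ) ^ a * ((m + 1).choose (a + 1) : ℂ)) m
  have h3 : ∑ k ∈ range (m + 2), (-1 : ℂ) ^ k * ((m + 1).choose k : ℂ) = 0 := by
    exact_mod_cast congrArg (Int.cast : ℤ → ℂ)
      (Int.alternating_sum_range_choose_of_ne (n := m + 1) (by omega))
  rw [Finset.sum_range_succ'] at h3
  have h4 : ∑ k ∈ range (m + 1), (-1 : ℂ) ^ k * ((m + 1).choose (k + 1) : ℂ) = 1 := by
    have : ∑ k ∈ range (m + 1), (-1 : ℂ) ^ (k + 1) * ((m + 1).choose (k + 1) : ℂ) =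
        -∑ k ∈ range (m + 1), (-1 : ℂ) ^ k * ((m + 1).choose (k + 1) : ℂ) := by
      rw [← Finset.sum_neg_distrib]
      exact Finset.sum_congr rfl fun k _ => by ring
    rw [this] at h3
    simp only [pow_zero, Nat.choose_zero_right, Nat.cast_one, mul_one] at h3
    linear_combination -h3
  rw [h2, h4, mul_one]

theorem expQuot_neg_mul_exp (A : Matrix (Fin n) (Fin n) ℂ) :
    expQuot (-A) * NormedSpace.exp A = expQuot A := by
  ext k j
  rw [Matrix.mul_apply]
  have h : ∀ i, HasSum (fun m => ∑ p ∈ Finset.HasAntidiagonal.antidiagonal m,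
      ((((p.1 + 1).factorial : ℂ))⁻¹ * ((-A) ^ p.1) k i) *
        (((p.2.factorial : ℂ))⁻¹ * (A ^ p.2) i j))
      (expQuot (-A) k i * NormedSpace.exp A i j) := fun i => by
    have := hasSum_antidiagonal_bilinear (isBoundedBilinearMap_smul_complex ℂ)
      (f := fun l => (((l + 1).factorial : ℂ))⁻¹ * ((-A) ^ l) k i)
      (g := fun l => ((l.factorial : ℂ))⁻¹ * (A ^ l) i j)
      (summable_norm_expQuot_entry (-A) k i) (summable_norm_exp_entry A i j)
    simp only [smul_eq_mul, ← expQuot_apply, ← exp_apply] at this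
    exact this
  refine (hasSum_sum fun i (_ : i ∈ Finset.univ) => h i).unique ?_
  have h2 := Pi.hasSum.1 (Pi.hasSum.1 (hasSum_expQuot A) k) j
  refine h2.congr_fun fun m => ?_
  rw [Finset.sum_comm, Matrix.smul_apply, smul_eq_mul, ← sum_antidiagonal_alternating,
    Finset.sum_mul]
  refine Finset.sum_congr rfl fun p hp => ?_
  rw [← Finset.HasAntidiagonal.mem_antidiagonal.1 hp, pow_add, Matrix.mul_apply, Finset.mul_sum]
  refine Finset.sum_congr rfl fun i _ => ?_
  have : ((-A) ^ p.1) k i = (-1) ^ p.1 * (A ^ p.1) k i := by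
    rw [← neg_one_smul ℂ A, smul_pow, Matrix.smul_apply, smul_eq_mul]
  rw [this]
  ring

end MatrixExponential

/-! ### Symmetric generators at imaginary parameters -/

section HermitianGenerators

variable {H : Type*} [NormedAddCommGroup H] [InnerProductSpace ℂ H] {n : ℕ} {E : Submodule ℂ H}
  {C : Fin n → Fin n → Fin n → ℂ} {s : Fin n → Module.End ℂ E}

/-- Real-linearly independent symmetric generators have imaginary structure constants. -/
theorem conj_structureConst (hE : Dense (E : Set H))
    (hC : ∀ i k, s i * s k - s k * s i = ∑ j, C i k j • s j)
    (hs : ∀ (k : Fin n) (u v : E),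
      inner ℂ ((s k u : E) : H) (v : H) = inner ℂ (u : H) ((s k v : E) : H))
    (hind : ∀ a : Fin n → ℝ, ∑ k, (a k : ℂ) • s k = 0 → a = 0) (i k j : Fin n) :
    conj (C i k j) = -C i k j := by
  have h1 := adjoint_comm hE hC hs k i
  have h2 := congrArg Neg.neg (hC i k)
  -- A commutation relation added to its adjoint gives ∑ⱼ 2 Re(C) sⱼ = 0, a real linear relation.
  have h3 := hind (fun j => 2 * (C i k j).re) (by
    have : ∀ j, ((2 * (C i k j).re : ℝ) : ℂ) = conj (C i k j) + C i k j := fun j => by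
      apply Complex.ext <;> simp [two_mul]
    simp_rw [this, add_smul, Finset.sum_add_distrib, ← h1, ← hC i k]
    abel)
  have h4 := congrFun h3 j
  simp only [Pi.zero_apply, mul_eq_zero, OfNat.ofNat_ne_zero, false_or] at h4
  apply Complex.ext <;> simp [h4]

theorem adMatrix_map_conj {θ : Fin n → ℝ} (hbar : ℝ) (hC : ∀ i k j, conj (C i k j) = -C i k j) :
    (adMatrix C fun k => Complex.I * θ k / hbar).map conj =
      adMatrix C fun k => Complex.I * θ k / hbar := by
  ext i j
  simp only [adMatrix, Matrix.map_apply, Matrix.sum_apply, Matrix.smul_apply, Matrix.of_apply,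
    smul_eq_mul, map_sum, map_mul, map_div₀, Complex.conj_I, Complex.conj_ofReal, hC]
  exact Finset.sum_congr rfl fun k _ => by ring

theorem kMatrix_conjTranspose {A : Matrix (Fin n) (Fin n) ℂ} (hA : A.map conj = A) :
    (kMatrix A)ᴴ = (kMatrix A)ᵀ := by
  have h := expQuot_map_conj A
  rw [hA] at h
  have h' : (expQuot A)ᴴ = (expQuot A)ᵀ := by
    conv_rhs => rw [h]
    rfl
  rw [kMatrix, Matrix.conjTranspose_nonsing_inv, h', Matrix.transpose_nonsing_inv]

theorem star_imaginary (θ : Fin n → ℝ) (hbar : ℝ) :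
    (star fun k => Complex.I * θ k / hbar : Fin n → ℂ) = -fun k => Complex.I * θ k / hbar := by
  funext k
  simp [neg_div]

theorem adMatrix_neg (z : Fin n → ℂ) : adMatrix C (-z) = -adMatrix C z := by
  ext i j
  simp [adMatrix, Matrix.sum_apply]

theorem mulVec_gram_eq_zero {V : Type*} [NormedAddCommGroup V] [InnerProductSpace ℂ V]
    {t : Fin n → V} {a : Fin n → ℂ} (h : ∑ k, a k • t k = 0) : Matrix.gram ℂ t *ᵥ a = 0 := by
  funext i
  simp only [Matrix.mulVec, dotProduct, Matrix.gram_apply, Pi.zero_apply]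
  simp_rw [mul_comm _ (a _), ← inner_smul_right]
  rw [← inner_sum, h, inner_zero_right]

/-- A linear relation between symmetric operators gives one between the vectors `s_k ψ`. -/
theorem sum_smul_eq_zero {ι : Type*} (hE : Dense (E : Set H)) {φ : L2 ι H} {l : Fin n → L2 ι H}
    (h : ∀ k (u : E) j, inner ℂ ((s k u : E) : H) (φ j) = inner ℂ (u : H) (l k j))
    {a : Fin n → ℝ} (ha : ∑ k, (a k : ℂ) • s k = 0) : ∑ k, (a k : ℂ) • l k = 0 := by
  ext j
  refine hE.eq_zero_of_inner_right ℂ fun u hu => ?_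
  have := congrArg (fun f : Module.End ℂ E => inner ℂ ((f ⟨u, hu⟩ : E) : H) (φ j)) ha
  simp only [LinearMap.sum_apply, LinearMap.smul_apply, Submodule.coe_sum, Submodule.coe_smul,
    sum_inner, inner_smul_left, h, Complex.conj_ofReal, LinearMap.zero_apply,
    ZeroMemClass.coe_zero, inner_zero_left] at this
  simpa only [lp.coeFn_sum, Finset.sum_apply, lp.coeFn_smul, Pi.smul_apply, inner_sum,
    inner_smul_right] using this

variable [CompleteSpace H] {ι : Type*} {ψ : ι → E} {r : ℝ}

/-- The initial family in the Hilbert sum. -/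
def initL2 (h : JointlyAnalytic s ψ r) : L2 ι H := familyL2 s ⟨ψ, h.mem_smoothFamilies⟩

/-- The family `s_k ψ` in the Hilbert sum. -/
def genInitL2 (h : JointlyAnalytic s ψ r) (k : Fin n) : L2 ι H :=
  familyL2 s (familyGen s k ⟨ψ, h.mem_smoothFamilies⟩)

omit [CompleteSpace H] in
theorem gram_orthPart_of_inner {V : Fin n → L2 ι H} {W : Fin n → L2 ι H} {φ ψ : L2 ι H}
    (h1 : ∀ i k, inner ℂ (V i) (V k) = inner ℂ (W i) (W k))
    (h2 : ∀ k, inner ℂ φ (V k) = inner ℂ ψ (W k)) (h3 : inner ℂ φ φ = inner ℂ ψ ψ) :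
    (Matrix.gram ℂ fun k => orthPart φ (V k)) = Matrix.gram ℂ fun k => orthPart ψ (W k) := by
  ext i k
  simp only [Matrix.gram_apply, orthPart, inner_sub_left, inner_sub_right, inner_smul_left,
    inner_smul_right, h1, h2, h3]
  rw [← inner_conj_symm (V i) φ, ← inner_conj_symm (W i) ψ, h2]

/-- For imaginary z the exponential preserves inner products, and pulling s_k through it with
`genExpMap_eq` produces the matrix e^A. The covariances thus reduce to those of the initial state.
-/
theorem canonL2_gram (hE : Dense (E : Set H))
    (hC : ∀ i k, s i * s k - s k * s i = ∑ j, C i k j • s j)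
    (hs : ∀ (k : Fin n) (u v : E),
      inner ℂ ((s k u : E) : H) (v : H) = inner ℂ (u : H) ((s k v : E) : H))
    (hψ : HasSum (fun j => ‖(ψ j : H)‖ ^ 2) 1) (h : JointlyAnalytic s ψ r)
    {z : Fin n → ℂ} (hz : ‖z‖ < r) (hzs : star z = -z) :
    (Matrix.gram ℂ fun k => orthPart (canonL2 h z) (genCanonL2 h k z)) =
      NormedSpace.exp (adMatrix C z) *
        (Matrix.gram ℂ fun k => orthPart (initL2 h) (genInitL2 h k)) *
        (NormedSpace.exp (adMatrix C z))ᴴ := by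
  have hr : 0 < r := (norm_nonneg z).trans_lt hz
  have hskew : ∀ u v, inner ℂ (familyL2 s (genComb (familyGen s) z u)) (familyL2 s v) =
      -inner ℂ (familyL2 s u) (familyL2 (ι := ι) s (genComb (familyGen s) z v)) := by
    intro u v
    rw [← tsum_eq_inner (fun j => rfl), ← tsum_eq_inner (fun j => rfl), ← tsum_neg]
    refine tsum_congr fun j => ?_
    simp only [familyL2_apply, genComb_familyGen_apply]
    rw [genComb_apply, genComb_apply]
    simp only [Submodule.coe_sum, Submodule.coe_smul, sum_inner, inner_sum, inner_smul_left,
        inner_smul_right, hs]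
    rw [← Finset.sum_neg_distrib]
    refine Finset.sum_congr rfl fun k _ => ?_
    have := congrFun hzs k
    simp only [Pi.star_apply, RCLike.star_def, Pi.neg_apply] at this
    rw [this, neg_mul]
  have ha0 : IsAnalyticVec (familyL2 s) (familyGen s) ⟨ψ, h.mem_smoothFamilies⟩ ‖z‖ :=
    h.isAnalyticVec.mono (norm_nonneg z) hz.le
  have hak : ∀ k, IsAnalyticVec (familyL2 s) (familyGen s)
      (familyGen s k ⟨ψ, h.mem_smoothFamilies⟩) ‖z‖ := fun k =>
    h.isAnalyticVec.gen (norm_nonneg z) hz k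
  set a : Fin n → L2 ι H := fun k =>
    expMap (familyL2 s) (familyGen s) z (familyGen s k ⟨ψ, h.mem_smoothFamilies⟩) with hadef
  have hF : inner ℂ (expFamily h z) (expFamily h z) = inner ℂ (initL2 h) (initL2 h) :=
    inner_expMap_of_skew ha0 ha0 hskew
  have hψ1 : ‖initL2 h‖ = 1 := by
    have : ‖initL2 h‖ ^ 2 = 1 := (L2.hasSum_norm_sq (initL2 h)).unique hψ
    exact (pow_eq_one_iff_of_nonneg (norm_nonneg _) two_ne_zero).1 this
  have hF1 : ‖expFamily h z‖ = 1 := by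
    have := congrArg Complex.re hF
    rw [inner_self_eq_norm_sq_to_K, inner_self_eq_norm_sq_to_K, hψ1] at this
    simp only [Complex.coe_algebraMap] at this
    norm_cast at this
    exact (pow_eq_one_iff_of_nonneg (norm_nonneg _) two_ne_zero).1 (by simpa using this)
  have e1 : canonL2 h z = expFamily h z := by simp [canonL2, hF1]
  have e2 : ∀ k, genCanonL2 h k z =
      ∑ j, conj (NormedSpace.exp (adMatrix C z) k j) • a j := fun k => by
    have h3 := h.isAnalyticVec.genExpMap_eq hz
      (genComb_comm (familyGen_comm s (adjoint_comm hE hC hs)) z) k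
    have h4 : -(adMatrix C (star z)).map conj = (adMatrix C z).map conj := by
      rw [hzs, adMatrix_neg]
      ext i j
      simp
    rw [h4, exp_map_conj] at h3
    rw [genCanonL2, hF1]
    simpa [genExpFamily] using h3
  simp_rw [e1, e2, orthPart_sum]
  rw [gram_sum_eq, gram_orthPart_of_inner (V := a) (φ := expFamily h z) (W := genInitL2 h)
    (ψ := initL2 h) (fun i k => inner_expMap_of_skew (hak i) (hak k) hskew)
    (fun k => inner_expMap_of_skew ha0 (hak k) hskew) hF]

theorem wirtinger_im (hbar : ℝ) (β : Fin n → ℂ) (i k : Fin n) :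
    wirtinger (fun b : Fin n → ℂ => ((hbar * (b i).im : ℝ) : ℂ)) β k =
      (-(Complex.I * hbar) / 2) * (1 : Matrix (Fin n) (Fin n) ℂ) i k := by
  let L : (Fin n → ℂ) →L[ℝ] ℂ := Complex.ofRealCLM ∘L (hbar • Complex.imCLM) ∘L
    (ContinuousLinearMap.proj (R := ℝ) (φ := fun _ : Fin n => ℂ) i)
  have hL : ∀ b : Fin n → ℂ, L b = ((hbar * (b i).im : ℝ) : ℂ) := fun b => by simp [L]
  have : fderiv ℝ (fun b : Fin n → ℂ => ((hbar * (b i).im : ℝ) : ℂ)) β = L := by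
    simp_rw [← hL]
    exact L.fderiv
  rw [wirtinger, this, hL, hL, Matrix.one_apply]
  by_cases hik : i = k
  · subst hik
    simp
    ring
  · simp [hik]

/-- The bound for Hermitian generators, for estimates unbiased on the canonical family. -/
theorem posSemidef_errMatrix_sub_hermitian {X : Type*} [MeasurableSpace X]
    (hE : Dense (E : Set H))
    {hbar : ℝ} (hb : 0 < hbar) (hC : ∀ i k, s i * s k - s k * s i = ∑ j, C i k j • s j)
    (hs : ∀ (k : Fin n) (u v : E),
      inner ℂ ((s k u : E) : H) (v : H) = inner ℂ (u : H) ((s k v : E) : H))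
    (hψ : HasSum (fun j => ‖(ψ j : H)‖ ^ 2) 1) (h : JointlyAnalytic s ψ r) {θ : Fin n → ℝ}
    (hr : 0 < r) (hθ : ∀ k, |θ k| / hbar < r) {βθ : Fin n → ℂ}
    (hβθ : βθ = fun k => Complex.I * θ k / hbar)
    (P : QPM X H) {est : X → Fin n → ℝ} (he : Measurable est)
    (hM : ∃ M : ℝ≥0, ∀ᶠ b in 𝓝 βθ, ∀ i, ∫⁻ ω, ‖est ω i‖ₑ ^ 2 ∂(P.law (canonVec s ψ b)) ≤ M)
    (hu : ∀ᶠ b in 𝓝 βθ, ∀ i, ∫ ω, est ω i ∂(P.law (canonVec s ψ b)) = hbar * (b i).im)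
    (hQ : IsUnit (expQuot (adMatrix C βθ)).det)
    (hS : IsUnit (covMatrix (fun j => (ψ j : H)) s).det) :
    (errMatrix (P.law (canonVec s ψ βθ)) (fun ω i => (est ω i : ℂ)) (fun i => (θ i : ℂ))
      - ((hbar : ℂ) ^ 2 / 4) • ((kMatrix (adMatrix C βθ))ᵀ *
        (covMatrix (fun j => (ψ j : H)) s)⁻¹ * kMatrix (adMatrix C βθ))).PosSemidef := by
  have hβ : ‖βθ‖ < r := by
    rw [pi_norm_lt_iff hr]
    intro k
    simpa [hβθ, abs_of_pos hb] using hθ k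
  have hstar : star βθ = -βθ := by rw [hβθ, star_imaginary]
  have hinit : ∀ k (u : E) j,
      inner ℂ ((s k u : E) : H) (initL2 h j) = inner ℂ (u : H) (genInitL2 h k j) :=
    fun k u j => hs k u (ψ j)
  have hS0 : covMatrix (fun j => (ψ j : H)) s =
      Matrix.gram ℂ fun k => orthPart (initL2 h) (genInitL2 h k) :=
    covMatrix_eq_gram hE (φ := initL2 h) hinit
  -- A real relation among the s_k would put a vector in the kernel of the nonsingular matrix S₀.
  have hCi := conj_structureConst hE hC hs fun a ha => by
    have h1 := mulVec_gram_eq_zero (t := fun k => orthPart (initL2 h) (genInitL2 h k))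
      (a := fun k => (a k : ℂ)) (by
        rw [← orthPart_sum, sum_smul_eq_zero hE hinit ha]; simp [orthPart])
    rw [← hS0] at h1
    have h2 := (Matrix.mulVec_injective_iff_isUnit.2 ((Matrix.isUnit_iff_isUnit_det _).2 hS))
      (h1.trans (Matrix.mulVec_zero _).symm)
    funext k
    simpa using congrFun h2 k
  have hreal : (kMatrix (adMatrix C βθ))ᴴ = (kMatrix (adMatrix C βθ))ᵀ :=
    kMatrix_conjTranspose (by rw [hβθ]; exact adMatrix_map_conj hbar hCi)
  have hcov := canonL2_gram hE hC hs hψ h hβ hstar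
  rw [← covMatrix_canonVec hE hs h hβ, ← hS0] at hcov
  have hexp : IsUnit (NormedSpace.exp (adMatrix C βθ)).det :=
    (Matrix.isUnit_iff_isUnit_det _).1 (Matrix.isUnit_exp _)
  have hQm : expQuot (adMatrix C (star βθ)) * NormedSpace.exp (adMatrix C βθ) =
      expQuot (adMatrix C βθ) := by
    rw [hstar, adMatrix_neg, expQuot_neg_mul_exp]
  have hQ' : IsUnit (expQuot (adMatrix C (star βθ))).det := by
    rw [← hQm, Matrix.det_mul] at hQ
    exact isUnit_of_mul_isUnit_left hQ
  have hS' : IsUnit (covMatrix (canonVec s ψ βθ) s).det := by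
    rw [hcov, Matrix.det_mul, Matrix.det_mul, Matrix.det_conjTranspose]
    exact (hexp.mul hS).mul hexp.star
  have hest : Measurable fun ω i => (est ω i : ℂ) := by fun_prop
  have hϑ : DifferentiableAt ℝ (fun (b : Fin n → ℂ) i => ((hbar * (b i).im : ℝ) : ℂ)) βθ := by
    refine differentiableAt_pi.2 fun i => ?_
    exact Complex.ofRealCLM.differentiableAt.comp βθ
      ((Complex.imCLM.differentiableAt.comp βθ (differentiableAt_apply i βθ)).const_mul hbar)
  have key := posSemidef_errMatrix_sub_canonVec hE hC hs hψ h hβ P hest hϑ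
    (by
      obtain ⟨M, hM⟩ := hM
      refine ⟨M, hM.mono fun b hb i => ?_⟩
      simpa [enorm, Complex.nnnorm_real] using hb i)
    (hu.mono fun b hb i => by rw [integral_complex_ofReal, hb i]) hQ' hS'
  have hD : (Matrix.of fun i k => wirtinger (fun b : Fin n → ℂ => ((hbar * (b i).im : ℝ) : ℂ)) βθ k)
      = (-(Complex.I * hbar) / 2) • (1 : Matrix (Fin n) (Fin n) ℂ) := by
    ext i k
    rw [Matrix.of_apply, wirtinger_im]
    rfl
  -- Here star βθ = -βθ. The factors e^A of the covariance matrix at βθ are absorbed through Q(-A)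
  -- e^A = Q(A).
  have hK : (kMatrix (adMatrix C (star βθ)))ᴴ * (covMatrix (canonVec s ψ βθ) s)⁻¹ *
      kMatrix (adMatrix C (star βθ)) = (kMatrix (adMatrix C βθ))ᵀ *
        (covMatrix (fun j => (ψ j : H)) s)⁻¹ * kMatrix (adMatrix C βθ) := by
    rw [← hreal, hcov]
    simp only [kMatrix, ← hQm, Matrix.mul_inv_rev, Matrix.conjTranspose_mul,
      Matrix.conjTranspose_nonsing_inv, Matrix.mul_assoc]
  have hval : (fun i => ((hbar * (βθ i).im : ℝ) : ℂ)) = fun i => (θ i : ℂ) := by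
    funext i
    congr 1
    rw [hβθ]
    simp [Complex.div_ofReal_im]
    field_simp
  rw [hD, hval, Matrix.conjTranspose_smul, Matrix.conjTranspose_one] at key
  rw [← hK]
  convert key using 2
  simp only [Matrix.mul_assoc, Matrix.smul_mul, Matrix.mul_smul, Matrix.one_mul, Matrix.mul_one,
    smul_smul]
  congr 1
  simp [Complex.conj_ofReal]
  ring_nf
  simp
  ring

end HermitianGenerators

/-! ### Linear differential equations and a weak product rule -/

section LinearSystems

variable {n : ℕ}

open scoped Matrix.Norms.Operator in
theorem hasDerivAt_exp_smul_apply (A : Matrix (Fin n) (Fin n) ℂ) (t : ℝ) (k j : Fin n) :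
    HasDerivAt (fun t : ℝ => NormedSpace.exp (t • A) k j)
      ((A * NormedSpace.exp (t • A)) k j) t :=
  hasDerivAt_pi.1 (hasDerivAt_pi.1 (hasDerivAt_exp_smul_const' (𝕂 := ℝ) A t) k) j

open scoped Matrix.Norms.Operator in
theorem hasDerivAt_exp_smul_apply' (A : Matrix (Fin n) (Fin n) ℂ) (t : ℝ) (k j : Fin n) :
    HasDerivAt (fun t : ℝ => NormedSpace.exp (t • A) k j)
      ((NormedSpace.exp (t • A) * A) k j) t :=
  hasDerivAt_pi.1 (hasDerivAt_pi.1 (hasDerivAt_exp_smul_const (𝕂 := ℝ) A t) k) j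

/-- The solution of a linear system with constant coefficients. -/
theorem eq_exp_mulVec {A : Matrix (Fin n) (Fin n) ℂ} {c : ℝ → Fin n → ℂ}
    (hc : ∀ t k, HasDerivAt (fun t => c t k) (∑ j, A k j * c t j) t) :
    c 1 = NormedSpace.exp A *ᵥ c 0 := by
  -- The vector e^{-tA} c(t) is constant.
  have hd : ∀ k t, HasDerivAt (fun t : ℝ => ∑ j, NormedSpace.exp (t • -A) k j * c t j) 0 t := by
    intro k t
    have h := HasDerivAt.fun_sum (u := Finset.univ) fun j _ =>
      (hasDerivAt_exp_smul_apply' (-A) t k j).mul (hc t j)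
    refine h.congr_deriv ?_
    rw [Finset.sum_add_distrib]
    have : (∑ j, NormedSpace.exp (t • -A) k j * ∑ i, A j i * c t i) =
        ∑ i, (NormedSpace.exp (t • -A) * A) k i * c t i := by
      simp only [Matrix.mul_apply, Finset.mul_sum, Finset.sum_mul]
      rw [Finset.sum_comm]
      simp only [mul_assoc]
    rw [this]
    simp
  have hconst : ∀ k, ∑ j, NormedSpace.exp ((1 : ℝ) • -A) k j * c 1 j =
      ∑ j, NormedSpace.exp ((0 : ℝ) • -A) k j * c 0 j := fun k =>
    is_const_of_deriv_eq_zero (fun t => (hd k t).differentiableAt) (fun t => (hd k t).deriv) 1 0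
  have h1 : NormedSpace.exp (-A) *ᵥ c 1 = c 0 := by
    funext k
    have := hconst k
    rw [one_smul, zero_smul, NormedSpace.exp_zero] at this
    simpa [Matrix.mulVec, dotProduct, Matrix.one_apply] using this
  have h2 : NormedSpace.exp A * NormedSpace.exp (-A) = 1 := by
    rw [← Matrix.exp_add_of_commute _ _ (Commute.refl A).neg_right, add_neg_cancel,
      NormedSpace.exp_zero]
  rw [← h1, Matrix.mulVec_mulVec, h2, Matrix.one_mulVec]

theorem continuous_exp_smul_apply (A : Matrix (Fin n) (Fin n) ℂ) (k j : Fin n) :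
    Continuous fun t : ℝ => NormedSpace.exp (t • A) k j :=
  continuous_iff_continuousAt.2 fun t => (hasDerivAt_exp_smul_apply A t k j).continuousAt

/-- `∫₀¹ e^{(1-t)A} dt = (e^A - 1) A⁻¹`. -/
theorem integral_exp_smul_apply (A : Matrix (Fin n) (Fin n) ℂ) (k j : Fin n) :
    ∫ t in (0 : ℝ)..1, NormedSpace.exp ((1 - t) • A) k j = expQuot A k j := by
  have h := intervalIntegral.hasSum_integral_of_dominated_convergence (μ := volume) (a := 0) (b := 1)
    (F := fun (l : ℕ) (t : ℝ) => ((1 - t : ℝ) : ℂ) ^ l * (((l.factorial : ℂ))⁻¹ * (A ^ l) k j))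
    (f := fun t => NormedSpace.exp ((1 - t) • A) k j)
    (fun l _ => ‖((l.factorial : ℂ))⁻¹ * (A ^ l) k j‖)
    (fun l => by
      refine Continuous.aestronglyMeasurable ?_
      fun_prop)
    (fun l => Eventually.of_forall fun t ht => by
      rw [Set.uIoc_of_le zero_le_one] at ht
      rw [norm_mul, norm_pow, Complex.norm_real]
      refine mul_le_of_le_one_left (norm_nonneg _) (pow_le_one₀ (norm_nonneg _) ?_)
      rw [Real.norm_eq_abs, abs_le]
      constructor <;> linarith [ht.1, ht.2])
    (Eventually.of_forall fun t _ => summable_norm_exp_entry A k j)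
    intervalIntegrable_const
    (Eventually.of_forall fun t _ => by
      have := Pi.hasSum.1 (Pi.hasSum.1 (hasSum_exp ((1 - t) • A)) k) j
      refine this.congr_fun fun l => ?_
      rw [smul_pow, Matrix.smul_apply, Matrix.smul_apply, smul_eq_mul, Complex.real_smul]
      push_cast
      ring)
  refine h.unique ?_
  have h2 := Pi.hasSum.1 (Pi.hasSum.1 (hasSum_expQuot A) k) j
  refine h2.congr_fun fun l => ?_
  -- This factor turns 1/l! into 1/(l + 1)!.
  have e : ∫ t in (0 : ℝ)..1, ((1 - t : ℝ) : ℂ) ^ l = ((l : ℂ) + 1)⁻¹ := by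
    have e1 : ∫ t in (0 : ℝ)..1, (1 - t) ^ l = ((l : ℝ) + 1)⁻¹ := by
      rw [intervalIntegral.integral_comp_sub_left (fun t : ℝ => t ^ l) 1]
      simp [integral_pow]
    simp only [← Complex.ofReal_pow]
    rw [intervalIntegral.integral_ofReal, e1]
    push_cast
    rfl
  rw [intervalIntegral.integral_mul_const, e, Matrix.smul_apply, smul_eq_mul, Nat.factorial_succ]
  push_cast
  rw [mul_inv]
  ring

/-- The product rule for an inner product one factor of which is only continuous. -/
theorem hasDerivAt_inner_of_continuousAt {H : Type*} [NormedAddCommGroup H] [InnerProductSpace ℂ H]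
    {F G : ℝ → H} {F' : H} {d : ℂ} {t : ℝ} (hF : HasDerivAt F F' t) (hG : ContinuousAt G t)
    (hd : HasDerivAt (fun τ => inner ℂ (F t) (G τ)) d t) :
    HasDerivAt (fun τ => inner ℂ (F τ) (G τ)) (inner ℂ F' (G t) + d) t := by
  rw [hasDerivAt_iff_tendsto_slope] at hF hd ⊢
  have h1 : Tendsto (fun τ => inner ℂ (slope F t τ) (G τ)) (𝓝[≠] t) (𝓝 (inner ℂ F' (G t))) :=
    hF.inner (hG.mono_left nhdsWithin_le_nhds)
  refine (h1.add hd).congr fun τ => ?_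
  simp only [slope_def_module, ← Complex.coe_smul, inner_smul_left, Complex.conj_ofReal,
    inner_sub_left, smul_eq_mul]
  ring

end LinearSystems

/-! ### Unitary representations and the adjoint action -/

section Representation

variable {H : Type*} [NormedAddCommGroup H] [InnerProductSpace ℂ H] {n : ℕ} {E : Submodule ℂ H}
  {C : Fin n → Fin n → Fin n → ℂ} {hbar : ℝ} {s : Fin n → Module.End ℂ E}
  {U : (Fin n → ℝ) → (H ≃ₗᵢ[ℂ] H)}

/-- The complex parameter `i θ / ħ`. -/
abbrev phase (hbar : ℝ) (θ : Fin n → ℝ) : Fin n → ℂ := fun k => Complex.I * θ k / hbar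

theorem phase_smul (t : ℝ) (θ : Fin n → ℝ) : phase hbar (t • θ) = (t : ℂ) • phase hbar θ := by
  funext k
  simp [phase]
  ring

theorem adMatrix_smul (c : ℂ) (z : Fin n → ℂ) : adMatrix C (c • z) = c • adMatrix C z := by
  simp [adMatrix, Finset.smul_sum, smul_smul]

theorem adMatrix_phase_smul (t : ℝ) (θ : Fin n → ℝ) :
    adMatrix C (phase hbar (t • θ)) = t • adMatrix C (phase hbar θ) := by
  rw [phase_smul, adMatrix_smul]
  ext i j
  simp

theorem gen_genComb_comm {R : Type*} [AddCommGroup R] [Module ℂ R] {s : Fin n → Module.End ℂ R}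
    (hC : ∀ i k, s i * s k - s k * s i = ∑ j, C i k j • s j)
    (z : Fin n → ℂ) (k : Fin n) :
    s k * genComb s z - genComb s z * s k = ∑ j, adMatrix C z k j • s j := by
  have h : ∀ i, s k * (z i • s i) - z i • s i * s k = ∑ j, (z i * C k i j) • s j := fun i => by
    rw [smul_mul_assoc, mul_smul_comm, ← smul_sub, hC, Finset.smul_sum]
    simp only [smul_smul]
  rw [genComb, Finset.sum_mul, Finset.mul_sum, ← Finset.sum_sub_distrib,
    Finset.sum_congr rfl fun i _ => h i, Finset.sum_comm]
  refine Finset.sum_congr rfl fun j _ => ?_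
  rw [← Finset.sum_smul]
  congr 1
  simp [adMatrix, Matrix.sum_apply]

namespace IsUnitaryRep

variable (hU : IsUnitaryRep hbar s U)
include hU

theorem apply_zero (v : H) : U 0 v = v := by
  have := hU.map_add 0 0 0 v
  simp only [smul_zero] at this
  exact ((U 0).injective this).symm

theorem apply_neg_apply (θ : Fin n → ℝ) (v : H) : U (-θ) (U θ v) = v := by
  have := hU.map_add θ (-1) 1 v
  simpa [hU.apply_zero] using this.symm

theorem apply_apply_neg (θ : Fin n → ℝ) (v : H) : U θ (U (-θ) v) = v := by
  simpa using hU.apply_neg_apply (-θ) v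

theorem inner_apply_left (θ : Fin n → ℝ) (u v : H) : inner ℂ (U θ u) v = inner ℂ u (U (-θ) v) := by
  conv_lhs => rw [← hU.apply_apply_neg θ v]
  exact (U θ).inner_map_map u _

theorem inner_apply_right (θ : Fin n → ℝ) (u v : H) : inner ℂ u (U θ v) = inner ℂ (U (-θ) u) v := by
  simpa using (hU.inner_apply_left (-θ) u v).symm

theorem hasDerivAt_zero (θ : Fin n → ℝ) (v : E) :
    HasDerivAt (fun t : ℝ => U (t • θ) (v : H)) ((genComb s (phase hbar θ) v : E) : H) 0 := by
  convert hU.hasDerivAt θ v using 1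
  rw [genComb_apply, Submodule.coe_sum, Finset.smul_sum]
  refine Finset.sum_congr rfl fun k _ => ?_
  rw [Submodule.coe_smul, smul_smul]
  congr 1
  simp only [phase]
  ring

/-- A member of the representation acting on the invariant domain. -/
def onDomain (θ : Fin n → ℝ) (v : E) : E := ⟨U θ v, hU.mapsTo θ v⟩

theorem hasDerivAt_apply (θ : Fin n → ℝ) (v : E) (t : ℝ) :
    HasDerivAt (fun t : ℝ => U (t • θ) (v : H))
      ((genComb s (phase hbar θ) (hU.onDomain (t • θ) v) : E) : H) t := by
  have h1 := hU.hasDerivAt_zero θ (hU.onDomain (t • θ) v)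
  rw [← sub_self t] at h1
  refine (h1.comp_sub_const t t).congr_of_eventuallyEq (Eventually.of_forall fun τ => ?_)
  have := hU.map_add θ (τ - t) t (v : H)
  rwa [sub_add_cancel] at this

theorem hasDerivAt_apply' (θ : Fin n → ℝ) (v : E) (t : ℝ) :
    HasDerivAt (fun t : ℝ => U (t • θ) (v : H))
      (U (t • θ) ((genComb s (phase hbar θ) v : E) : H)) t := by
  have h1 := (U (t • θ)).toContinuousLinearEquiv.toContinuousLinearMap.restrictScalars ℝ
    |>.hasFDerivAt.comp_hasDerivAt (0 : ℝ) (hU.hasDerivAt_zero θ v)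
  rw [← sub_self t] at h1
  refine (h1.comp_sub_const t t).congr_of_eventuallyEq (Eventually.of_forall fun τ => ?_)
  have := hU.map_add θ t (τ - t) (v : H)
  rwa [add_sub_cancel] at this

/-- Derivative at t = 0 of ⟨U(tθ)u, U(tθ)v⟩ = ⟨u, v⟩. -/
theorem inner_genComb_phase (θ : Fin n → ℝ) (u v : E) :
    inner ℂ ((genComb s (phase hbar θ) u : E) : H) (v : H) =
      -inner ℂ (u : H) ((genComb s (phase hbar θ) v : E) : H) := by
  have h1 := (hU.hasDerivAt_zero θ u).inner ℂ (hU.hasDerivAt_zero θ v)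
  have h2 : HasDerivAt (fun t : ℝ => inner ℂ (U (t • θ) (u : H)) (U (t • θ) (v : H))) 0 0 := by
    simp only [LinearIsometryEquiv.inner_map_map]
    exact hasDerivAt_const _ _
  have := h1.unique h2
  rw [zero_smul, hU.apply_zero, hU.apply_zero] at this
  linear_combination this

/-- The generators of a unitary representation are symmetric. -/
theorem inner_gen (hb : 0 < hbar) (k : Fin n) (u v : E) :
    inner ℂ ((s k u : E) : H) (v : H) = inner ℂ (u : H) ((s k v : E) : H) := by
  have h := hU.inner_genComb_phase (Pi.single k 1) u v
  have e : (phase hbar (Pi.single k 1) : Fin n → ℂ) =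
      (Complex.I / hbar : ℂ) • Pi.single k 1 := by
    funext i
    by_cases hi : i = k
    · subst hi; simp [phase]
    · simp [phase, hi]
  rw [e, genComb_smul, genComb_single, LinearMap.smul_apply, LinearMap.smul_apply,
    Submodule.coe_smul, Submodule.coe_smul, inner_smul_left, inner_smul_right, map_div₀,
    Complex.conj_I, Complex.conj_ofReal] at h
  have hne : (Complex.I / hbar : ℂ) ≠ 0 :=
    div_ne_zero Complex.I_ne_zero (by exact_mod_cast hb.ne')
  refine mul_left_cancel₀ hne ?_
  linear_combination -h

/-- The adjoint action on the generators. -/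
theorem gen_onDomain (hE : Dense (E : Set H)) (hb : 0 < hbar)
    (hC : ∀ i k, s i * s k - s k * s i = ∑ j, C i k j • s j) (θ : Fin n → ℝ) (v : E) (k : Fin n) :
    ((s k (hU.onDomain θ v) : E) : H) =
      ∑ j, NormedSpace.exp (adMatrix C (phase hbar θ)) k j • U θ ((s j v : E) : H) := by
  have key : ∀ u : E, inner ℂ (U θ u) ((s k (hU.onDomain θ v) : E) : H) =
      ∑ j, NormedSpace.exp (adMatrix C (phase hbar θ)) k j *
        inner ℂ (u : H) ((s j v : E) : H) := by
    intro u
    -- The functions ⟨U(tθ)u, s_k U(tθ)v⟩ solve c' = A c by the commutation relations. Since s_k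
    -- U(tθ)v is only known to be continuous, its weak derivative is found by moving s_k to the
    -- other side, where symmetry leaves the differentiable U(tθ)v.
    have h := eq_exp_mulVec (A := adMatrix C (phase hbar θ)) (c := fun t k =>
      inner ℂ (U (t • θ) (u : H)) ((s k (hU.onDomain (t • θ) v) : E) : H)) (fun t k => by
        have hd : HasDerivAt (fun τ : ℝ => inner ℂ (U (t • θ) (u : H))
            ((s k (hU.onDomain (τ • θ) v) : E) : H))
            (inner ℂ ((s k (hU.onDomain (t • θ) u) : E) : H)
              ((genComb s (phase hbar θ) (hU.onDomain (t • θ) v) : E) : H)) t := by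
          have := (hasDerivAt_const t ((s k (hU.onDomain (t • θ) u) : E) : H)).inner ℂ
            (hU.hasDerivAt_apply θ v t)
          rw [inner_zero_left, add_zero] at this
          exact this.congr_of_eventuallyEq (Eventually.of_forall fun τ =>
            (hU.inner_gen hb k (hU.onDomain (t • θ) u) (hU.onDomain (τ • θ) v)).symm)
        refine (hasDerivAt_inner_of_continuousAt (hU.hasDerivAt_apply θ u t)
          (hU.continuous_gen θ v k).continuousAt hd).congr_deriv ?_
        have h1 := hU.inner_genComb_phase θ (hU.onDomain (t • θ) u)
          (s k (hU.onDomain (t • θ) v))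
        have h2 := hU.inner_gen hb k (hU.onDomain (t • θ) u)
          (genComb s (phase hbar θ) (hU.onDomain (t • θ) v))
        have h3 := congrArg (fun f : Module.End ℂ E => inner ℂ (U (t • θ) (u : H))
          ((f (hU.onDomain (t • θ) v) : E) : H)) (gen_genComb_comm hC (phase hbar θ) k)
        generalize genComb s (phase hbar θ) = A at h1 h2 h3 ⊢
        simp only [LinearMap.sub_apply, Module.End.mul_apply, LinearMap.sum_apply,
          LinearMap.smul_apply, Submodule.coe_sub, Submodule.coe_sum, Submodule.coe_smul,
          inner_sub_right, inner_sum, inner_smul_right] at h3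
        rw [← h3, h2]
        refine (congrArg (· + _) h1).trans (neg_add_eq_sub _ _))
    have h4 := congrFun h k
    simp only [Matrix.mulVec, dotProduct, one_smul, zero_smul, onDomain, hU.apply_zero] at h4
    exact h4
  refine hE.eq_of_inner_right ℂ fun w hw => ?_
  have := key (hU.onDomain (-θ) ⟨w, hw⟩)
  simp only [onDomain, hU.apply_apply_neg] at this
  rw [inner_sum]
  refine this.trans (Finset.sum_congr rfl fun j _ => ?_)
  rw [inner_smul_right, hU.inner_apply_right]

/-- The adjoint action on the vectors `σ_k = s_k* ψ`. -/
theorem inner_gen_apply (hE : Dense (E : Set H)) (hb : 0 < hbar)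
    (hC : ∀ i k, s i * s k - s k * s i = ∑ j, C i k j • s j) {ψ : H} {σ : Fin n → H}
    (hσ : ∀ k (u : E), inner ℂ ((s k u : E) : H) ψ = inner ℂ (u : H) (σ k)) (θ : Fin n → ℝ)
    (k : Fin n) (u : E) :
    inner ℂ ((s k u : E) : H) (U θ ψ) = inner ℂ (u : H)
      (∑ j, conj (NormedSpace.exp (adMatrix C (phase hbar θ)) k j) • U θ (σ j)) := by
  have h := hU.gen_onDomain hE hb hC θ (hU.onDomain (-θ) u) k
  simp only [onDomain, hU.apply_apply_neg] at h
  change ((s k u : E) : H) = _ at h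
  rw [h, sum_inner, inner_sum]
  refine Finset.sum_congr rfl fun j _ => ?_
  rw [inner_smul_left, inner_smul_right, (U θ).inner_map_map, hσ, hU.inner_apply_right]

end IsUnitaryRep
end Representation

/-! ### Weak Duhamel formula and strong continuity -/

section WeakDuhamel

variable {H : Type*} [NormedAddCommGroup H] [InnerProductSpace ℂ H] {n : ℕ} {E : Submodule ℂ H}
  {C : Fin n → Fin n → Fin n → ℂ} {hbar : ℝ} {s : Fin n → Module.End ℂ E}
  {U : (Fin n → ℝ) → (H ≃ₗᵢ[ℂ] H)}

theorem conj_phase_sub (θ θ' : Fin n → ℝ) (k : Fin n) :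
    conj (phase hbar (θ - θ') k) = phase hbar (θ' - θ) k := by
  simp [phase]
  ring

theorem norm_le_of_inner_le (hE : Dense (E : Set H)) {x : H} {B : ℝ} (hB : 0 ≤ B)
    (h : ∀ u : E, ‖inner ℂ (u : H) x‖ ≤ B * ‖(u : H)‖) : ‖x‖ ≤ B := by
  have hcl : IsClosed {u : H | ‖inner ℂ u x‖ ≤ B * ‖u‖} :=
    isClosed_le (by fun_prop) (by fun_prop)
  have hx : x ∈ {u : H | ‖inner ℂ u x‖ ≤ B * ‖u‖} :=
    closure_minimal (fun u hu => h ⟨u, hu⟩) hcl (hE.closure_eq ▸ Set.mem_univ x)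
  simp only [Set.mem_ofPred_eq, inner_self_eq_norm_sq_to_K] at hx
  rcases eq_or_lt_of_le (norm_nonneg x) with h0 | h0
  · exact h0 ▸ hB
  · have : ‖x‖ * ‖x‖ ≤ B * ‖x‖ := by simpa [sq] using hx
    exact le_of_mul_le_mul_right this h0

namespace IsUnitaryRep

variable (hU : IsUnitaryRep hbar s U)
include hU

/-- The derivative along the path `t ↦ U(tθ') U((1-t)θ)`, in the weak sense. -/
theorem hasDerivAt_inner_path (hE : Dense (E : Set H)) (hb : 0 < hbar)
    (hC : ∀ i k, s i * s k - s k * s i = ∑ j, C i k j • s j) {ψ : H} {σ : Fin n → H}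
    (hσ : ∀ k (u : E), inner ℂ ((s k u : E) : H) ψ = inner ℂ (u : H) (σ k)) (θ θ' : Fin n → ℝ)
    (u : E) (t : ℝ) :
    HasDerivAt (fun t : ℝ => inner ℂ (u : H) (U (t • θ') (U ((1 - t) • θ) ψ)))
      (∑ k, phase hbar (θ' - θ) k * ∑ j,
        NormedSpace.exp ((1 - t) • (adMatrix C (phase hbar θ)).map conj) k j *
          inner ℂ (u : H) (U (t • θ') (U ((1 - t) • θ) (σ j)))) t := by
  -- Moving U(tθ') to u gives a differentiable factor, as u is smooth. The factor U((1-t)θ)ψ is only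
  -- continuous, but its pairing with the smooth vector w is differentiable.
  set w := hU.onDomain (t • -θ') u with hw
  have hG : Continuous fun τ : ℝ => U ((1 - τ) • θ) ψ :=
    (hU.continuous θ ψ).comp (continuous_const.sub continuous_id)
  have hd : HasDerivAt (fun τ : ℝ => inner ℂ (w : H) (U ((1 - τ) • θ) ψ))
      (inner ℂ ((genComb s (phase hbar θ) w : E) : H) (U ((1 - t) • θ) ψ)) t := by
    have h1 := ((hU.hasDerivAt_apply' θ w (t - 1)).comp_sub_const t 1).inner ℂ
      (hasDerivAt_const t ψ)
    simp only [hU.inner_apply_left, ← neg_smul, neg_sub] at h1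
    exact h1.congr_deriv (by simp)
  have h := hasDerivAt_inner_of_continuousAt (hU.hasDerivAt_apply (-θ') u t) hG.continuousAt hd
  refine (h.congr_of_eventuallyEq (Eventually.of_forall fun τ => ?_)).congr_deriv ?_
  · simp only [hU.inner_apply_right, smul_neg]
  · have e : ∀ k, ((phase hbar (θ - θ') k : ℂ)) = phase hbar (-θ') k + phase hbar θ k := fun k => by
      simp [phase]; ring
    have hk : ∀ k, inner ℂ ((s k w : E) : H) (U ((1 - t) • θ) ψ) = ∑ j,
        NormedSpace.exp ((1 - t) • (adMatrix C (phase hbar θ)).map conj) k j *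
          inner ℂ (u : H) (U (t • θ') (U ((1 - t) • θ) (σ j))) := fun k => by
      rw [hU.inner_gen_apply hE hb hC hσ, inner_sum]
      refine Finset.sum_congr rfl fun j _ => ?_
      have e1 : (1 - t) • (adMatrix C (phase hbar θ)).map conj =
          ((1 - t) • adMatrix C (phase hbar θ)).map conj := by
        ext i j; simp
      rw [inner_smul_right, adMatrix_phase_smul, e1, exp_map_conj, Matrix.map_apply,
        hU.inner_apply_right (t • θ'), ← smul_neg]
      rfl
    have hs : ∀ k, phase hbar (θ' - θ) k * inner ℂ ((s k w : E) : H) (U ((1 - t) • θ) ψ) =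
        conj (phase hbar (-θ') k) * inner ℂ ((s k w : E) : H) (U ((1 - t) • θ) ψ) +
        conj (phase hbar θ k) * inner ℂ ((s k w : E) : H) (U ((1 - t) • θ) ψ) := fun k => by
      rw [← conj_phase_sub θ θ' k, e, _root_.map_add, add_mul]
    simp_rw [← hk]
    rw [Finset.sum_congr rfl fun k _ => hs k, Finset.sum_add_distrib]
    have hg : ∀ z : Fin n → ℂ, inner ℂ ((genComb s z w : E) : H) (U ((1 - t) • θ) ψ) =
        ∑ k, conj (z k) * inner ℂ ((s k w : E) : H) (U ((1 - t) • θ) ψ) := fun z => by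
      rw [genComb_apply, Submodule.coe_sum, sum_inner]
      exact Finset.sum_congr rfl fun k _ => by rw [Submodule.coe_smul, inner_smul_left]
    rw [← hg, ← hg]

/-- The mean value inequality along the path from U(θ)v to U(θ')v gives a bound linear in θ' - θ,
uniform over smooth test vectors of norm one. -/
theorem tendsto_apply (hE : Dense (E : Set H)) (hb : 0 < hbar)
    (hC : ∀ i k, s i * s k - s k * s i = ∑ j, C i k j • s j) (θ : Fin n → ℝ) (v : E) :
    Tendsto (fun θ' => U θ' (v : H)) (𝓝 θ) (𝓝 (U θ v)) := by
  set N := (adMatrix C (phase hbar θ)).map conj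
  have hbd : ∀ k j, ∃ c : ℝ, ∀ t ∈ Set.Icc (0 : ℝ) 1, ‖NormedSpace.exp ((1 - t) • N) k j‖ ≤ c :=
    fun k j => isCompact_Icc.exists_bound_of_continuousOn
      ((continuous_exp_smul_apply N k j).comp (continuous_const.sub continuous_id)).continuousOn
  choose c hc using hbd
  have hlip : ∀ θ', ‖U θ' (v : H) - U θ v‖ ≤
      ∑ k, ‖phase hbar (θ' - θ) k‖ * ∑ j, c k j * ‖((s j v : E) : H)‖ := by
    intro θ'
    have hc0 : ∀ k j, 0 ≤ c k j := fun k j =>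
      (norm_nonneg _).trans (hc k j 0 ⟨le_rfl, zero_le_one⟩)
    refine norm_le_of_inner_le hE (Finset.sum_nonneg fun k _ => mul_nonneg (norm_nonneg _)
      (Finset.sum_nonneg fun j _ => mul_nonneg (hc0 k j) (norm_nonneg _))) fun u => ?_
    have h1 := norm_image_sub_le_of_norm_deriv_le_segment_01'
      (fun t _ => (hU.hasDerivAt_inner_path hE hb hC (fun k u => hU.inner_gen hb k u v) θ θ' u
        t).hasDerivWithinAt)
      (C := (∑ k, ‖phase hbar (θ' - θ) k‖ * ∑ j, c k j * ‖((s j v : E) : H)‖) * ‖(u : H)‖)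
      (fun t ht => by
        rw [Finset.sum_mul]
        refine (norm_sum_le _ _).trans (Finset.sum_le_sum fun k _ => ?_)
        rw [norm_mul, mul_assoc, Finset.sum_mul]
        refine mul_le_mul_of_nonneg_left ?_ (norm_nonneg _)
        refine (norm_sum_le _ _).trans (Finset.sum_le_sum fun j _ => ?_)
        rw [norm_mul, mul_assoc]
        refine mul_le_mul (hc k j t ⟨ht.1, ht.2.le⟩) ?_ (norm_nonneg _)
          (hc0 k j)
        refine (norm_inner_le_norm _ _).trans (le_of_eq ?_)
        rw [LinearIsometryEquiv.norm_map, LinearIsometryEquiv.norm_map, mul_comm])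
    simp only [sub_zero, one_smul, sub_self, zero_smul, hU.apply_zero] at h1
    rwa [inner_sub_right]
  rw [tendsto_iff_norm_sub_tendsto_zero]
  refine squeeze_zero (fun _ => norm_nonneg _) hlip ?_
  have : Continuous fun θ' : Fin n → ℝ =>
      ∑ k, ‖phase hbar (θ' - θ) k‖ * ∑ j, c k j * ‖((s j v : E) : H)‖ := by
    unfold phase
    fun_prop
  have h0 := this.tendsto θ
  simpa [phase] using h0

/-- A unitary representation in canonical coordinates is strongly continuous. -/
theorem continuous_apply (hE : Dense (E : Set H)) (hb : 0 < hbar)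
    (hC : ∀ i k, s i * s k - s k * s i = ∑ j, C i k j • s j) (v : H) :
    Continuous fun θ => U θ v := by
  refine continuous_iff_continuousAt.2 fun θ => ?_
  refine Metric.tendsto_nhds.2 fun ε hε => ?_
  obtain ⟨w, hw, hwε⟩ := Metric.dense_iff.1 hE v (ε / 3) (by linarith)
  rw [Metric.mem_ball, dist_comm] at hw
  have h := Metric.tendsto_nhds.1 (hU.tendsto_apply hE hb hC θ ⟨w, hwε⟩) (ε / 3) (by linarith)
  filter_upwards [h] with θ' hθ'
  calc dist (U θ' v) (U θ v) ≤ dist (U θ' v) (U θ' w) + dist (U θ' w) (U θ w)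
        + dist (U θ w) (U θ v) := dist_triangle4 _ _ _ _
    _ < ε := by
      rw [LinearIsometryEquiv.dist_map, LinearIsometryEquiv.dist_map, dist_comm w v]
      linarith

end IsUnitaryRep
end WeakDuhamel

/-! ### Duhamel formula and derivatives for families of vectors -/

section Amplification

variable {H : Type*} [NormedAddCommGroup H] [InnerProductSpace ℂ H] {n : ℕ} {ι : Type*}

/-- A unitary operator acting on every member of a family. -/
def amplifyUnitary (V : H ≃ₗᵢ[ℂ] H) : L2 ι H →L[ℂ] L2 ι H :=
  amplify (V.toContinuousLinearEquiv : H →L[ℂ] H)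

@[simp] theorem amplifyUnitary_apply (V : H ≃ₗᵢ[ℂ] H) (u : L2 ι H) (j : ι) :
    amplifyUnitary V u j = V (u j) := rfl

theorem inner_amplifyUnitary (V : H ≃ₗᵢ[ℂ] H) (u v : L2 ι H) :
    inner ℂ (amplifyUnitary V u) (amplifyUnitary V v) = inner ℂ u v := by
  rw [← tsum_eq_inner (u := u) (v := v) fun j => rfl]
  exact (tsum_eq_inner fun j => ((V.inner_map_map (u j) (v j)).symm)).symm

theorem norm_amplifyUnitary (V : H ≃ₗᵢ[ℂ] H) (u : L2 ι H) : ‖amplifyUnitary V u‖ = ‖u‖ := by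
  rw [@norm_eq_sqrt_re_inner ℂ, inner_amplifyUnitary, ← norm_eq_sqrt_re_inner]

theorem continuous_amplifyUnitary {W : Type*} [TopologicalSpace W] {V : W → (H ≃ₗᵢ[ℂ] H)}
    (hV : ∀ v, Continuous fun a => V a v) (u : L2 ι H) :
    Continuous fun a => amplifyUnitary (V a) u := by
  refine continuous_iff_continuousAt.2 fun a => ?_
  refine tendsto_iff_norm_sub_tendsto_zero.2 ?_
  have h1 : Tendsto (fun b => ∑' j, ‖V b (u j) - V a (u j)‖ ^ 2) (𝓝 a) (𝓝 (∑' _j : ι, (0 : ℝ))) := by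
    refine tendsto_tsum_of_dominated_convergence
      (bound := fun j => 4 * ‖u j‖ ^ 2) ((L2.hasSum_norm_sq u).summable.mul_left 4) (fun j => ?_)
      (Eventually.of_forall fun b j => ?_)
    · have := (tendsto_iff_norm_sub_tendsto_zero.1 ((hV (u j)).tendsto a)).pow 2
      simpa using this
    · rw [norm_pow, norm_norm]
      have : ‖V b (u j) - V a (u j)‖ ≤ 2 * ‖u j‖ := (norm_sub_le _ _).trans (by
        rw [LinearIsometryEquiv.norm_map, LinearIsometryEquiv.norm_map, two_mul])
      calc ‖V b (u j) - V a (u j)‖ ^ 2 ≤ (2 * ‖u j‖) ^ 2 := by gcongr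
        _ = _ := by ring
  rw [tsum_zero] at h1
  have h2 : ∀ b, ‖amplifyUnitary (V b) u - amplifyUnitary (V a) u‖ =
      √(∑' j, ‖V b (u j) - V a (u j)‖ ^ 2) := fun b => by
    rw [← Real.sqrt_sq (norm_nonneg (_ - _)), ← (L2.hasSum_norm_sq _).tsum_eq]
    rfl
  simp_rw [h2]
  have h3 := (Real.continuous_sqrt.tendsto 0).comp h1
  rw [Real.sqrt_zero] at h3
  exact h3

/-- Strongly continuous families of isometries act continuously. -/
theorem continuous_amplifyUnitary_comp {W : Type*} [TopologicalSpace W] {V : W → (H ≃ₗᵢ[ℂ] H)}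
    (hV : ∀ v, Continuous fun a => V a v) {x : W → L2 ι H} (hx : Continuous x) :
    Continuous fun a => amplifyUnitary (V a) (x a) := by
  refine continuous_iff_continuousAt.2 fun a => ?_
  refine tendsto_iff_norm_sub_tendsto_zero.2 ?_
  have h1 := tendsto_iff_norm_sub_tendsto_zero.1 (hx.tendsto a)
  have h2 := tendsto_iff_norm_sub_tendsto_zero.1 ((continuous_amplifyUnitary hV (x a)).tendsto a)
  refine squeeze_zero (fun _ => norm_nonneg _) (fun b => ?_) (by simpa using h1.add h2)
  calc ‖amplifyUnitary (V b) (x b) - amplifyUnitary (V a) (x a)‖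
      = ‖amplifyUnitary (V b) (x b - x a)
          + (amplifyUnitary (V b) (x a) - amplifyUnitary (V a) (x a))‖ := by
        rw [map_sub]; congr 1; abel
    _ ≤ _ := (norm_add_le _ _).trans (by rw [norm_amplifyUnitary])

variable {E : Submodule ℂ H} [CompleteSpace H]
  {C : Fin n → Fin n → Fin n → ℂ} {hbar : ℝ} {s : Fin n → Module.End ℂ E}
  {U : (Fin n → ℝ) → (H ≃ₗᵢ[ℂ] H)}

/-- The density in the Duhamel formula. -/
def duhamel (U : (Fin n → ℝ) → (H ≃ₗᵢ[ℂ] H)) (N : Matrix (Fin n) (Fin n) ℂ) (c : Fin n → ℂ)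
    (θ θ' : Fin n → ℝ) (σ : Fin n → L2 ι H) (t : ℝ) : L2 ι H :=
  ∑ k, c k • ∑ j, NormedSpace.exp ((1 - t) • N) k j •
    amplifyUnitary (U (t • θ')) (amplifyUnitary (U ((1 - t) • θ)) (σ j))

omit [CompleteSpace H] in
theorem IsUnitaryRep.continuous_duhamel (hU : IsUnitaryRep hbar s U) (hE : Dense (E : Set H))
    (hb : 0 < hbar) (hC : ∀ i k, s i * s k - s k * s i = ∑ j, C i k j • s j)
    {W : Type*} [TopologicalSpace W] (N : Matrix (Fin n) (Fin n) ℂ) (c : Fin n → ℂ)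
    (θ : Fin n → ℝ) {θ' : W → Fin n → ℝ} (hθ' : Continuous θ') (σ : Fin n → L2 ι H)
    {t : W → ℝ} (ht : Continuous t) :
    Continuous fun a => duhamel U N c θ (θ' a) σ (t a) := by
  have hc := hU.continuous_apply hE hb hC
  have h1 : ∀ k j, Continuous fun a => NormedSpace.exp ((1 - t a) • N) k j := fun k j =>
    (continuous_exp_smul_apply N k j).comp (f := fun a => 1 - t a) (by fun_prop)
  have h2 : ∀ j, Continuous fun a =>
      amplifyUnitary (U (t a • θ' a)) (amplifyUnitary (U ((1 - t a) • θ)) (σ j)) := fun j =>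
    continuous_amplifyUnitary_comp
      (fun v => (hc v).comp (f := fun a => t a • θ' a) (by fun_prop))
      (continuous_amplifyUnitary
        (fun v => (hc v).comp (f := fun a => (1 - t a) • θ) (by fun_prop)) (σ j))
  unfold duhamel
  exact continuous_finsetSum _ fun k _ =>
    (continuous_finsetSum _ fun j _ => (h1 k j).smul (h2 j)).const_smul (c k)

/-- The Duhamel density is norm continuous although the path is differentiable only weakly, so the
weak formula integrates to an identity between vectors, checked componentwise against E. -/
theorem IsUnitaryRep.apply_sub_eq_integral (hU : IsUnitaryRep hbar s U) (hE : Dense (E : Set H))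
    (hb : 0 < hbar) (hC : ∀ i k, s i * s k - s k * s i = ∑ j, C i k j • s j)
    {ψ : L2 ι H} {σ : Fin n → L2 ι H}
    (hσ : ∀ k (u : E) j, inner ℂ ((s k u : E) : H) (ψ j) = inner ℂ (u : H) (σ k j))
    (θ θ' : Fin n → ℝ) :
    amplifyUnitary (U θ') ψ - amplifyUnitary (U θ) ψ = ∫ t in (0 : ℝ)..1,
      duhamel U ((adMatrix C (phase hbar θ)).map conj) (phase hbar (θ' - θ)) θ θ' σ t := by
  have hcont := hU.continuous_duhamel hE hb hC ((adMatrix C (phase hbar θ)).map conj)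
    (phase hbar (θ' - θ)) θ (continuous_const (y := θ')) σ (t := fun t => t) continuous_id
  ext a
  refine hE.eq_of_inner_right ℂ fun u hu => ?_
  have h1 := (((innerSL ℂ u).comp (lp.evalCLM ℂ (fun _ : ι => H) 2 a)).intervalIntegral_comp_comm
    (hcont.intervalIntegrable (μ := volume) 0 1))
  refine Eq.trans ?_ h1
  have h2 := fun t => hU.hasDerivAt_inner_path hE hb hC (fun k u => hσ k u a) θ θ' ⟨u, hu⟩ t
  have e : ∀ t, ((innerSL ℂ u).comp (lp.evalCLM ℂ (fun _ : ι => H) 2 a))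
      (duhamel U ((adMatrix C (phase hbar θ)).map conj) (phase hbar (θ' - θ)) θ θ' σ t) =
      ∑ k, phase hbar (θ' - θ) k * ∑ j,
        NormedSpace.exp ((1 - t) • (adMatrix C (phase hbar θ)).map conj) k j *
          inner ℂ u (U (t • θ') (U ((1 - t) • θ) (σ j a))) := fun t => by
    simp only [duhamel, map_sum, map_smul, smul_eq_mul]
    rfl
  have hcont2 := ((innerSL ℂ u).comp (lp.evalCLM ℂ (fun _ : ι => H) 2 a)).continuous.comp hcont
  rw [intervalIntegral.integral_congr fun t _ => e t, intervalIntegral.integral_eq_sub_of_hasDerivAt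
    (fun t _ => h2 t) ?_]
  · simp [hU.apply_zero, inner_sub_right]
  · refine Continuous.intervalIntegrable ?_ _ _
    exact hcont2.congr e

/-- The derivatives of a family of states with finite second moments of the generators. -/
theorem IsUnitaryRep.hasDerivAt_amplify (hU : IsUnitaryRep hbar s U) (hE : Dense (E : Set H))
    (hb : 0 < hbar) (hC : ∀ i k, s i * s k - s k * s i = ∑ j, C i k j • s j)
    {ψ : L2 ι H} {σ : Fin n → L2 ι H}
    (hσ : ∀ k (u : E) j, inner ℂ ((s k u : E) : H) (ψ j) = inner ℂ (u : H) (σ k j))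
    (θ : Fin n → ℝ) (k : Fin n) :
    HasDerivAt (fun h : ℝ => amplifyUnitary (U (θ + h • Pi.single k 1)) ψ)
      ((Complex.I / hbar : ℂ) • ∑ j, conj (expQuot (adMatrix C (phase hbar θ)) k j) •
        amplifyUnitary (U θ) (σ j)) 0 := by
  set N := (adMatrix C (phase hbar θ)).map conj with hN
  set δ : Fin n → ℝ := Pi.single k 1 with hδ
  -- The density is linear in θ' - θ = hδ, so the difference quotient is this integral and its limit
  -- is the value at h = 0.
  have hcont : Continuous fun h : ℝ => ∫ t in (0 : ℝ)..1,
      duhamel U N (phase hbar δ) θ (θ + h • δ) σ t :=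
    intervalIntegral.continuous_parametric_intervalIntegral_of_continuous'
      (hU.continuous_duhamel hE hb hC N (phase hbar δ) θ
        (θ' := fun p : ℝ × ℝ => θ + p.1 • δ) (by fun_prop) σ continuous_snd) 0 1
  -- At h = 0 the two unitaries combine to U(θ), and what remains is ∫ e^{(1-t)N} dt = (e^N - 1)/N.
  have h0 : ∫ t in (0 : ℝ)..1, duhamel U N (phase hbar δ) θ (θ + (0 : ℝ) • δ) σ t =
      (Complex.I / hbar : ℂ) • ∑ j, conj (expQuot (adMatrix C (phase hbar θ)) k j) •
        amplifyUnitary (U θ) (σ j) := by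
    have e : ∀ t : ℝ, duhamel U N (phase hbar δ) θ (θ + (0 : ℝ) • δ) σ t =
        (Complex.I / hbar : ℂ) • ∑ j, NormedSpace.exp ((1 - t) • N) k j •
          amplifyUnitary (U θ) (σ j) := fun t => by
      rw [duhamel, Finset.sum_eq_single k]
      · congr 1
        · simp [phase, hδ]
        · refine Finset.sum_congr rfl fun j _ => ?_
          congr 1
          ext a
          simp only [zero_smul, add_zero, amplifyUnitary_apply]
          rw [← hU.map_add, add_sub_cancel, one_smul]
      · intro i _ hi
        simp [phase, hδ, hi]
      · simp
    rw [intervalIntegral.integral_congr fun t _ => e t, intervalIntegral.integral_smul,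
      intervalIntegral.integral_finsetSum]
    · congr 1
      refine Finset.sum_congr rfl fun j _ => ?_
      rw [intervalIntegral.integral_smul_const, integral_exp_smul_apply, hN, expQuot_map_conj,
        Matrix.map_apply]
    · intro j _
      refine Continuous.intervalIntegrable ?_ _ _
      exact ((continuous_exp_smul_apply N k j).comp
        (continuous_const.sub continuous_id)).smul continuous_const
  rw [hasDerivAt_iff_tendsto_slope_zero, ← h0]
  refine ((hcont.tendsto 0).mono_left nhdsWithin_le_nhds).congr' ?_
  filter_upwards [self_mem_nhdsWithin] with h hh
  have h1 := hU.apply_sub_eq_integral hE hb hC hσ θ (θ + h • δ)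
  have e : ∀ t : ℝ, duhamel U N (phase hbar (θ + h • δ - θ)) θ (θ + h • δ) σ t =
      h • duhamel U N (phase hbar δ) θ (θ + h • δ) σ t := fun t => by
    rw [add_sub_cancel_left, phase_smul, duhamel, duhamel, Finset.smul_sum]
    refine Finset.sum_congr rfl fun i _ => ?_
    rw [Pi.smul_apply, smul_eq_mul, mul_smul, Complex.coe_smul]
    rfl
  rw [zero_add, zero_smul, add_zero, h1, intervalIntegral.integral_congr fun t _ => e t,
    intervalIntegral.integral_smul, smul_smul, inv_mul_cancel₀ hh, one_smul]

end Amplification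

/-! ### Real matrices and real parts inside complex matrices -/

section RealMatrices

variable {n : ℕ}

/-- For symmetric real A the cross terms cancel: the form at x is the sum of its values at Re x and
Im x. -/
theorem _root_.Matrix.PosSemidef.map_ofReal {A : Matrix (Fin n) (Fin n) ℝ} (hA : A.PosSemidef) :
    (A.map Complex.ofReal).PosSemidef := by
  obtain ⟨hA1, hA2⟩ := Matrix.posSemidef_iff_dotProduct_mulVec.1 hA
  have hsymm : ∀ i j, A i j = A j i := fun i j => by
    have := congrFun (congrFun hA1 j) i
    simpa using this
  refine Matrix.posSemidef_iff_dotProduct_mulVec.2 ⟨?_, fun x => ?_⟩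
  · ext i j
    simp [hsymm i j, Complex.conj_ofReal]
  · have h1 := hA2 fun i => (x i).re
    have h2 := hA2 fun i => (x i).im
    have e : star x ⬝ᵥ (A.map Complex.ofReal *ᵥ x) =
        (((star fun i => (x i).re) ⬝ᵥ (A *ᵥ fun i => (x i).re) +
          (star fun i => (x i).im) ⬝ᵥ (A *ᵥ fun i => (x i).im) : ℝ) : ℂ) := by
      simp only [dotProduct, Matrix.mulVec, Finset.mul_sum, Matrix.map_apply, Pi.star_apply,
        star_trivial, RCLike.star_def]
      apply Complex.ext
      · rw [Complex.ofReal_re, Complex.re_sum, ← Finset.sum_add_distrib]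
        refine Finset.sum_congr rfl fun i _ => ?_
        rw [Complex.re_sum, ← Finset.sum_add_distrib]
        exact Finset.sum_congr rfl fun j _ => by simp
      · have h3 : ∀ i j, (conj (x i) * (↑(A i j) * x j)).im =
            A i j * ((x i).re * (x j).im) - A i j * ((x i).im * (x j).re) := fun i j => by
          simp; ring
        simp only [Complex.im_sum, h3, Complex.ofReal_im, Finset.sum_sub_distrib]
        rw [Finset.sum_comm, sub_eq_zero]
        refine Finset.sum_congr rfl fun i _ => Finset.sum_congr rfl fun j _ => ?_
        rw [hsymm]
        ring
    rw [e]
    exact_mod_cast add_nonneg h1 h2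

theorem map_ofReal_inv {A : Matrix (Fin n) (Fin n) ℝ} (hA : IsUnit A.det) :
    A⁻¹.map Complex.ofReal = (A.map Complex.ofReal)⁻¹ := by
  symm
  refine Matrix.inv_eq_right_inv ?_
  have h := congrArg (fun M : Matrix (Fin n) (Fin n) ℝ => Complex.ofRealHom.mapMatrix M)
    (Matrix.mul_nonsing_inv A hA)
  simp only [map_mul, map_one] at h
  exact h

theorem isUnit_det_map_ofReal {A : Matrix (Fin n) (Fin n) ℝ} :
    IsUnit (A.map Complex.ofReal).det ↔ IsUnit A.det := by
  have h : (A.map Complex.ofReal).det = (A.det : ℂ) := (Complex.ofRealHom.map_det A).symm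
  rw [h, isUnit_iff_ne_zero, isUnit_iff_ne_zero, Complex.ofReal_ne_zero]

/-- The real part of a complex matrix, as a complex matrix. -/
def realPart (A : Matrix (Fin n) (Fin n) ℂ) : Matrix (Fin n) (Fin n) ℂ :=
  (A.map Complex.re).map Complex.ofReal

theorem realPart_eq (A : Matrix (Fin n) (Fin n) ℂ) :
    realPart A = (2⁻¹ : ℂ) • (A + A.map conj) := by
  ext i j
  simp only [realPart, Matrix.map_apply, Matrix.smul_apply, Matrix.add_apply, smul_eq_mul]
  rw [Complex.add_conj]
  push_cast
  ring

theorem realPart_mul_mul {Q : Matrix (Fin n) (Fin n) ℂ} (hQ : Q.map conj = Q)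
    (S : Matrix (Fin n) (Fin n) ℂ) : realPart (Q * S * Qᵀ) = Q * realPart S * Qᵀ := by
  have h : (Q * S * Qᵀ).map conj = Q * S.map conj * Qᵀ := by
    conv_rhs => rw [← hQ]
    have h1 := map_mul ((starRingEnd ℂ).mapMatrix (m := Fin n)) (Q * S) Qᵀ
    have h2 := map_mul ((starRingEnd ℂ).mapMatrix (m := Fin n)) Q S
    exact h1.trans (congrArg (· * _) h2)
  rw [realPart_eq, realPart_eq, h]
  simp only [Matrix.mul_smul, Matrix.smul_mul, Matrix.mul_add, Matrix.add_mul]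

theorem realPart_smul (c : ℝ) (A : Matrix (Fin n) (Fin n) ℂ) :
    realPart ((c : ℂ) • A) = (c : ℂ) • realPart A := by
  ext i j
  simp [realPart]

end RealMatrices

/-! ### Cramér–Rao inequality for real parameters -/

section RealEstimates

variable {n : ℕ} {X : Type*} [MeasurableSpace X] {P : Measure X} {est : X → Fin n → ℝ}
  {ϑ : Fin n → ℝ}

/-- The Cramér–Rao inequality for real estimates. -/
theorem posSemidef_errMatrix_sub_real [IsFiniteMeasure P] {V : Type*} [NormedAddCommGroup V]
    [InnerProductSpace ℂ V] (he : ∀ i, MemLp (fun ω => (est ω i : ℂ)) 2 P) {w : Fin n → V}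
    (h : ∀ z : Fin n → ℝ, ∃ a b : V,
      ‖a‖ ^ 2 ≤ ∫ ω, ‖combErr (fun ω i => (est ω i : ℂ)) (fun i => (ϑ i : ℂ))
        (fun i => (z i : ℂ)) ω‖ ^ 2 ∂P ∧
      ‖b‖ ^ 2 ≤ ∫ ω, ‖combErr (fun ω i => (est ω i : ℂ)) (fun i => (ϑ i : ℂ))
        (fun i => (z i : ℂ)) ω‖ ^ 2 ∂P ∧
      ∀ k, (z k : ℂ) = inner ℂ (w k) b + inner ℂ a (w k))
    (hw : IsUnit (realPart (Matrix.gram ℂ w)).det) :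
    (errMatrix P (fun ω i => (est ω i : ℂ)) (fun i => (ϑ i : ℂ))
      - ((4 : ℂ) • realPart (Matrix.gram ℂ w))⁻¹).PosSemidef := by
  set R : Matrix (Fin n) (Fin n) ℝ := Matrix.of fun i j =>
    ∫ ω, (est ω i - ϑ i) * (est ω j - ϑ j) ∂P with hRdef
  have hR : errMatrix P (fun ω i => (est ω i : ℂ)) (fun i => (ϑ i : ℂ)) = R.map Complex.ofReal := by
    ext i j
    rw [errMatrix, Matrix.of_apply, Matrix.map_apply, hRdef, Matrix.of_apply,
      ← integral_complex_ofReal]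
    congr 1
    funext ω
    rw [map_sub, Complex.conj_ofReal, Complex.conj_ofReal]
    push_cast
    rfl
  have hRz : ∀ z : Fin n → ℝ, z ⬝ᵥ (R *ᵥ z) =
      ∫ ω, ‖combErr (fun ω i => (est ω i : ℂ)) (fun i => (ϑ i : ℂ))
        (fun i => (z i : ℂ)) ω‖ ^ 2 ∂P := fun z => by
    have h1 := dotProduct_errMatrix_mulVec (ϑ := fun i => (ϑ i : ℂ)) he (fun i => (z i : ℂ))
    rw [hR] at h1
    have h2 : (star fun i => (z i : ℂ)) ⬝ᵥ (R.map Complex.ofReal *ᵥ fun i => (z i : ℂ)) =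
        ((z ⬝ᵥ (R *ᵥ z) : ℝ) : ℂ) := by
      simp [dotProduct, Matrix.mulVec, Complex.conj_ofReal]
    rw [h2] at h1
    exact_mod_cast h1
  set G : Matrix (Fin n) (Fin n) ℝ := (Matrix.gram ℂ w).map Complex.re with hG
  have hGx : ∀ x : Fin n → ℝ, x ⬝ᵥ (G *ᵥ x) = ‖∑ k, (x k : ℂ) • w k‖ ^ 2 := fun x => by
    rw [← inner_self_eq_norm_sq (𝕜 := ℂ), sum_inner]
    simp only [inner_sum, inner_smul_left, inner_smul_right, dotProduct, Matrix.mulVec, hG,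
      Matrix.map_apply, Matrix.gram_apply, Finset.mul_sum, Complex.conj_ofReal, map_sum,
      RCLike.re_to_complex, Complex.re_ofReal_mul]
    exact Finset.sum_congr rfl fun i _ => Finset.sum_congr rfl fun j _ => by ring
  have hRp : R.PosSemidef := by
    refine Matrix.posSemidef_iff_dotProduct_mulVec.2 ⟨?_, fun z => ?_⟩
    · ext i j
      simp [hRdef, mul_comm]
    · rw [star_trivial, hRz]
      exact integral_nonneg fun ω => by positivity
  have hGp : G.PosSemidef := by
    refine Matrix.posSemidef_iff_dotProduct_mulVec.2 ⟨?_, fun x => ?_⟩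
    · ext i j
      simp only [hG, Matrix.conjTranspose_apply, Matrix.map_apply, Matrix.gram_apply, star_trivial]
      rw [← inner_conj_symm, Complex.conj_re]
    · rw [star_trivial, hGx]
      positivity
  have hmap : ((4 : ℝ) • G).map Complex.ofReal = (4 : ℂ) • realPart (Matrix.gram ℂ w) := by
    ext i j
    simp [hG, realPart]
  have hdet : IsUnit ((4 : ℝ) • G).det := by
    rw [← isUnit_det_map_ofReal, hmap, Matrix.det_smul]
    exact ((isUnit_iff_ne_zero.2 (by norm_num : (4 : ℂ) ≠ 0)).pow _).mul hw
  have key := posSemidef_sub_mul_inv_mul (R := R) (G := (4 : ℝ) • G) (B := 1) hRp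
    (hGp.smul (by norm_num)) hdet fun z x => by
      obtain ⟨a, b, ha, hb, hz⟩ := h z
      simp only [star_trivial, Matrix.one_mulVec, RCLike.re_to_real]
      rw [Matrix.smul_mulVec, dotProduct_smul, hGx, hRz, smul_eq_mul]
      set I := ∫ ω, ‖combErr (fun ω i => (est ω i : ℂ)) (fun i => (ϑ i : ℂ))
        (fun i => (z i : ℂ)) ω‖ ^ 2 ∂P
      set v := ∑ k, (x k : ℂ) • w k with hv
      have e : ((z ⬝ᵥ x : ℝ) : ℂ) = inner ℂ v b + inner ℂ a v := by
        rw [hv, sum_inner, inner_sum, ← Finset.sum_add_distrib, dotProduct]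
        push_cast
        refine Finset.sum_congr rfl fun k _ => ?_
        rw [inner_smul_left, inner_smul_right, Complex.conj_ofReal, hz]
        ring
      have h1 : ‖z ⬝ᵥ x‖ ≤ (‖a‖ + ‖b‖) * ‖v‖ := by
        rw [← Complex.norm_real, e]
        refine (norm_add_le _ _).trans ?_
        have := norm_inner_le_norm (𝕜 := ℂ) v b
        have := norm_inner_le_norm (𝕜 := ℂ) a v
        linarith
      -- The factor 4 arises from (‖a‖ + ‖b‖)² ≤ 2(‖a‖² + ‖b‖²) ≤ 4 I.
      calc ‖z ⬝ᵥ x‖ ^ 2 ≤ ((‖a‖ + ‖b‖) * ‖v‖) ^ 2 := by gcongr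
        _ = (‖a‖ + ‖b‖) ^ 2 * ‖v‖ ^ 2 := by ring
        _ ≤ (4 * I) * ‖v‖ ^ 2 := by
          gcongr
          nlinarith [sq_nonneg (‖a‖ - ‖b‖)]
        _ = _ := by ring
  have := key.map_ofReal
  rw [hR, ← hmap, ← map_ofReal_inv hdet]
  convert this using 1
  ext i j
  simp

end RealEstimates

/-! ### The bound on the orbit of a unitary representation -/

section UnitaryBound

variable {H : Type*} [NormedAddCommGroup H] [InnerProductSpace ℂ H] [CompleteSpace H] {n : ℕ}
  {ι : Type*} {E : Submodule ℂ H} {C : Fin n → Fin n → Fin n → ℂ} {hbar : ℝ}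
  {s : Fin n → Module.End ℂ E} {U : (Fin n → ℝ) → (H ≃ₗᵢ[ℂ] H)} {X : Type*} [MeasurableSpace X]

-- An estimate centered at its true value has mean zero, so its vectors a and b are orthogonal to φ.
-- Derivatives may then be replaced by their orthogonal parts, which gives covariances instead of
-- second moments.
omit [CompleteSpace H] in
theorem inner_orthPart_add {φ a b : L2 ι H} (ha : inner ℂ a φ = 0) (hb : inner ℂ φ b = 0)
    (l : L2 ι H) :
    inner ℂ (orthPart φ l) b + inner ℂ a (orthPart φ l) = inner ℂ l b + inner ℂ a l := by
  simp only [orthPart, inner_sub_left, inner_sub_right, inner_smul_left, inner_smul_right, ha, hb,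
    mul_zero, sub_zero]

/-- The bound for estimates that are unbiased on the orbit of a unitary representation. -/
theorem posSemidef_errMatrix_sub_unitary (hE : Dense (E : Set H)) (hb : 0 < hbar)
    (hC : ∀ i k, s i * s k - s k * s i = ∑ j, C i k j • s j) (hU : IsUnitaryRep hbar s U)
    {ψ : L2 ι H} {σ : Fin n → L2 ι H} (hψ : ‖ψ‖ = 1)
    (hσ : ∀ k (u : E) j, inner ℂ ((s k u : E) : H) (ψ j) = inner ℂ (u : H) (σ k j))
    {θ : Fin n → ℝ} (P : QPM X H) {est : X → Fin n → ℝ} (he : Measurable est)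
    (hM : ∃ M : ℝ≥0, ∀ᶠ t in 𝓝 θ, ∀ i,
      ∫⁻ ω, ‖est ω i‖ₑ ^ 2 ∂(P.law (amplifyUnitary (U t) ψ)) ≤ M)
    (hu : ∀ᶠ t in 𝓝 θ, ∀ i, ∫ ω, est ω i ∂(P.law (amplifyUnitary (U t) ψ)) = t i)
    (hQ : IsUnit (expQuot (adMatrix C (phase hbar θ))).det)
    (hS : IsUnit (realPart (covMatrix ψ s)).det) :
    (errMatrix (P.law (amplifyUnitary (U θ) ψ)) (fun ω i => (est ω i : ℂ)) (fun i => (θ i : ℂ))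
      - ((hbar : ℂ) ^ 2 / 4) • ((kMatrix (adMatrix C (phase hbar θ)))ᵀ *
        (realPart (covMatrix ψ s))⁻¹ * kMatrix (adMatrix C (phase hbar θ)))).PosSemidef := by
  set φ := amplifyUnitary (U θ) ψ with hφ
  set Q := expQuot (adMatrix C (phase hbar θ)) with hQdef
  have hS0 : covMatrix ψ s = Matrix.gram ℂ fun k => orthPart ψ (σ k) := covMatrix_eq_gram hE hσ
  -- A real relation among the generators kills the covariance matrix, hence also its real part,
  -- which is nonsingular.
  have hCi := conj_structureConst hE hC (hU.inner_gen hb) fun a ha => by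
    have h1 : ∑ k, (a k : ℂ) • orthPart ψ (σ k) = 0 := by
      rw [← orthPart_sum, sum_smul_eq_zero hE hσ ha]; simp [orthPart]
    have h2 : (covMatrix ψ s).map Complex.re *ᵥ a = 0 := by
      have := mulVec_gram_eq_zero (a := fun k => (a k : ℂ)) h1
      rw [← hS0] at this
      funext i
      have hi := congrArg Complex.re (congrFun this i)
      simpa [Matrix.mulVec, dotProduct] using hi
    rw [realPart, isUnit_det_map_ofReal] at hS
    exact (Matrix.mulVec_injective_iff_isUnit.2 ((Matrix.isUnit_iff_isUnit_det _).2 hS))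
      (h2.trans (Matrix.mulVec_zero _).symm)
  have hQr : Q.map conj = Q := by
    rw [hQdef, ← expQuot_map_conj, adMatrix_map_conj hbar hCi]
  have hQt : Qᴴ = Qᵀ := by
    conv_rhs => rw [← hQr]
    rfl
  have hT := P.isOutcomeFamily ι
  have hnorm : ∀ t, ‖amplifyUnitary (U t) ψ‖ = 1 := fun t => by rw [norm_amplifyUnitary, hψ]
  have hprob : ∀ t, IsProbabilityMeasure (P.law (amplifyUnitary (U t) ψ : ι → H)) := fun t =>
    hT.isProbabilityMeasure (hnorm t)
  obtain ⟨M, hM⟩ := hM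
  have hest : Measurable fun ω i => (est ω i : ℂ) := by fun_prop
  have hM' : ∀ᶠ t in 𝓝 θ, ∀ i,
      ∫⁻ ω, ‖(est ω i : ℂ)‖ₑ ^ 2 ∂(P.law (amplifyUnitary (U t) ψ)) ≤ M :=
    hM.mono fun t ht i => by simpa [enorm, Complex.nnnorm_real] using ht i
  have hu' : ∀ᶠ t in 𝓝 θ, ∀ i,
      ∫ ω, (est ω i : ℂ) ∂(P.law (amplifyUnitary (U t) ψ)) = (t i : ℂ) :=
    hu.mono fun t ht i => by rw [integral_complex_ofReal, ht i]
  have hmem : ∀ᶠ t in 𝓝 θ, ∀ i,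
      MemLp (fun ω => (est ω i : ℂ)) 2 (P.law (amplifyUnitary (U t) ψ : ι → H)) :=
    hM'.mono fun t ht => memLp_of_lintegral_le hest ht
  set w : Fin n → L2 ι H := fun k => (Complex.I / hbar : ℂ) •
    ∑ j, conj (Q k j) • orthPart φ (amplifyUnitary (U θ) (σ j)) with hw
  have hgram : Matrix.gram ℂ w = (((hbar ^ 2)⁻¹ : ℝ) : ℂ) • (Q * covMatrix ψ s * Qᵀ) := by
    rw [hS0, ← hQt, ← gram_orthPart_of_inner (V := fun j => amplifyUnitary (U θ) (σ j)) (φ := φ)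
      (fun i k => inner_amplifyUnitary _ _ _) (fun k => inner_amplifyUnitary _ _ _)
      (inner_amplifyUnitary _ _ _), ← gram_sum_eq]
    ext i k
    simp only [hw, Matrix.gram_apply, Matrix.smul_apply, inner_smul_left, inner_smul_right,
      smul_eq_mul, ← mul_assoc]
    congr 1
    simp only [map_div₀, Complex.conj_I, Complex.conj_ofReal]
    push_cast
    have : (hbar : ℂ) ≠ 0 := by exact_mod_cast hb.ne'
    field_simp
    simp
  have hreal : realPart (Matrix.gram ℂ w) =
      (((hbar ^ 2)⁻¹ : ℝ) : ℂ) • (Q * realPart (covMatrix ψ s) * Qᵀ) := by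
    rw [hgram, realPart_smul, realPart_mul_mul hQr]
  have hh : (hbar : ℂ) ≠ 0 := by exact_mod_cast hb.ne'
  have hdet : IsUnit (realPart (Matrix.gram ℂ w)).det := by
    rw [hreal, Matrix.det_smul, Matrix.det_mul, Matrix.det_mul, Matrix.det_transpose]
    refine IsUnit.mul (IsUnit.pow _ (isUnit_iff_ne_zero.2 ?_)) ((hQ.mul hS).mul hQ)
    push_cast
    positivity
  have := hprob θ
  have key := posSemidef_errMatrix_sub_real (ϑ := θ) hmem.self_of_nhds (w := w) (fun z => by
    have hf := measurable_combErr hest (fun i => (θ i : ℂ)) fun i => (z i : ℂ)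
    have hint : ∀ᶠ t in 𝓝 θ, ∫ ω, combErr (fun ω i => (est ω i : ℂ)) (fun i => (θ i : ℂ))
        (fun i => (z i : ℂ)) ω ∂(P.law (amplifyUnitary (U t) ψ)) =
        ∑ i, (z i : ℂ) * ((t i : ℂ) - θ i) := by
      filter_upwards [hmem, hu'] with t ht htu
      have := hprob t
      rw [integral_combErr ht]
      simp only [htu, Complex.conj_ofReal]
    obtain ⟨M', hM'b⟩ := lintegral_combErr_le hest (fun i => (θ i : ℂ)) (fun i => (z i : ℂ)) M
    have hbd : ∀ᶠ t in 𝓝 θ, ∫⁻ ω, ‖combErr (fun ω i => (est ω i : ℂ)) (fun i => (θ i : ℂ))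
        (fun i => (z i : ℂ)) ω‖ₑ ^ 2 ∂(P.law (amplifyUnitary (U t) ψ)) ≤ M' := by
      filter_upwards [hM'] with t ht
      have := hprob t
      exact hM'b _ prob_le_one ht
    obtain ⟨a, b, ha, hb', ha0, hb0, hder⟩ := exists_moment_vectors hT hf (u := φ)
      (integrable_norm_sq_of_lintegral_le hf hbd.self_of_nhds).1
    have h0 := hint.self_of_nhds
    simp only [sub_self, mul_zero, Finset.sum_const_zero] at h0
    rw [h0] at ha0 hb0
    refine ⟨a, b, ha, hb', fun k => ?_⟩
    have hline : Tendsto (fun h : ℝ => θ + h • (Pi.single k 1 : Fin n → ℝ)) (𝓝 0) (𝓝 θ) := by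
      have : Continuous fun h : ℝ => θ + h • (Pi.single k 1 : Fin n → ℝ) := by fun_prop
      simpa using this.tendsto 0
    have hd := hder (fun h : ℝ => amplifyUnitary (U (θ + h • Pi.single k 1)) ψ) _ (by simp [hφ])
      (hU.hasDerivAt_amplify hE hb hC hσ θ k) ⟨M', hline.eventually hbd⟩
    -- Unbiasedness makes the mean of the combined error equal to h z_k along the k-th coordinate
    -- line.
    have hd2 : HasDerivAt (fun h : ℝ => ((h : ℝ) : ℂ) * (z k : ℂ)) (z k : ℂ) 0 := by
      simpa using (Complex.ofRealCLM.hasDerivAt (x := (0 : ℝ))).mul_const (z k : ℂ)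
    have hz := hd2.unique (hd.congr_of_eventuallyEq (by
      filter_upwards [hline.eventually hint] with h hh
      rw [hh, Finset.sum_eq_single k]
      · simp [mul_comm]
      · intro i _ hi
        simp [hi]
      · simp))
    have hwk : w k = orthPart φ ((Complex.I / hbar : ℂ) • ∑ j, conj (Q k j) •
        amplifyUnitary (U θ) (σ j)) := by
      rw [hw, orthPart_smul, orthPart_sum]
    rw [hz, hwk]
    exact (inner_orthPart_add ha0 hb0 _).symm) hdet
  convert key using 2
  rw [hreal]
  have e1 : (4 : ℂ) • ((((hbar ^ 2)⁻¹ : ℝ) : ℂ) • (Q * realPart (covMatrix ψ s) * Qᵀ)) =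
      (4 * ((hbar : ℂ) ^ 2)⁻¹) • (Q * realPart (covMatrix ψ s) * Qᵀ) := by
    rw [smul_smul]
    push_cast
    rfl
  rw [e1]
  symm
  refine Matrix.inv_eq_right_inv ?_
  have h1 : Q * (realPart (covMatrix ψ s)) * Qᵀ * ((kMatrix (adMatrix C (phase hbar θ)))ᵀ *
        (realPart (covMatrix ψ s))⁻¹ * kMatrix (adMatrix C (phase hbar θ))) = 1 := by
    have hK : kMatrix (adMatrix C (phase hbar θ)) = Q⁻¹ := rfl
    have hQQ : Qᵀ * Q⁻¹ᵀ = 1 := by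
      rw [← Matrix.transpose_mul, Matrix.nonsing_inv_mul Q hQ, Matrix.transpose_one]
    rw [hK]
    calc Q * realPart (covMatrix ψ s) * Qᵀ * (Q⁻¹ᵀ * (realPart (covMatrix ψ s))⁻¹ * Q⁻¹)
        = Q * realPart (covMatrix ψ s) * (Qᵀ * Q⁻¹ᵀ) * (realPart (covMatrix ψ s))⁻¹ * Q⁻¹ := by
          simp only [Matrix.mul_assoc]
      _ = Q * (realPart (covMatrix ψ s) * (realPart (covMatrix ψ s))⁻¹) * Q⁻¹ := by
          rw [hQQ, Matrix.mul_one, Matrix.mul_assoc Q]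
      _ = 1 := by rw [Matrix.mul_nonsing_inv _ hS, Matrix.mul_one, Matrix.mul_nonsing_inv _ hQ]
  rw [Matrix.smul_mul, Matrix.mul_smul, h1, smul_smul]
  have : 4 * ((hbar : ℂ) ^ 2)⁻¹ * ((hbar : ℂ) ^ 2 / 4) = 1 := by field_simp
  rw [this, one_smul]

end UnitaryBound

end LieBound

end

theorem mainTheorem6 {H : Type*} [NormedAddCommGroup H] [InnerProductSpace ℂ H] [CompleteSpace H]
    {X : Type*} [MeasurableSpace X] {ι : Type*} {n : ℕ}
    (E : Submodule ℂ H) (hE : Dense (E : Set H)) (C : Fin n → Fin n → Fin n → ℂ) :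
    -- the canonical family of arbitrary generators of a Lie algebra
    (∀ x : Fin n → Module.End ℂ E,
      (∀ i k, x i * x k - x k * x i = ∑ j, C i k j • x j) →
      -- `y k` is the restriction of `(x k)*` to an invariant domain `D`
      ∀ (D : Submodule ℂ H) (y : Fin n → Module.End ℂ D),
      (∀ (k : Fin n) (u : E) (v : D),
        inner ℂ ((x k u : E) : H) (v : H) = inner ℂ (u : H) ((y k v : D) : H)) →
      ∀ ψ : ι → D, HasSum (fun j => ‖(ψ j : H)‖ ^ 2) 1 →
      ∀ r : ℝ, 0 < r → LieBound.JointlyAnalytic y ψ r →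
      (∀ᶠ b : Fin n → ℂ in 𝓝 0, IsUnit (LieBound.expQuot (LieBound.adMatrix C (star b))).det) ∧
      ∀ β : Fin n → ℂ, (∀ k, ‖β k‖ < r) →
        let φ : (Fin n → ℂ) → ι → H := LieBound.canonVec y ψ
        let S := LieBound.covMatrix (φ β) x
        let Q := LieBound.expQuot (LieBound.adMatrix C (star β))
        let K := LieBound.kMatrix (LieBound.adMatrix C (star β))
        -- the states are density operators with finite second moments of the generators
        HasSum (fun j => ‖φ β j‖ ^ 2) 1 ∧
        (∀ k j, φ β j ∈ (LieBound.opOn (x k)).adjoint.domain) ∧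
        (∀ k, Summable fun j => ‖LieBound.adjApply (LieBound.opOn (x k)) (φ β j)‖ ^ 2) ∧
        -- the right logarithmic derivatives and the right Fisher information
        LieBound.IsRightLogDeriv (LieBound.canonState y ψ) β
          (fun k => LieBound.opOn (LieBound.centered (φ β) (∑ j, Q k j • x j))) ∧
        (∀ h : Fin n → H →ₗ.[ℂ] H, LieBound.IsRightLogDeriv (LieBound.canonState y ψ) β h →
          LieBound.rightFisher (φ β) h = Q * S * Qᴴ) ∧
        -- the uncertainty bound
        ∀ (m : ℕ) (P : LieBound.QPM X H) (est : X → Fin m → ℂ), Measurable est →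
          ∀ ϑ : (Fin n → ℂ) → Fin m → ℂ, DifferentiableAt ℝ ϑ β →
          (∃ M : ℝ≥0, ∀ᶠ b in 𝓝 β, ∀ i, ∫⁻ ω, ‖est ω i‖ₑ ^ 2 ∂(P.law (φ b)) ≤ M) →
          (∀ᶠ b in 𝓝 β, ∀ i, ∫ ω, est ω i ∂(P.law (φ b)) = ϑ b i) →
          IsUnit Q.det → IsUnit S.det →
          let D' : Matrix (Fin m) (Fin n) ℂ :=
            Matrix.of fun i k => LieBound.wirtinger (fun b => ϑ b i) β k
          (LieBound.errMatrix (P.law (φ β)) est (ϑ β)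
            - D' * Kᴴ * S⁻¹ * K * D'ᴴ).PosSemidef) ∧
    -- Hermitian generators, unbiased estimation of `θ = ħ Im β` near `β = i θ / ħ`
    (∀ hbar : ℝ, 0 < hbar → ∀ s : Fin n → Module.End ℂ E,
      (∀ i k, s i * s k - s k * s i = ∑ j, C i k j • s j) →
      (∀ (k : Fin n) (u v : E),
        inner ℂ ((s k u : E) : H) (v : H) = inner ℂ (u : H) ((s k v : E) : H)) →
      ∀ ψ : ι → E, HasSum (fun j => ‖(ψ j : H)‖ ^ 2) 1 →
      ∀ r : ℝ, 0 < r → LieBound.JointlyAnalytic s ψ r →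
      ∀ θ : Fin n → ℝ, (∀ k, |θ k| / hbar < r) →
        let φ : (Fin n → ℂ) → ι → H := LieBound.canonVec s ψ
        let βθ : Fin n → ℂ := fun k => Complex.I * θ k / hbar
        let S₀ := LieBound.covMatrix (fun j => (ψ j : H)) s
        let K := LieBound.kMatrix (LieBound.adMatrix C βθ)
        ∀ (P : LieBound.QPM X H) (est : X → Fin n → ℝ), Measurable est →
          (∃ M : ℝ≥0, ∀ᶠ b in 𝓝 βθ, ∀ i, ∫⁻ ω, ‖est ω i‖ₑ ^ 2 ∂(P.law (φ b)) ≤ M) →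
          (∀ᶠ b in 𝓝 βθ, ∀ i, ∫ ω, est ω i ∂(P.law (φ b)) = hbar * (b i).im) →
          IsUnit (LieBound.expQuot (LieBound.adMatrix C βθ)).det → IsUnit S₀.det →
          (LieBound.errMatrix (P.law (φ βθ)) (fun ω i => (est ω i : ℂ)) (fun i => (θ i : ℂ))
            - ((hbar : ℂ) ^ 2 / 4) • (Kᵀ * S₀⁻¹ * K)).PosSemidef) ∧
    -- unitary representation, estimation unbiased on the states `U(θ) ρ₀ U(θ)*` only
    (∀ hbar : ℝ, 0 < hbar → ∀ s : Fin n → Module.End ℂ E,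
      (∀ i k, s i * s k - s k * s i = ∑ j, C i k j • s j) →
      ∀ U : (Fin n → ℝ) → (H ≃ₗᵢ[ℂ] H), LieBound.IsUnitaryRep hbar s U →
      ∀ ψ : ι → H, HasSum (fun j => ‖ψ j‖ ^ 2) 1 →
      (∀ k j, ψ j ∈ (LieBound.opOn (s k)).adjoint.domain) →
      (∀ k, Summable fun j => ‖LieBound.adjApply (LieBound.opOn (s k)) (ψ j)‖ ^ 2) →
      ∀ θ : Fin n → ℝ,
        let φ : (Fin n → ℝ) → ι → H := fun t j => U t (ψ j)
        let βθ : Fin n → ℂ := fun k => Complex.I * θ k / hbar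
        -- the symmetric covariances `Tr ½(s_i s_k + s_k s_i) ρ₀` of the centered generators
        let S₀ : Matrix (Fin n) (Fin n) ℂ :=
          Matrix.of fun i k => (((LieBound.covMatrix ψ s i k).re : ℝ) : ℂ)
        let K := LieBound.kMatrix (LieBound.adMatrix C βθ)
        ∀ (P : LieBound.QPM X H) (est : X → Fin n → ℝ), Measurable est →
          (∃ M : ℝ≥0, ∀ᶠ t in 𝓝 θ, ∀ i, ∫⁻ ω, ‖est ω i‖ₑ ^ 2 ∂(P.law (φ t)) ≤ M) →
          (∀ᶠ t in 𝓝 θ, ∀ i, ∫ ω, est ω i ∂(P.law (φ t)) = t i) →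
          IsUnit (LieBound.expQuot (LieBound.adMatrix C βθ)).det → IsUnit S₀.det →
          (LieBound.errMatrix (P.law (φ θ)) (fun ω i => (est ω i : ℂ)) (fun i => (θ i : ℂ))
            - ((hbar : ℂ) ^ 2 / 4) • (Kᵀ * S₀⁻¹ * K)).PosSemidef) := by
  refine ⟨fun x hC D y hxy ψ hψ r hr h =>
    ⟨LieBound.eventually_isUnit_det_expQuot_adMatrix C, fun β hβ' => ?_⟩, ?_, ?_⟩
  · have hβ : ‖β‖ < r := (pi_norm_lt_iff hr).2 hβ'
    have hadj : ∀ k j, ∃ hv : LieBound.canonVec y ψ β j ∈ (LieBound.opOn (x k)).adjoint.domain,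
        (LieBound.opOn (x k)).adjoint ⟨_, hv⟩ = LieBound.genCanonL2 h k β j := fun k j => by
      rw [LieBound.canonVec_eq h hβ]
      exact LieBound.exists_mem_opOn_adjoint_domain hE _ fun u =>
        LieBound.inner_canonL2 hxy h hβ k u j
    refine ⟨?_, fun k j => (hadj k j).1, fun k => ?_,
      LieBound.isRightLogDeriv_canonState hE hC hxy hψ h hβ,
      fun f hf => LieBound.rightFisher_eq hE hC hxy hψ h hβ hf,
      fun m P est he ϑ hϑ hM hu hQ hS =>
        LieBound.posSemidef_errMatrix_sub_canonVec hE hC hxy hψ h hβ P he hϑ hM hu hQ hS⟩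
    · have := LieBound.L2.hasSum_norm_sq (LieBound.canonL2 h β)
      rw [LieBound.norm_canonL2 hE hxy hψ h hβ, one_pow] at this
      rwa [LieBound.canonVec_eq h hβ]
    · refine (LieBound.L2.hasSum_norm_sq (LieBound.genCanonL2 h k β)).summable.congr fun j => ?_
      rw [LieBound.adjApply, dif_pos (hadj k j).1, (hadj k j).2]
  · intro hbar hb s hC hs ψ hψ r hr h θ hθ φ βθ S₀ K P est he hM hu hQ hS
    exact LieBound.posSemidef_errMatrix_sub_hermitian hE hb hC hs hψ h hr hθ rfl P he hM hu hQ hS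
  · intro hbar hb s hC U hU ψ hψ hdom hsum θ φ βθ S₀ K P est he hM hu hQ hS
    have h1 := LieBound.L2.hasSum_norm_sq (LieBound.toL2 ψ hψ.summable)
    have hψ1 : ‖LieBound.toL2 ψ hψ.summable‖ = 1 :=
      (pow_eq_one_iff_of_nonneg (norm_nonneg _) two_ne_zero).1 (h1.unique hψ)
    exact LieBound.posSemidef_errMatrix_sub_unitary (σ := fun k => LieBound.toL2 _ (hsum k))
      hE hb hC hU hψ1
      (fun k u j => LieBound.adjApply_opOn_spec hE (s k) (hdom k j) u) P he hM hu hQ hS
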